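/- Let $J=\mathbb{R}^5$ with coordinates $(x,y,z,p,q)$, let $\varpi=dz-p\,dx-q\,dy$, and let $\Upsilon$ be the symmetric 4-tensor \begin{align*} \Upsilon&=81dp^4-216dp^3dx+216dp^2dq\,dy+144dp^2dx^2+24dp\,dq^3-288dp\,dq\,dx\,dy-384dp\,dy^3-48dq^2dy^2+512dx\,dy^3 . \end{align*} (1) $[\varpi,\Upsilon]$ is a contact structure of $G_2$ type: there is a smooth bundle isomorphism from the trivial bundle of binary cubics $S^3(\mathbb{R}^2)$ onto $\mathcal{C}=\ker\varpi$ under which $d\varpi|_{\mathcal{C}}$ is a nowhere zero multiple of the $SL(2,\mathbb{R})$-invariant symplectic form and $\Upsilon|_{\mathcal{C}}$ is a nowhere zero multiple of the discriminant. (2) It is associated to the solution of Noth's equation parametrized by $$(t,H)=\left(\frac{2s^{1/3}}{s+2},-\frac{4s^{2/3}}{s+2}\right):$$ on each of the branches $0<s<1$ and $s>1$, $t$ runs through an open set on which the curve is the graph of a smooth function $H(t)$ with $$10H''^3H^{(6)}-70H''^2H'''H^{(5)}-49H''^2H''''^2+280H''H'''^2H''''-175H'''^4=0,$$ and, for a suitable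 primitive $\int H\,dt$, $\Upsilon$ vanishes at every tangent vector annihilated by both of the forms \begin{align*} \omega_2&=dp+\Bigl(t^2H_t-2tH+2\textstyle\int H\,dt\Bigr)dx+(H-tH_t)dy,\\ \omega_3&=dq+(H-tH_t)dx+H_t\,dy . \end{align*} (3) Let $\mathfrak{g}$ be the set of smooth vector fields $X$ on $J$ with $\mathcal{L}_X\varpi\equiv0\bmod\varpi$ and $\mathcal{L}_X\Upsilon\equiv0\bmod\varpi,\Upsilon$ (the symmetry algebra). Then $\mathfrak{g}$ is a Lie algebra isomorphic to the split real form of $\mathfrak{g}_2$, with basis the 14 vector fields \begin{align*} S^1&=-(-3qx-6y^2+\frac{9}{4}pq)\partial_x-(3z-3px-4qy+\frac{9}{8}p^2)\partial_y-(-8xy^2-3pqx-2q^2y+\frac{9}{4}p^2q)\partial_z\\&\quad{}+8y^2\partial_p-(12py-q^2-16xy)\partial_q,\\ L^2&=-(-\frac{9}{2}px+\frac{27}{16}p^2+\frac{3}{2}z+2x^2)\partial_x-\frac{1}{4}q^2\partial_y-(-\frac{9}{4}p^2x+\frac{9}{8}p^3+\frac{1}{6}q^3+2x z)\partial_z\\&\quad{}-(2z-2px+\frac{3}{4}p^2)\partial_p+(\frac{3}{2}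 pq-2 qx)\partial_q,\\ S^3&=-\frac{3}{2}y\partial_x-\frac{1}{2}q\partial_y-(2 x y+\frac{1}{4}q^2)\partial_z-2y \partial_p+(\frac{3}{2}p-2x)\partial_q,\\ L^{4}&=\frac{3}{4}\partial_x+x\partial_z+\partial_p,\quad S^{5}=\partial_y,\quad L^{6}=\partial_z,\quad S^{7}=y\partial_z+\partial_q,\quad L^{8}=\partial_{x},\\ S^{9}&=\frac{3}{4}q\partial_x+\frac{3}{4}p\partial_y+(\frac{3}{4}pq+2y^2)\partial_z+4y \partial_q,\\ L^{10}&=(\frac{3}{4}qy+\frac{27}{32}p^2-\frac{3}{4}z)\partial_x+\frac{3}{4}py\partial_y+(\frac{3}{4}pqy+\frac{9}{16}p^3+\frac{2}{3}y^3)\partial_z+\frac{3}{4}p^2\partial_p+2y^2\partial_q,\\ S^{11}&=(\frac{3}{8}q^2+\frac{9}{4}py)\partial_x+(\frac{3}{4}pq+y^2)\partial_y+(\frac{3}{4}pq^2+\frac{9}{8}p^2y+3yz)\partial_z+3py\partial_p-(-3z+\frac{9}{8}p^2-q y)\partial_q,\\ L^{12}&=(3zx+\frac{1}{8}q^3-3qxy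 - 2y^3 - \frac{27}{8}p^2x+\frac{27}{16}p^3+\frac{9}{4}pqy)\partial_x+(3yz - 3pxy +\frac{3}{8}pq^2- 2qy^2 + \frac{9}{8}p^2y)\partial_y\\ &\quad{}+(-\frac{9}{4}p^3x-\frac{8}{3}xy^3+3z^2+\frac{3}{8}q^3p-q^2y^2+\frac{9}{4}qy p^2+\frac{81}{64}p^4-3 x p q y)\partial_z\\&\quad{}+(3pz-3p^2 x-\frac{8}{3}y^3+\frac{9}{8}p^3)\partial_p-(-3 q z+\frac{9}{8}p^2 q-6 p y^2+q^2 y+8 x y^2)\partial_q,\\ h_1&=-(\frac{9}{4}p-\frac{3}{2}x)\partial_x-\frac{1}{2}y\partial_y-\frac{9}{8}p^2\partial_z-\frac{3}{2}p \partial_p+\frac{1}{2}q\partial_q,\\ h_2&=\frac{\sqrt{3}}{2}(x\partial_x+y\partial_y+2 z \partial_z+p \partial_p+q\partial_q). \end{align*} Moreover every smooth vector field on a connected open subset of $J$ that satisfies the same two congruences there is the restriction of an element of $\mathfrak{g}$. (4) The span of $h_1,h_2$ is a Cartan subalgebra of $\mathfrak{g}$, $[h_1,h_2]=0$, and $h_1,h_2$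 are orthogonal and of equal length for the Killing form. The 12 other fields are root vectors forming a $G_2$ root diagram: for $i=1,\dots,12$ let $X^i$ be $S^i$ if $i$ is odd and $L^i$ if $i$ is even; then $[h_1,X^i]=\alpha_iX^i$ and $[h_2,X^i]=\beta_iX^i$ with $$(\alpha_i,\beta_i)=r_i\left(\sin\tfrac{\pi i}{6},\cos\tfrac{\pi i}{6}\right),\qquad r_i=1\ (i\text{ odd, short roots}),\quad r_i=\sqrt3\ (i\text{ even, long roots}),$$ so that $(\alpha_i,\beta_i)$ points to hour $i$ of a clock face. -/

import Mathlib

open Set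
open scoped ContDiff

noncomputable section

namespace ContactG2

/-- The coordinate space with coordinates `(x, y, z, p, q) = (u 0, u 1, u 2, u 3, u 4)`.
A tangent vector `v` has components `v 0 = dx v, …, v 4 = dq v`. -/
abbrev J : Type := Fin 5 → ℝ

/-! ### The Lie algebra of smooth vector fields -/

/-- The real vector space of smooth vector fields on `J`. -/
def VF : Submodule ℝ (J → J) where
  carrier := {X | ContDiff ℝ ∞ X}
  add_mem' {X Y} hX hY := by
    have h1 : ContDiff ℝ ∞ X := hX
    have h2 : ContDiff ℝ ∞ Y := hY
    exact h1.add h2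
  zero_mem' := by
    change ContDiff ℝ ∞ (fun _ : J => (0 : J))
    exact contDiff_const
  smul_mem' c X hX := by
    have h1 : ContDiff ℝ ∞ X := hX
    exact h1.const_smul c

theorem contDiff_coe (X : VF) : ContDiff ℝ ∞ (X : J → J) := X.2

theorem differentiableAt_coe (X : VF) (u : J) : DifferentiableAt ℝ (X : J → J) u :=
  ((contDiff_coe X).differentiable (by simp)) u

/-- The Lie bracket of vector fields, `[X, Y] = DY(X) - DX(Y)`. -/
instance : Bracket VF VF where
  bracket X Y := ⟨VectorField.lieBracket ℝ (X : J → J) (Y : J → J),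
    show ContDiff ℝ ∞ _ from
      (contDiff_coe X).lieBracket_vectorField (contDiff_coe Y) (m := ∞) (by simp)⟩

theorem coe_lie (X Y : VF) :
    ((⁅X, Y⁆ : VF) : J → J) = VectorField.lieBracket ℝ (X : J → J) (Y : J → J) := rfl

instance : LieRing VF where
  add_lie X Y Z := by
    apply Subtype.ext; funext u
    exact VectorField.lieBracket_add_left (differentiableAt_coe X u) (differentiableAt_coe Y u)
  lie_add X Y Z := by
    apply Subtype.ext; funext u
    exact VectorField.lieBracket_add_right (differentiableAt_coe Y u) (differentiableAt_coe Z u)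
  lie_self X := by
    apply Subtype.ext
    exact VectorField.lieBracket_self
  leibniz_lie X Y Z := by
    apply Subtype.ext; funext u
    exact VectorField.leibniz_identity_lieBracket (n := ∞)
      (by simpa using (WithTop.coe_le_coe.2 (le_top : (2 : ℕ∞) ≤ ⊤)))
      (contDiff_coe X).contDiffAt (contDiff_coe Y).contDiffAt (contDiff_coe Z).contDiffAt

instance : LieAlgebra ℝ VF where
  lie_smul c X Y := by
    apply Subtype.ext; funext u
    exact VectorField.lieBracket_const_smul_right (differentiableAt_coe Y u)

/-! ### Symmetric covariant tensors, Lie derivatives, symmetries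

A symmetric covariant `k`-tensor field `T` is written as the function `T u v` that is, for each
point `u`, the associated homogeneous polynomial of degree `k` in the tangent vector `v`. In
particular a 1-form `α` is written as `α u v = α_u(v)`. -/

/-- The Lie derivative `L_X T` of a symmetric covariant tensor field: the derivative at `ε = 0` of
`T (φ_ε u) (Dφ_ε v)` for the flow `φ` of `X`. -/
def lieDeriv (X : J → J) (T : J → J → ℝ) (u v : J) : ℝ :=
  fderiv ℝ (fun w => T w v) u (X u) + fderiv ℝ (T u) v (fderiv ℝ X u v)

/-- `X` is on `U` an infinitesimal symmetry of the structure `[α, T]`: `L_X α ≡ 0 mod α` and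
`L_X T ≡ 0 mod α, T`. The second congruence says that on the contact hyperplanes `α = 0` the
tensor `L_X T` is a multiple of `T`. -/
def IsSymmetryOn (α T : J → J → ℝ) (U : Set J) (X : J → J) : Prop :=
  (∃ a : J → ℝ, ∀ u ∈ U, ∀ v, lieDeriv X α u v = a u * α u v) ∧
  (∃ b : J → ℝ, ∀ u ∈ U, ∀ v, α u v = 0 → lieDeriv X T u v = b u * T u v)

/-! ### Contact structures of `G₂` type -/

/-- The exterior derivative of a 1-form: `dα(v, w) = ∂_v (α w) - ∂_w (α v)`. -/
def extD (α : J → J → ℝ) (u v w : J) : ℝ :=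
  fderiv ℝ (fun x => α x w) u v - fderiv ℝ (fun x => α x v) u w

/-- The `SL(2)`-invariant symplectic form on binary cubics
`a₀ X³ + 3 a₁ X² Y + 3 a₂ X Y² + a₃ Y³`. -/
def cubicSymp (a b : Fin 4 → ℝ) : ℝ :=
  a 0 * b 3 - 3 * a 1 * b 2 + 3 * a 2 * b 1 - a 3 * b 0

/-- The `SL(2)`-invariant quartic on binary cubics `a₀ X³ + 3 a₁ X² Y + 3 a₂ X Y² + a₃ Y³`
(the discriminant, up to a constant factor). -/
def cubicDisc (a : Fin 4 → ℝ) : ℝ :=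
  (a 0 * a 3 - a 1 * a 2) ^ 2 - 4 * (a 0 * a 2 - a 1 ^ 2) * (a 1 * a 3 - a 2 ^ 2)

/-- `[α, T]` is a contact structure of type `G₂` on `J`: the hyperplane bundle `C = {α = 0}` is
identified, by a smooth bundle isomorphism `Φ`, with the third symmetric power of a rank 2 bundle
(the binary cubics), so that the Levi form `dα|_C` is a nonzero multiple of the invariant
symplectic form and the structural tensor `T|_C` a nonzero multiple of the discriminant.
In particular `dα|_C` is nondegenerate, that is, `α` is a contact form. -/
def IsG2Contact (α T : J → J → ℝ) : Prop :=
  ∃ (Φ : J → ((Fin 4 → ℝ) →L[ℝ] J)) (c k : J → ℝ), ContDiff ℝ ∞ Φ ∧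
    ∀ u, Function.Injective (Φ u) ∧ Set.range (Φ u) = {v | α u v = 0} ∧
      c u ≠ 0 ∧ k u ≠ 0 ∧
      (∀ a b, extD α u (Φ u a) (Φ u b) = c u * cubicSymp a b) ∧
      (∀ a, T u (Φ u a) = k u * cubicDisc a)

/-- The contact form `ϖ = dz - p dx - q dy`. -/
def varpi (u v : J) : ℝ := v 2 - u 3 * v 0 - u 4 * v 1

/-- The quartic form `Υ` in the differentials `dx, dy, dp, dq`. -/
def upsilonPoly (dx dy dp dq : ℝ) : ℝ :=
  81 * dp ^ 4 - 216 * dp ^ 3 * dx + 216 * dp ^ 2 * dq * dy + 144 * dp ^ 2 * dx ^ 2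
    + 24 * dp * dq ^ 3 - 288 * dp * dq * dx * dy - 384 * dp * dy ^ 3
    - 48 * dq ^ 2 * dy ^ 2 + 512 * dx * dy ^ 3

/-- The structural tensor `Υ`, a symmetric 4-tensor with constant coefficients. -/
def upsilon (_u v : J) : ℝ := upsilonPoly (v 0) (v 1) (v 3) (v 4)

/-! ### Noth's equation and the associated structural 1-forms -/

/-- `H` is a smooth solution of Noth's equation on `D`. -/
def SolvesNoth (H : ℝ → ℝ) (D : Set ℝ) : Prop :=
  ContDiffOn ℝ ∞ H D ∧ ∀ t ∈ D,
    10 * iteratedDeriv 2 H t ^ 3 * iteratedDeriv 6 H t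
      - 70 * iteratedDeriv 2 H t ^ 2 * iteratedDeriv 3 H t * iteratedDeriv 5 H t
      - 49 * iteratedDeriv 2 H t ^ 2 * iteratedDeriv 4 H t ^ 2
      + 280 * iteratedDeriv 2 H t * iteratedDeriv 3 H t ^ 2 * iteratedDeriv 4 H t
      - 175 * iteratedDeriv 3 H t ^ 4 = 0

/-- The 1-form `ω₂ = dp + (t² H_t - 2 t H + 2 ∫ H dt) dx + (H - t H_t) dy`, with `F = ∫ H dt`. -/
def omega2 (H F : ℝ → ℝ) (t : ℝ) (v : J) : ℝ :=
  v 3 + (t ^ 2 * deriv H t - 2 * t * H t + 2 * F t) * v 0 + (H t - t * deriv H t) * v 1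

/-- The 1-form `ω₃ = dq + (H - t H_t) dx + H_t dy`. -/
def omega3 (H : ℝ → ℝ) (t : ℝ) (v : J) : ℝ :=
  v 4 + (H t - t * deriv H t) * v 0 + deriv H t * v 1

/-- `T` is a structural tensor associated to the solution `H` of Noth's equation on the open set
`D`: for a suitable primitive `F` of `H`, it vanishes on every common zero of `ω₂` and `ω₃`
(in particular on every common zero of `ω₂`, `ω₃` and `ω₄ = dy - t dx`). -/
def IsAssociatedToNoth (T : J → J → ℝ) (H : ℝ → ℝ) (D : Set ℝ) : Prop :=
  IsOpen D ∧ SolvesNoth H D ∧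
  ∃ F : ℝ → ℝ, (∀ t ∈ D, HasDerivAt F (H t) t) ∧
    ∀ t ∈ D, ∀ u v : J, omega2 H F t v = 0 → omega3 H t v = 0 → T u v = 0

/-- The `t`-component of the curve `(t, H) = (2 s^{1/3} / (s + 2), - 4 s^{2/3} / (s + 2))`. -/
def nothT (s : ℝ) : ℝ := 2 * s ^ (1 / 3 : ℝ) / (s + 2)

/-- The `H`-component of the curve `(t, H) = (2 s^{1/3} / (s + 2), - 4 s^{2/3} / (s + 2))`. -/
def nothH (s : ℝ) : ℝ := -(4 * s ^ (2 / 3 : ℝ) / (s + 2))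

/-! ### The fourteen vector fields

The entries of `![X₀, X₁, X₂, X₃, X₄]` are the coefficients of `∂_x, ∂_y, ∂_z, ∂_p, ∂_q`. -/

/-- A vector field given by its coefficients as functions of `x, y, z, p, q`. -/
def field (f : ℝ → ℝ → ℝ → ℝ → ℝ → J) (u : J) : J := f (u 0) (u 1) (u 2) (u 3) (u 4)

def S1 : J → J := field fun x y z p q =>
  ![-(-3 * q * x - 6 * y ^ 2 + 9 / 4 * p * q),
    -(3 * z - 3 * p * x - 4 * q * y + 9 / 8 * p ^ 2),
    -(-8 * x * y ^ 2 - 3 * p * q * x - 2 * q ^ 2 * y + 9 / 4 * p ^ 2 * q),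
    8 * y ^ 2,
    -(12 * p * y - q ^ 2 - 16 * x * y)]

def L2 : J → J := field fun x _y z p q =>
  ![-(-(9 / 2) * p * x + 27 / 16 * p ^ 2 + 3 / 2 * z + 2 * x ^ 2),
    -(1 / 4 * q ^ 2),
    -(-(9 / 4) * p ^ 2 * x + 9 / 8 * p ^ 3 + 1 / 6 * q ^ 3 + 2 * x * z),
    -(2 * z - 2 * p * x + 3 / 4 * p ^ 2),
    3 / 2 * p * q - 2 * q * x]

def S3 : J → J := field fun x y _z p q =>
  ![-(3 / 2 * y), -(1 / 2 * q), -(2 * x * y + 1 / 4 * q ^ 2), -(2 * y), 3 / 2 * p - 2 * x]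

def L4 : J → J := field fun x _y _z _p _q => ![3 / 4, 0, x, 1, 0]

def S5 : J → J := field fun _x _y _z _p _q => ![0, 1, 0, 0, 0]

def L6 : J → J := field fun _x _y _z _p _q => ![0, 0, 1, 0, 0]

def S7 : J → J := field fun _x y _z _p _q => ![0, 0, y, 0, 1]

def L8 : J → J := field fun _x _y _z _p _q => ![1, 0, 0, 0, 0]

def S9 : J → J := field fun _x y _z p q =>
  ![3 / 4 * q, 3 / 4 * p, 3 / 4 * p * q + 2 * y ^ 2, 0, 4 * y]

def L10 : J → J := field fun _x y z p q =>
  ![3 / 4 * q * y + 27 / 32 * p ^ 2 - 3 / 4 * z,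
    3 / 4 * p * y,
    3 / 4 * p * q * y + 9 / 16 * p ^ 3 + 2 / 3 * y ^ 3,
    3 / 4 * p ^ 2,
    2 * y ^ 2]

def S11 : J → J := field fun _x y z p q =>
  ![3 / 8 * q ^ 2 + 9 / 4 * p * y,
    3 / 4 * p * q + y ^ 2,
    3 / 4 * p * q ^ 2 + 9 / 8 * p ^ 2 * y + 3 * y * z,
    3 * p * y,
    -(-3 * z + 9 / 8 * p ^ 2 - q * y)]

def L12 : J → J := field fun x y z p q =>
  ![3 * z * x + 1 / 8 * q ^ 3 - 3 * q * x * y - 2 * y ^ 3 - 27 / 8 * p ^ 2 * x + 27 / 16 * p ^ 3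
      + 9 / 4 * p * q * y,
    3 * y * z - 3 * p * x * y + 3 / 8 * p * q ^ 2 - 2 * q * y ^ 2 + 9 / 8 * p ^ 2 * y,
    -(9 / 4) * p ^ 3 * x - 8 / 3 * x * y ^ 3 + 3 * z ^ 2 + 3 / 8 * q ^ 3 * p - q ^ 2 * y ^ 2
      + 9 / 4 * q * y * p ^ 2 + 81 / 64 * p ^ 4 - 3 * x * p * q * y,
    3 * p * z - 3 * p ^ 2 * x - 8 / 3 * y ^ 3 + 9 / 8 * p ^ 3,
    -(-3 * q * z + 9 / 8 * p ^ 2 * q - 6 * p * y ^ 2 + q ^ 2 * y + 8 * x * y ^ 2)]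

def h1 : J → J := field fun x y _z p q =>
  ![-(9 / 4 * p - 3 / 2 * x), -(1 / 2 * y), -(9 / 8 * p ^ 2), -(3 / 2 * p), 1 / 2 * q]

def h2 : J → J := field fun x y z p q =>
  (√3 / 2) • ![x, y, 2 * z, p, q]

/-- The twelve fields `S¹, L², …, S¹¹, L¹²`; the index `i` stands for the hour `i + 1`. -/
def rootField : Fin 12 → J → J := ![S1, L2, S3, L4, S5, L6, S7, L8, S9, L10, S11, L12]

/-- The twelve arrows of the `G₂` root diagram in the Euclidean plane: at hour `i + 1` of the
clock face, of length `1` at odd hours (short roots) and of length `√3` at even hours (long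
roots). -/
def rootArrow : Fin 12 → ℝ × ℝ :=
  ![(1 / 2, √3 / 2), (3 / 2, √3 / 2), (1, 0), (3 / 2, -(√3 / 2)), (1 / 2, -(√3 / 2)), (0, -√3),
    (-(1 / 2), -(√3 / 2)), (-(3 / 2), -(√3 / 2)), (-1, 0), (-(3 / 2), √3 / 2), (-(1 / 2), √3 / 2),
    (0, √3)]

end ContactG2

end

open ContactG2

namespace ContactG2

set_option linter.unusedSimpArgs false
set_option linter.unusedTactic false
set_option linter.unreachableTactic false
set_option linter.flexible false
set_option linter.unnecessarySeqFocus false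

/-! Everything is governed by the contact frame A = ∂ₓ + p∂_z, B = ∂_q, C = ∂_y + q∂_z, D = ∂_p +
(3/4)A. The only nonzero brackets are [B,C] = [D,A] = Z = ∂_z. With coordinates (a,b,c,d) in this
frame, Υ becomes 144a²d² - 288abcd + 24b³d + 512ac³ - 48b²c². The shift by 3/4 removes the dp⁴ and
dp³ terms. After rescaling to the cubic with coefficients (a/9, b/6, 2c, 9d) this is 144 times the
discriminant, and dϖ is the invariant symplectic form.

The fourteen fields are symmetries by direct polynomial computation. For the upper bound, a contact
field X is determined by its generating function f = ϖ(X): the frame derivatives of f give dx, dy,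
dp, dq of X. The condition on Υ turns into seven linear second-order equations on f (`symmEqs_ham`).
Invariantly, S²(S³) = S² ⊕ S⁶ under SL(2), and the equations remove the S⁶ part. Commuting
derivatives closes the system: f is determined by f, its four frame derivatives, Zf, BBf, CBf, BDf,
the Z-derivatives of the four frame derivatives, and ZZf at one point (`SymmEqs.eq_zero`). Grouping
Zf with the three second derivatives, these are 1 + 4 + 4 + 4 + 1 = 14 numbers, the contact grading
of 𝔤₂. The fourteen fields have independent jets of this kind, so they exhaust the symmetries on any
connected open set (`exists_eqOn_of_isSymmetryOn`).

For the isomorphism type, S³, L⁸ and multiples of S⁹, L² satisfy the Serre relations of type G₂,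
which gives a homomorphism from 𝔤₂ into vector fields (`exists_lieHom_of_isChevalleyG2`). The Serre
relations alone force 𝔤₂ to be spanned by fourteen explicit brackets (`IsChevalleyG2.span_eq_top`).
Their images are nonzero multiples of the root fields, together with two independent combinations of
h₁ and h₂. Independence of the fourteen fields therefore makes the homomorphism injective, and no
prior knowledge of dim 𝔤₂ is needed.

For Noth's equation put s = c³. Then t and H are rational in c, dt/dc vanishes on c > 0 only at c =
1, and d/dt = (c³+2)²/(4(1-c³)) d/dc. All derivatives of H are explicit rational functions of c.
Modulo ϖ, the equations ω₂ = ω₃ = 0 cut out the cubics with a double root at X/Y = -6/c, so Υ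
vanishes there. -/

theorem vec_congr {a₀ a₁ a₂ a₃ a₄ b₀ b₁ b₂ b₃ b₄ : ℝ} (h₀ : a₀ = b₀) (h₁ : a₁ = b₁)
    (h₂ : a₂ = b₂) (h₃ : a₃ = b₃) (h₄ : a₄ = b₄) :
    (![a₀, a₁, a₂, a₃, a₄] : J) = ![b₀, b₁, b₂, b₃, b₄] := by
  rw [h₀, h₁, h₂, h₃, h₄]

/-! ### The derivatives of the fourteen vector fields -/

theorem fderiv_coord (i : Fin 5) (u v : J) : fderiv ℝ (fun w : J => w i) u v = v i := by
  have h : HasFDerivAt (fun w : J => w i)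
      (ContinuousLinearMap.proj (R := ℝ) (φ := fun _ : Fin 5 => ℝ) i) u :=
    (ContinuousLinearMap.proj (R := ℝ) (φ := fun _ : Fin 5 => ℝ) i).hasFDerivAt
  rw [h.fderiv]; rfl

theorem fderiv_vec {f₀ f₁ f₂ f₃ f₄ : J → ℝ} {u : J} (h₀ : DifferentiableAt ℝ f₀ u)
    (h₁ : DifferentiableAt ℝ f₁ u) (h₂ : DifferentiableAt ℝ f₂ u) (h₃ : DifferentiableAt ℝ f₃ u)
    (h₄ : DifferentiableAt ℝ f₄ u) (v : J) :
    fderiv ℝ (fun w => (![f₀ w, f₁ w, f₂ w, f₃ w, f₄ w] : J)) u v =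
      ![fderiv ℝ f₀ u v, fderiv ℝ f₁ u v, fderiv ℝ f₂ u v, fderiv ℝ f₃ u v, fderiv ℝ f₄ u v] := by
  have h : HasFDerivAt (fun w => (![f₀ w, f₁ w, f₂ w, f₃ w, f₄ w] : J))
      (ContinuousLinearMap.pi ![fderiv ℝ f₀ u, fderiv ℝ f₁ u, fderiv ℝ f₂ u, fderiv ℝ f₃ u,
        fderiv ℝ f₄ u]) u := by
    rw [hasFDerivAt_pi]
    intro i
    fin_cases i
    exacts [h₀.hasFDerivAt, h₁.hasFDerivAt, h₂.hasFDerivAt, h₃.hasFDerivAt, h₄.hasFDerivAt]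
  rw [h.fderiv]
  ext i
  fin_cases i <;> rfl

theorem fderiv_S1 (u v : J) : fderiv ℝ S1 u v =
    ![3 * u 4 * v 0 + 12 * u 1 * v 1 + (-(9 / 4 * u 4)) * v 3 + (3 * u 0 - 9 / 4 * u 3) * v 4, 3 *
    u 3 * v 0 + 4 * u 4 * v 1 + (-3) * v 2 + (3 * u 0 - 9 / 4 * u 3) * v 3 + 4 * u 1 * v 4, (8 * u
    1 ^ 2 + 3 * u 3 * u 4) * v 0 + (16 * u 0 * u 1 + 2 * u 4 ^ 2) * v 1 + (3 * u 0 * u 4 - 9 / 2 *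
    u 3 * u 4) * v 3 + (3 * u 0 * u 3 + 4 * u 1 * u 4 - 9 / 4 * u 3 ^ 2) * v 4, 16 * u 1 * v 1, 16
    * u 1 * v 0 + (16 * u 0 - 12 * u 3) * v 1 + (-12 * u 1) * v 3 + 2 * u 4 * v 4] := by
  unfold S1 field
  rw [fderiv_vec (by fun_prop) (by fun_prop) (by fun_prop) (by fun_prop) (by fun_prop)]
  refine vec_congr ?_ ?_ ?_ ?_ ?_ <;>
    simp (disch := fun_prop) [fderiv_fun_add, fderiv_fun_sub, fderiv_fun_mul, fderiv_fun_pow,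
      fderiv_coord] <;> ring

theorem fderiv_L2 (u v : J) : fderiv ℝ L2 u v =
    ![(-4 * u 0 + 9 / 2 * u 3) * v 0 + (-(3 / 2)) * v 2 + (9 / 2 * u 0 - 27 / 8 * u 3) * v 3, (-(1
    / 2 * u 4)) * v 4, (-2 * u 2 + 9 / 4 * u 3 ^ 2) * v 0 + (-2 * u 0) * v 2 + (9 / 2 * u 0 * u 3
    - 27 / 8 * u 3 ^ 2) * v 3 + (-(1 / 2 * u 4 ^ 2)) * v 4, 2 * u 3 * v 0 + (-2) * v 2 + (2 * u 0
    - 3 / 2 * u 3) * v 3, (-2 * u 4) * v 0 + 3 / 2 * u 4 * v 3 + (-2 * u 0 + 3 / 2 * u 3) * v 4] := by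
  unfold L2 field
  rw [fderiv_vec (by fun_prop) (by fun_prop) (by fun_prop) (by fun_prop) (by fun_prop)]
  refine vec_congr ?_ ?_ ?_ ?_ ?_ <;>
    simp (disch := fun_prop) [fderiv_fun_add, fderiv_fun_sub, fderiv_fun_mul, fderiv_fun_pow,
      fderiv_coord] <;> ring

theorem fderiv_S3 (u v : J) : fderiv ℝ S3 u v =
    ![(-(3 / 2)) * v 1, (-(1 / 2)) * v 4, (-2 * u 1) * v 0 + (-2 * u 0) * v 1 + (-(1 / 2 * u 4)) *
    v 4, (-2) * v 1, (-2) * v 0 + 3 / 2 * v 3] := by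
  unfold S3 field
  rw [fderiv_vec (by fun_prop) (by fun_prop) (by fun_prop) (by fun_prop) (by fun_prop)]
  refine vec_congr ?_ ?_ ?_ ?_ ?_ <;>
    simp (disch := fun_prop) [fderiv_fun_add, fderiv_fun_sub, fderiv_fun_mul, fderiv_fun_pow,
      fderiv_coord] <;> ring

theorem fderiv_L4 (u v : J) : fderiv ℝ L4 u v =
    ![0, 0, v 0, 0, 0] := by
  unfold L4 field
  rw [fderiv_vec (by fun_prop) (by fun_prop) (by fun_prop) (by fun_prop) (by fun_prop)]
  refine vec_congr ?_ ?_ ?_ ?_ ?_ <;>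
    simp (disch := fun_prop) [fderiv_fun_add, fderiv_fun_sub, fderiv_fun_mul, fderiv_fun_pow,
      fderiv_coord] <;> ring

theorem fderiv_S5 (u v : J) : fderiv ℝ S5 u v =
    ![0, 0, 0, 0, 0] := by
  unfold S5 field
  rw [fderiv_vec (by fun_prop) (by fun_prop) (by fun_prop) (by fun_prop) (by fun_prop)]
  refine vec_congr ?_ ?_ ?_ ?_ ?_ <;>
    simp (disch := fun_prop) [fderiv_fun_add, fderiv_fun_sub, fderiv_fun_mul, fderiv_fun_pow,
      fderiv_coord] <;> ring

theorem fderiv_L6 (u v : J) : fderiv ℝ L6 u v =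
    ![0, 0, 0, 0, 0] := by
  unfold L6 field
  rw [fderiv_vec (by fun_prop) (by fun_prop) (by fun_prop) (by fun_prop) (by fun_prop)]
  refine vec_congr ?_ ?_ ?_ ?_ ?_ <;>
    simp (disch := fun_prop) [fderiv_fun_add, fderiv_fun_sub, fderiv_fun_mul, fderiv_fun_pow,
      fderiv_coord] <;> ring

theorem fderiv_S7 (u v : J) : fderiv ℝ S7 u v =
    ![0, 0, v 1, 0, 0] := by
  unfold S7 field
  rw [fderiv_vec (by fun_prop) (by fun_prop) (by fun_prop) (by fun_prop) (by fun_prop)]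
  refine vec_congr ?_ ?_ ?_ ?_ ?_ <;>
    simp (disch := fun_prop) [fderiv_fun_add, fderiv_fun_sub, fderiv_fun_mul, fderiv_fun_pow,
      fderiv_coord] <;> ring

theorem fderiv_L8 (u v : J) : fderiv ℝ L8 u v =
    ![0, 0, 0, 0, 0] := by
  unfold L8 field
  rw [fderiv_vec (by fun_prop) (by fun_prop) (by fun_prop) (by fun_prop) (by fun_prop)]
  refine vec_congr ?_ ?_ ?_ ?_ ?_ <;>
    simp (disch := fun_prop) [fderiv_fun_add, fderiv_fun_sub, fderiv_fun_mul, fderiv_fun_pow,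
      fderiv_coord] <;> ring

theorem fderiv_S9 (u v : J) : fderiv ℝ S9 u v =
    ![3 / 4 * v 4, 3 / 4 * v 3, 4 * u 1 * v 1 + 3 / 4 * u 4 * v 3 + 3 / 4 * u 3 * v 4, 0, 4 * v 1] := by
  unfold S9 field
  rw [fderiv_vec (by fun_prop) (by fun_prop) (by fun_prop) (by fun_prop) (by fun_prop)]
  refine vec_congr ?_ ?_ ?_ ?_ ?_ <;>
    simp (disch := fun_prop) [fderiv_fun_add, fderiv_fun_sub, fderiv_fun_mul, fderiv_fun_pow,
      fderiv_coord] <;> ring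

theorem fderiv_L10 (u v : J) : fderiv ℝ L10 u v =
    ![3 / 4 * u 4 * v 1 + (-(3 / 4)) * v 2 + 27 / 16 * u 3 * v 3 + 3 / 4 * u 1 * v 4, 3 / 4 * u 3
    * v 1 + 3 / 4 * u 1 * v 3, (2 * u 1 ^ 2 + 3 / 4 * u 3 * u 4) * v 1 + (3 / 4 * u 1 * u 4 + 27 /
    16 * u 3 ^ 2) * v 3 + 3 / 4 * u 1 * u 3 * v 4, 3 / 2 * u 3 * v 3, 4 * u 1 * v 1] := by
  unfold L10 field
  rw [fderiv_vec (by fun_prop) (by fun_prop) (by fun_prop) (by fun_prop) (by fun_prop)]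
  refine vec_congr ?_ ?_ ?_ ?_ ?_ <;>
    simp (disch := fun_prop) [fderiv_fun_add, fderiv_fun_sub, fderiv_fun_mul, fderiv_fun_pow,
      fderiv_coord] <;> ring

theorem fderiv_S11 (u v : J) : fderiv ℝ S11 u v =
    ![9 / 4 * u 3 * v 1 + 9 / 4 * u 1 * v 3 + 3 / 4 * u 4 * v 4, 2 * u 1 * v 1 + 3 / 4 * u 4 * v 3
    + 3 / 4 * u 3 * v 4, (3 * u 2 + 9 / 8 * u 3 ^ 2) * v 1 + 3 * u 1 * v 2 + (9 / 4 * u 1 * u 3 +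
    3 / 4 * u 4 ^ 2) * v 3 + 3 / 2 * u 3 * u 4 * v 4, 3 * u 3 * v 1 + 3 * u 1 * v 3, u 4 * v 1 + 3
    * v 2 + (-(9 / 4 * u 3)) * v 3 + u 1 * v 4] := by
  unfold S11 field
  rw [fderiv_vec (by fun_prop) (by fun_prop) (by fun_prop) (by fun_prop) (by fun_prop)]
  refine vec_congr ?_ ?_ ?_ ?_ ?_ <;>
    simp (disch := fun_prop) [fderiv_fun_add, fderiv_fun_sub, fderiv_fun_mul, fderiv_fun_pow,
      fderiv_coord] <;> ring

theorem fderiv_L12 (u v : J) : fderiv ℝ L12 u v =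
    ![(-3 * u 1 * u 4 + 3 * u 2 - 27 / 8 * u 3 ^ 2) * v 0 + (-3 * u 0 * u 4 - 6 * u 1 ^ 2 + 9 / 4
    * u 3 * u 4) * v 1 + 3 * u 0 * v 2 + (-(27 / 4 * u 0 * u 3) + 9 / 4 * u 1 * u 4 + 81 / 16 * u
    3 ^ 2) * v 3 + (-3 * u 0 * u 1 + 9 / 4 * u 1 * u 3 + 3 / 8 * u 4 ^ 2) * v 4, (-3 * u 1 * u 3)
    * v 0 + (-3 * u 0 * u 3 - 4 * u 1 * u 4 + 3 * u 2 + 9 / 8 * u 3 ^ 2) * v 1 + 3 * u 1 * v 2 +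
    (-3 * u 0 * u 1 + 9 / 4 * u 1 * u 3 + 3 / 8 * u 4 ^ 2) * v 3 + (-2 * u 1 ^ 2 + 3 / 4 * u 3 * u
    4) * v 4, (-(8 / 3 * u 1 ^ 3) - 3 * u 1 * u 3 * u 4 - 9 / 4 * u 3 ^ 3) * v 0 + (-8 * u 0 * u 1
    ^ 2 - 3 * u 0 * u 3 * u 4 - 2 * u 1 * u 4 ^ 2 + 9 / 4 * u 3 ^ 2 * u 4) * v 1 + 6 * u 2 * v 2 +
    (-3 * u 0 * u 1 * u 4 - 27 / 4 * u 0 * u 3 ^ 2 + 9 / 2 * u 1 * u 3 * u 4 + 81 / 16 * u 3 ^ 3 +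
    3 / 8 * u 4 ^ 3) * v 3 + (-3 * u 0 * u 1 * u 3 - 2 * u 1 ^ 2 * u 4 + 9 / 4 * u 1 * u 3 ^ 2 + 9
    / 8 * u 3 * u 4 ^ 2) * v 4, (-3 * u 3 ^ 2) * v 0 + (-8 * u 1 ^ 2) * v 1 + 3 * u 3 * v 2 + (-6
    * u 0 * u 3 + 3 * u 2 + 27 / 8 * u 3 ^ 2) * v 3, (-8 * u 1 ^ 2) * v 0 + (-16 * u 0 * u 1 + 12
    * u 1 * u 3 - u 4 ^ 2) * v 1 + 3 * u 4 * v 2 + (6 * u 1 ^ 2 - 9 / 4 * u 3 * u 4) * v 3 + (-2 *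
    u 1 * u 4 + 3 * u 2 - 9 / 8 * u 3 ^ 2) * v 4] := by
  unfold L12 field
  rw [fderiv_vec (by fun_prop) (by fun_prop) (by fun_prop) (by fun_prop) (by fun_prop)]
  refine vec_congr ?_ ?_ ?_ ?_ ?_ <;>
    simp (disch := fun_prop) [fderiv_fun_add, fderiv_fun_sub, fderiv_fun_mul, fderiv_fun_pow,
      fderiv_coord] <;> ring

theorem fderiv_h1 (u v : J) : fderiv ℝ h1 u v =
    ![3 / 2 * v 0 + (-(9 / 4)) * v 3, (-(1 / 2)) * v 1, (-(9 / 4 * u 3)) * v 3, (-(3 / 2)) * v 3,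
    1 / 2 * v 4] := by
  unfold h1 field
  rw [fderiv_vec (by fun_prop) (by fun_prop) (by fun_prop) (by fun_prop) (by fun_prop)]
  refine vec_congr ?_ ?_ ?_ ?_ ?_ <;>
    simp (disch := fun_prop) [fderiv_fun_add, fderiv_fun_sub, fderiv_fun_mul, fderiv_fun_pow,
      fderiv_coord] <;> ring

theorem fderiv_h2 (u v : J) :
    fderiv ℝ h2 u v = ![√3 / 2 * v 0, √3 / 2 * v 1, √3 / 2 * (2 * v 2), √3 / 2 * v 3,
      √3 / 2 * v 4] := by
  -- The scalar is moved into the entries because `fderiv_vec` expects a vector literal.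
  have h : h2 = fun w : J => (![√3 / 2 * w 0, √3 / 2 * w 1, √3 / 2 * (2 * w 2), √3 / 2 * w 3,
      √3 / 2 * w 4] : J) := by
    funext w
    simp [h2, field]
  rw [h, fderiv_vec (by fun_prop) (by fun_prop) (by fun_prop) (by fun_prop) (by fun_prop)]
  refine vec_congr ?_ ?_ ?_ ?_ ?_ <;> simp (disch := fun_prop) [fderiv_fun_mul, fderiv_coord]

/-! ### Smoothness of the fourteen fields. -/

theorem contDiff_S1 : ContDiff ℝ ∞ S1 := by
  unfold S1 field
  rw [contDiff_pi]
  intro i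
  fin_cases i <;> simp <;> fun_prop

theorem contDiff_L2 : ContDiff ℝ ∞ L2 := by
  unfold L2 field
  rw [contDiff_pi]
  intro i
  fin_cases i <;> simp <;> fun_prop

theorem contDiff_S3 : ContDiff ℝ ∞ S3 := by
  unfold S3 field
  rw [contDiff_pi]
  intro i
  fin_cases i <;> simp <;> fun_prop

theorem contDiff_L4 : ContDiff ℝ ∞ L4 := by
  unfold L4 field
  rw [contDiff_pi]
  intro i
  fin_cases i <;> simp <;> fun_prop

theorem contDiff_S5 : ContDiff ℝ ∞ S5 := by
  unfold S5 field
  rw [contDiff_pi]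
  intro i
  fin_cases i <;> simp <;> fun_prop

theorem contDiff_L6 : ContDiff ℝ ∞ L6 := by
  unfold L6 field
  rw [contDiff_pi]
  intro i
  fin_cases i <;> simp <;> fun_prop

theorem contDiff_S7 : ContDiff ℝ ∞ S7 := by
  unfold S7 field
  rw [contDiff_pi]
  intro i
  fin_cases i <;> simp <;> fun_prop

theorem contDiff_L8 : ContDiff ℝ ∞ L8 := by
  unfold L8 field
  rw [contDiff_pi]
  intro i
  fin_cases i <;> simp <;> fun_prop

theorem contDiff_S9 : ContDiff ℝ ∞ S9 := by
  unfold S9 field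
  rw [contDiff_pi]
  intro i
  fin_cases i <;> simp <;> fun_prop

theorem contDiff_L10 : ContDiff ℝ ∞ L10 := by
  unfold L10 field
  rw [contDiff_pi]
  intro i
  fin_cases i <;> simp <;> fun_prop

theorem contDiff_S11 : ContDiff ℝ ∞ S11 := by
  unfold S11 field
  rw [contDiff_pi]
  intro i
  fin_cases i <;> simp <;> fun_prop

theorem contDiff_L12 : ContDiff ℝ ∞ L12 := by
  unfold L12 field
  rw [contDiff_pi]
  intro i
  fin_cases i <;> simp <;> fun_prop

theorem contDiff_h1 : ContDiff ℝ ∞ h1 := by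
  unfold h1 field
  rw [contDiff_pi]
  intro i
  fin_cases i <;> simp <;> fun_prop

theorem contDiff_h2 : ContDiff ℝ ∞ h2 := by
  unfold h2 field
  rw [contDiff_pi]
  intro i
  fin_cases i <;> simp <;> fun_prop

/-! ### The fourteen vector fields are symmetries -/

theorem lieDeriv_varpi (X : J → J) (u v : J) : lieDeriv X varpi u v =
    fderiv ℝ X u v 2 - u 3 * fderiv ℝ X u v 0 - u 4 * fderiv ℝ X u v 1
      - X u 3 * v 0 - X u 4 * v 1 := by
  unfold lieDeriv varpi
  simp (disch := fun_prop) [fderiv_fun_sub, fderiv_fun_mul, fderiv_coord]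
  ring

theorem lieDeriv_upsilon (X : J → J) (u v : J) : lieDeriv X upsilon u v =
    (-(216 * v 3 ^ 3) + 288 * v 3 ^ 2 * v 0 - 288 * v 3 * v 4 * v 1 + 512 * v 1 ^ 3)
        * fderiv ℝ X u v 0
      + (216 * v 3 ^ 2 * v 4 - 288 * v 3 * v 4 * v 0 - 1152 * v 3 * v 1 ^ 2 - 96 * v 4 ^ 2 * v 1
        + 1536 * v 0 * v 1 ^ 2) * fderiv ℝ X u v 1
      + (324 * v 3 ^ 3 - 648 * v 3 ^ 2 * v 0 + 432 * v 3 * v 4 * v 1 + 288 * v 3 * v 0 ^ 2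
        + 24 * v 4 ^ 3 - 288 * v 4 * v 0 * v 1 - 384 * v 1 ^ 3) * fderiv ℝ X u v 3
      + (216 * v 3 ^ 2 * v 1 + 72 * v 3 * v 4 ^ 2 - 288 * v 3 * v 0 * v 1 - 96 * v 4 * v 1 ^ 2)
        * fderiv ℝ X u v 4 := by
  unfold lieDeriv upsilon upsilonPoly
  simp (disch := fun_prop) [fderiv_fun_add, fderiv_fun_sub, fderiv_fun_mul, fderiv_fun_pow,
    fderiv_coord]
  ring

/-- The factor for Υ has to be 2a. A map in GL(2) that scales the symplectic form on cubics by λ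
scales the discriminant, which has twice the degree, by λ². -/
theorem isSymmetryOn_univ_of (X : J → J) (a : J → ℝ)
    (h₁ : ∀ u v, lieDeriv X varpi u v = a u * varpi u v)
    (h₂ : ∀ u v, v 2 = u 3 * v 0 + u 4 * v 1 →
      lieDeriv X upsilon u v = 2 * a u * upsilonPoly (v 0) (v 1) (v 3) (v 4)) :
    IsSymmetryOn varpi upsilon univ X :=
  ⟨⟨a, fun u _ v => h₁ u v⟩, fun u => 2 * a u, fun u _ v hv => h₂ u v (by
    unfold varpi at hv; linarith)⟩

theorem isSymmetryOn_S1 : IsSymmetryOn varpi upsilon univ S1 := by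
  refine isSymmetryOn_univ_of _ (fun u => 3 * u 4) (fun u v => ?_) fun u v hv => ?_
  · simp only [lieDeriv_varpi, varpi, fderiv_S1]
    simp [S1, field]
    ring
  · simp only [lieDeriv_upsilon, upsilonPoly, fderiv_S1]
    simp [hv]
    ring

theorem isSymmetryOn_L2 : IsSymmetryOn varpi upsilon univ L2 := by
  refine isSymmetryOn_univ_of _ (fun u => -2 * u 0 + 3 / 2 * u 3) (fun u v => ?_) fun u v hv => ?_
  · simp only [lieDeriv_varpi, varpi, fderiv_L2]
    simp [L2, field]
    ring
  · simp only [lieDeriv_upsilon, upsilonPoly, fderiv_L2]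
    simp [hv]
    ring

theorem isSymmetryOn_S3 : IsSymmetryOn varpi upsilon univ S3 := by
  refine isSymmetryOn_univ_of _ (fun _ => 0) (fun u v => ?_) fun u v hv => ?_
  · simp only [lieDeriv_varpi, varpi, fderiv_S3]
    simp [S3, field]
    ring
  · simp only [lieDeriv_upsilon, upsilonPoly, fderiv_S3]
    simp [hv]
    ring

theorem isSymmetryOn_L4 : IsSymmetryOn varpi upsilon univ L4 := by
  refine isSymmetryOn_univ_of _ (fun _ => 0) (fun u v => ?_) fun u v hv => ?_
  · simp only [lieDeriv_varpi, varpi, fderiv_L4]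
    simp [L4, field]
  · simp only [lieDeriv_upsilon, upsilonPoly, fderiv_L4]
    simp [hv]

theorem isSymmetryOn_S5 : IsSymmetryOn varpi upsilon univ S5 := by
  refine isSymmetryOn_univ_of _ (fun _ => 0) (fun u v => ?_) fun u v hv => ?_
  · simp only [lieDeriv_varpi, varpi, fderiv_S5]
    simp [S5, field]
  · simp only [lieDeriv_upsilon, upsilonPoly, fderiv_S5]
    simp [hv]

theorem isSymmetryOn_L6 : IsSymmetryOn varpi upsilon univ L6 := by
  refine isSymmetryOn_univ_of _ (fun _ => 0) (fun u v => ?_) fun u v hv => ?_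
  · simp only [lieDeriv_varpi, varpi, fderiv_L6]
    simp [L6, field]
  · simp only [lieDeriv_upsilon, upsilonPoly, fderiv_L6]
    simp [hv]

theorem isSymmetryOn_S7 : IsSymmetryOn varpi upsilon univ S7 := by
  refine isSymmetryOn_univ_of _ (fun _ => 0) (fun u v => ?_) fun u v hv => ?_
  · simp only [lieDeriv_varpi, varpi, fderiv_S7]
    simp [S7, field]
  · simp only [lieDeriv_upsilon, upsilonPoly, fderiv_S7]
    simp [hv]

theorem isSymmetryOn_L8 : IsSymmetryOn varpi upsilon univ L8 := by
  refine isSymmetryOn_univ_of _ (fun _ => 0) (fun u v => ?_) fun u v hv => ?_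
  · simp only [lieDeriv_varpi, varpi, fderiv_L8]
    simp [L8, field]
  · simp only [lieDeriv_upsilon, upsilonPoly, fderiv_L8]
    simp [hv]

theorem isSymmetryOn_S9 : IsSymmetryOn varpi upsilon univ S9 := by
  refine isSymmetryOn_univ_of _ (fun _ => 0) (fun u v => ?_) fun u v hv => ?_
  · simp only [lieDeriv_varpi, varpi, fderiv_S9]
    simp [S9, field]
    ring
  · simp only [lieDeriv_upsilon, upsilonPoly, fderiv_S9]
    simp [hv]
    ring

theorem isSymmetryOn_L10 : IsSymmetryOn varpi upsilon univ L10 := by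
  refine isSymmetryOn_univ_of _ (fun u => 3 / 4 * u 3) (fun u v => ?_) fun u v hv => ?_
  · simp only [lieDeriv_varpi, varpi, fderiv_L10]
    simp [L10, field]
    ring
  · simp only [lieDeriv_upsilon, upsilonPoly, fderiv_L10]
    simp [hv]
    ring

theorem isSymmetryOn_S11 : IsSymmetryOn varpi upsilon univ S11 := by
  refine isSymmetryOn_univ_of _ (fun u => 3 * u 1) (fun u v => ?_) fun u v hv => ?_
  · simp only [lieDeriv_varpi, varpi, fderiv_S11]
    simp [S11, field]
    ring
  · simp only [lieDeriv_upsilon, upsilonPoly, fderiv_S11]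
    simp [hv]
    ring

theorem isSymmetryOn_L12 : IsSymmetryOn varpi upsilon univ L12 := by
  refine isSymmetryOn_univ_of _ (fun u => -3 * u 0 * u 3 - 3 * u 1 * u 4 + 6 * u 2) (fun u v => ?_) fun u v hv => ?_
  · simp only [lieDeriv_varpi, varpi, fderiv_L12]
    simp [L12, field]
    ring
  · simp only [lieDeriv_upsilon, upsilonPoly, fderiv_L12]
    simp [hv]
    ring

theorem isSymmetryOn_h1 : IsSymmetryOn varpi upsilon univ h1 := by
  refine isSymmetryOn_univ_of _ (fun _ => 0) (fun u v => ?_) fun u v hv => ?_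
  · simp only [lieDeriv_varpi, varpi, fderiv_h1]
    simp [h1, field]
    ring
  · simp only [lieDeriv_upsilon, upsilonPoly, fderiv_h1]
    simp [hv]
    ring

theorem isSymmetryOn_h2 : IsSymmetryOn varpi upsilon univ h2 := by
  refine isSymmetryOn_univ_of _ (fun _ => √3) (fun u v => ?_) fun u v hv => ?_
  · simp only [lieDeriv_varpi, varpi, fderiv_h2]
    simp [h2, field]
    ring
  · simp only [lieDeriv_upsilon, upsilonPoly, fderiv_h2]
    simp [hv]
    ring

/-! ### Brackets -/

/-- The field `S1` as an element of the Lie algebra of smooth vector fields. -/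
noncomputable def vfS1 : VF := ⟨S1, contDiff_S1⟩

/-- The field `L2` as an element of the Lie algebra of smooth vector fields. -/
noncomputable def vfL2 : VF := ⟨L2, contDiff_L2⟩

/-- The field `S3` as an element of the Lie algebra of smooth vector fields. -/
noncomputable def vfS3 : VF := ⟨S3, contDiff_S3⟩

/-- The field `L4` as an element of the Lie algebra of smooth vector fields. -/
noncomputable def vfL4 : VF := ⟨L4, contDiff_L4⟩

/-- The field `S5` as an element of the Lie algebra of smooth vector fields. -/
noncomputable def vfS5 : VF := ⟨S5, contDiff_S5⟩

/-- The field `L6` as an element of the Lie algebra of smooth vector fields. -/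
noncomputable def vfL6 : VF := ⟨L6, contDiff_L6⟩

/-- The field `S7` as an element of the Lie algebra of smooth vector fields. -/
noncomputable def vfS7 : VF := ⟨S7, contDiff_S7⟩

/-- The field `L8` as an element of the Lie algebra of smooth vector fields. -/
noncomputable def vfL8 : VF := ⟨L8, contDiff_L8⟩

/-- The field `S9` as an element of the Lie algebra of smooth vector fields. -/
noncomputable def vfS9 : VF := ⟨S9, contDiff_S9⟩

/-- The field `L10` as an element of the Lie algebra of smooth vector fields. -/
noncomputable def vfL10 : VF := ⟨L10, contDiff_L10⟩

/-- The field `S11` as an element of the Lie algebra of smooth vector fields. -/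
noncomputable def vfS11 : VF := ⟨S11, contDiff_S11⟩

/-- The field `L12` as an element of the Lie algebra of smooth vector fields. -/
noncomputable def vfL12 : VF := ⟨L12, contDiff_L12⟩

/-- The field `h1` as an element of the Lie algebra of smooth vector fields. -/
noncomputable def vfh1 : VF := ⟨h1, contDiff_h1⟩

/-- The field `h2` as an element of the Lie algebra of smooth vector fields. -/
noncomputable def vfh2 : VF := ⟨h2, contDiff_h2⟩

/-- The twelve root fields as elements of the Lie algebra of smooth vector fields. -/
noncomputable def rootVF : Fin 12 → VF :=
  ![vfS1, vfL2, vfS3, vfL4, vfS5, vfL6, vfS7, vfL8, vfS9, vfL10, vfS11, vfL12]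

theorem coe_rootVF (i : Fin 12) : (rootVF i : J → J) = rootField i := by
  fin_cases i <;> rfl

theorem lie_eq_of_fderiv {X Y Z : VF}
    (h : ∀ u, fderiv ℝ (Y : J → J) u ((X : J → J) u) - fderiv ℝ (X : J → J) u ((Y : J → J) u) =
      (Z : J → J) u) : ⁅X, Y⁆ = Z :=
  Subtype.ext (funext h)

/-! ### The S³-string L⁸, S⁷, S⁵, L⁴ and the opposite S⁹-string L², S¹, S¹¹, L¹⁰, with L⁶ and L¹² at
their ends. -/

theorem lie_S3_L8 : ⁅vfS3, vfL8⁆ = (2 : ℝ) • vfS7 := by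
  refine lie_eq_of_fderiv fun u => ?_
  simp only [vfS3, vfL8, fderiv_S3, fderiv_L8]
  ext i
  fin_cases i <;> simp [L8, S3, S7, vfS7, field] <;> ring

theorem lie_S3_S7 : ⁅vfS3, vfS7⁆ = (1 / 2 : ℝ) • vfS5 := by
  refine lie_eq_of_fderiv fun u => ?_
  simp only [vfS3, vfS7, fderiv_S3, fderiv_S7]
  ext i
  fin_cases i <;> simp [S3, S5, S7, vfS5, field] <;> ring

theorem lie_S3_S5 : ⁅vfS3, vfS5⁆ = (2 : ℝ) • vfL4 := by
  refine lie_eq_of_fderiv fun u => ?_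
  simp only [vfS3, vfS5, fderiv_S3, fderiv_S5]
  ext i
  fin_cases i <;> simp [L4, S3, S5, vfL4, field] <;> ring

theorem lie_S3_L4 : ⁅vfS3, vfL4⁆ = 0 := by
  refine lie_eq_of_fderiv fun u => ?_
  simp only [vfS3, vfL4, fderiv_S3, fderiv_L4]
  ext i
  fin_cases i <;> simp [L4, S3, field] <;> ring

theorem lie_L8_L4 : ⁅vfL8, vfL4⁆ = vfL6 := by
  refine lie_eq_of_fderiv fun u => ?_
  simp only [vfL8, vfL4, fderiv_L8, fderiv_L4]
  ext i
  fin_cases i <;> simp [L4, L6, L8, vfL6, field] <;> ring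

theorem lie_L8_S7 : ⁅vfL8, vfS7⁆ = 0 := by
  refine lie_eq_of_fderiv fun u => ?_
  simp only [vfL8, vfS7, fderiv_L8, fderiv_S7]
  ext i
  fin_cases i <;> simp [L8, S7, field] <;> ring

theorem lie_S9_L2 : ⁅vfS9, vfL2⁆ = (-(1 / 2) : ℝ) • vfS1 := by
  refine lie_eq_of_fderiv fun u => ?_
  simp only [vfS9, vfL2, fderiv_S9, fderiv_L2]
  ext i
  fin_cases i <;> simp [L2, S1, S9, vfS1, field] <;> ring

theorem lie_S9_S1 : ⁅vfS9, vfS1⁆ = (4 : ℝ) • vfS11 := by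
  refine lie_eq_of_fderiv fun u => ?_
  simp only [vfS9, vfS1, fderiv_S9, fderiv_S1]
  ext i
  fin_cases i <;> simp [S1, S11, S9, vfS11, field] <;> ring

theorem lie_S9_S11 : ⁅vfS9, vfS11⁆ = (3 : ℝ) • vfL10 := by
  refine lie_eq_of_fderiv fun u => ?_
  simp only [vfS9, vfS11, fderiv_S9, fderiv_S11]
  ext i
  fin_cases i <;> simp [L10, S11, S9, vfL10, field] <;> ring

theorem lie_S9_L10 : ⁅vfS9, vfL10⁆ = 0 := by
  refine lie_eq_of_fderiv fun u => ?_
  simp only [vfS9, vfL10, fderiv_S9, fderiv_L10]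
  ext i
  fin_cases i <;> simp [L10, S9, field] <;> ring

theorem lie_L2_L10 : ⁅vfL2, vfL10⁆ = (-(1 / 2) : ℝ) • vfL12 := by
  refine lie_eq_of_fderiv fun u => ?_
  simp only [vfL2, vfL10, fderiv_L2, fderiv_L10]
  ext i
  fin_cases i <;> simp [L10, L12, L2, vfL12, field] <;> ring

theorem lie_L2_S1 : ⁅vfL2, vfS1⁆ = 0 := by
  refine lie_eq_of_fderiv fun u => ?_
  simp only [vfL2, vfS1, fderiv_L2, fderiv_S1]
  ext i
  fin_cases i <;> simp [L2, S1, field] <;> ring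

theorem lie_S3_L2 : ⁅vfS3, vfL2⁆ = 0 := by
  refine lie_eq_of_fderiv fun u => ?_
  simp only [vfS3, vfL2, fderiv_S3, fderiv_L2]
  ext i
  fin_cases i <;> simp [L2, S3, field] <;> ring

theorem lie_L8_S9 : ⁅vfL8, vfS9⁆ = 0 := by
  refine lie_eq_of_fderiv fun u => ?_
  simp only [vfL8, vfS9, fderiv_L8, fderiv_S9]
  ext i
  fin_cases i <;> simp [L8, S9, field] <;> ring

theorem lie_S3_S9 : ⁅vfS3, vfS9⁆ = -vfh1 := by
  refine lie_eq_of_fderiv fun u => ?_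
  simp only [vfS3, vfS9, fderiv_S3, fderiv_S9]
  ext i
  fin_cases i <;> simp [S3, S9, h1, vfh1, field] <;> ring

theorem lie_L8_L2 : ⁅vfL8, vfL2⁆ = (-2 : ℝ) • vfh1 - (2 * √3 / 3 : ℝ) • vfh2 := by
  refine lie_eq_of_fderiv fun u => ?_
  simp only [vfL8, vfL2, fderiv_L8, fderiv_L2]
  ext i
  fin_cases i <;> simp [L2, L8, h1, h2, vfh1, vfh2, field] <;> ring_nf <;> rw [Real.sq_sqrt (by norm_num)] <;> ring

/-! ### Weights of the root fields under h₁ and h₂. -/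

theorem lie_h1_h2 : ⁅vfh1, vfh2⁆ = 0 := by
  refine lie_eq_of_fderiv fun u => ?_
  simp only [vfh1, vfh2, fderiv_h1, fderiv_h2]
  ext i
  fin_cases i <;> simp [h1, h2, field] <;> ring

theorem lie_h1_S1 : ⁅vfh1, vfS1⁆ = (1 / 2 : ℝ) • vfS1 := by
  refine lie_eq_of_fderiv fun u => ?_
  simp only [vfh1, vfS1, fderiv_h1, fderiv_S1]
  ext i
  fin_cases i <;> simp [S1, h1, vfS1, field] <;> ring

theorem lie_h2_S1 : ⁅vfh2, vfS1⁆ = (√3 / 2 : ℝ) • vfS1 := by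
  refine lie_eq_of_fderiv fun u => ?_
  simp only [vfh2, vfS1, fderiv_h2, fderiv_S1]
  ext i
  fin_cases i <;> simp [S1, h2, vfS1, field] <;> ring

theorem lie_h1_L2 : ⁅vfh1, vfL2⁆ = (3 / 2 : ℝ) • vfL2 := by
  refine lie_eq_of_fderiv fun u => ?_
  simp only [vfh1, vfL2, fderiv_h1, fderiv_L2]
  ext i
  fin_cases i <;> simp [L2, h1, vfL2, field] <;> ring

theorem lie_h2_L2 : ⁅vfh2, vfL2⁆ = (√3 / 2 : ℝ) • vfL2 := by
  refine lie_eq_of_fderiv fun u => ?_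
  simp only [vfh2, vfL2, fderiv_h2, fderiv_L2]
  ext i
  fin_cases i <;> simp [L2, h2, vfL2, field] <;> ring

theorem lie_h1_S3 : ⁅vfh1, vfS3⁆ = (1 : ℝ) • vfS3 := by
  refine lie_eq_of_fderiv fun u => ?_
  simp only [vfh1, vfS3, fderiv_h1, fderiv_S3]
  ext i
  fin_cases i <;> simp [S3, h1, vfS3, field] <;> ring

theorem lie_h2_S3 : ⁅vfh2, vfS3⁆ = (0 : ℝ) • vfS3 := by
  refine lie_eq_of_fderiv fun u => ?_
  simp only [vfh2, vfS3, fderiv_h2, fderiv_S3]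
  ext i
  fin_cases i <;> simp [S3, h2, vfS3, field] <;> ring

theorem lie_h1_L4 : ⁅vfh1, vfL4⁆ = (3 / 2 : ℝ) • vfL4 := by
  refine lie_eq_of_fderiv fun u => ?_
  simp only [vfh1, vfL4, fderiv_h1, fderiv_L4]
  ext i
  fin_cases i <;> simp [L4, h1, vfL4, field] <;> ring

theorem lie_h2_L4 : ⁅vfh2, vfL4⁆ = (-(√3 / 2) : ℝ) • vfL4 := by
  refine lie_eq_of_fderiv fun u => ?_
  simp only [vfh2, vfL4, fderiv_h2, fderiv_L4]
  ext i
  fin_cases i <;> simp [L4, h2, vfL4, field] <;> ring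

theorem lie_h1_S5 : ⁅vfh1, vfS5⁆ = (1 / 2 : ℝ) • vfS5 := by
  refine lie_eq_of_fderiv fun u => ?_
  simp only [vfh1, vfS5, fderiv_h1, fderiv_S5]
  ext i
  fin_cases i <;> simp [S5, h1, vfS5, field] <;> ring

theorem lie_h2_S5 : ⁅vfh2, vfS5⁆ = (-(√3 / 2) : ℝ) • vfS5 := by
  refine lie_eq_of_fderiv fun u => ?_
  simp only [vfh2, vfS5, fderiv_h2, fderiv_S5]
  ext i
  fin_cases i <;> simp [S5, h2, vfS5, field] <;> ring

theorem lie_h1_L6 : ⁅vfh1, vfL6⁆ = (0 : ℝ) • vfL6 := by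
  refine lie_eq_of_fderiv fun u => ?_
  simp only [vfh1, vfL6, fderiv_h1, fderiv_L6]
  ext i
  fin_cases i <;> simp [L6, h1, vfL6, field] <;> ring

theorem lie_h2_L6 : ⁅vfh2, vfL6⁆ = (-√3 : ℝ) • vfL6 := by
  refine lie_eq_of_fderiv fun u => ?_
  simp only [vfh2, vfL6, fderiv_h2, fderiv_L6]
  ext i
  fin_cases i <;> simp [L6, h2, vfL6, field] <;> ring

theorem lie_h1_S7 : ⁅vfh1, vfS7⁆ = (-(1 / 2) : ℝ) • vfS7 := by
  refine lie_eq_of_fderiv fun u => ?_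
  simp only [vfh1, vfS7, fderiv_h1, fderiv_S7]
  ext i
  fin_cases i <;> simp [S7, h1, vfS7, field] <;> ring

theorem lie_h2_S7 : ⁅vfh2, vfS7⁆ = (-(√3 / 2) : ℝ) • vfS7 := by
  refine lie_eq_of_fderiv fun u => ?_
  simp only [vfh2, vfS7, fderiv_h2, fderiv_S7]
  ext i
  fin_cases i <;> simp [S7, h2, vfS7, field] <;> ring

theorem lie_h1_L8 : ⁅vfh1, vfL8⁆ = (-(3 / 2) : ℝ) • vfL8 := by
  refine lie_eq_of_fderiv fun u => ?_
  simp only [vfh1, vfL8, fderiv_h1, fderiv_L8]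
  ext i
  fin_cases i <;> simp [L8, h1, vfL8, field] <;> ring

theorem lie_h2_L8 : ⁅vfh2, vfL8⁆ = (-(√3 / 2) : ℝ) • vfL8 := by
  refine lie_eq_of_fderiv fun u => ?_
  simp only [vfh2, vfL8, fderiv_h2, fderiv_L8]
  ext i
  fin_cases i <;> simp [L8, h2, vfL8, field] <;> ring

theorem lie_h1_S9 : ⁅vfh1, vfS9⁆ = (-1 : ℝ) • vfS9 := by
  refine lie_eq_of_fderiv fun u => ?_
  simp only [vfh1, vfS9, fderiv_h1, fderiv_S9]
  ext i
  fin_cases i <;> simp [S9, h1, vfS9, field] <;> ring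

theorem lie_h2_S9 : ⁅vfh2, vfS9⁆ = (0 : ℝ) • vfS9 := by
  refine lie_eq_of_fderiv fun u => ?_
  simp only [vfh2, vfS9, fderiv_h2, fderiv_S9]
  ext i
  fin_cases i <;> simp [S9, h2, vfS9, field] <;> ring

theorem lie_h1_L10 : ⁅vfh1, vfL10⁆ = (-(3 / 2) : ℝ) • vfL10 := by
  refine lie_eq_of_fderiv fun u => ?_
  simp only [vfh1, vfL10, fderiv_h1, fderiv_L10]
  ext i
  fin_cases i <;> simp [L10, h1, vfL10, field] <;> ring

theorem lie_h2_L10 : ⁅vfh2, vfL10⁆ = (√3 / 2 : ℝ) • vfL10 := by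
  refine lie_eq_of_fderiv fun u => ?_
  simp only [vfh2, vfL10, fderiv_h2, fderiv_L10]
  ext i
  fin_cases i <;> simp [L10, h2, vfL10, field] <;> ring

theorem lie_h1_S11 : ⁅vfh1, vfS11⁆ = (-(1 / 2) : ℝ) • vfS11 := by
  refine lie_eq_of_fderiv fun u => ?_
  simp only [vfh1, vfS11, fderiv_h1, fderiv_S11]
  ext i
  fin_cases i <;> simp [S11, h1, vfS11, field] <;> ring

theorem lie_h2_S11 : ⁅vfh2, vfS11⁆ = (√3 / 2 : ℝ) • vfS11 := by
  refine lie_eq_of_fderiv fun u => ?_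
  simp only [vfh2, vfS11, fderiv_h2, fderiv_S11]
  ext i
  fin_cases i <;> simp [S11, h2, vfS11, field] <;> ring

theorem lie_h1_L12 : ⁅vfh1, vfL12⁆ = (0 : ℝ) • vfL12 := by
  refine lie_eq_of_fderiv fun u => ?_
  simp only [vfh1, vfL12, fderiv_h1, fderiv_L12]
  ext i
  fin_cases i <;> simp [L12, h1, vfL12, field] <;> ring

theorem lie_h2_L12 : ⁅vfh2, vfL12⁆ = (√3 : ℝ) • vfL12 := by
  refine lie_eq_of_fderiv fun u => ?_
  simp only [vfh2, vfL12, fderiv_h2, fderiv_L12]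
  ext i
  fin_cases i <;> simp [L12, h2, vfL12, field] <;> ring

theorem lie_h1_rootVF (i : Fin 12) : ⁅vfh1, rootVF i⁆ = (rootArrow i).1 • rootVF i := by
  fin_cases i
  -- The brackets carry their scalar exactly as in `rootArrow`, including the scalars 0 and 1, so
  -- each case matches definitionally.
  exacts [lie_h1_S1, lie_h1_L2, lie_h1_S3, lie_h1_L4, lie_h1_S5, lie_h1_L6, lie_h1_S7, lie_h1_L8, lie_h1_S9, lie_h1_L10, lie_h1_S11, lie_h1_L12]

theorem lie_h2_rootVF (i : Fin 12) : ⁅vfh2, rootVF i⁆ = (rootArrow i).2 • rootVF i := by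
  fin_cases i
  exacts [lie_h2_S1, lie_h2_L2, lie_h2_S3, lie_h2_L4, lie_h2_S5, lie_h2_L6, lie_h2_S7, lie_h2_L8, lie_h2_S9, lie_h2_L10, lie_h2_S11, lie_h2_L12]

/-! ### The Serre presentation of `𝔤₂` -/

section Serre

variable {L : Type*} [LieRing L] [LieAlgebra ℝ L]

/-- Chevalley generators subject to the Serre relations for the Cartan matrix `G₂`; the root
`e₁` is short. -/
structure IsChevalleyG2 (e₁ e₂ f₁ f₂ h₁ h₂ : L) : Prop where
  hh : ⁅h₁, h₂⁆ = 0
  e₁f₁ : ⁅e₁, f₁⁆ = h₁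
  e₂f₂ : ⁅e₂, f₂⁆ = h₂
  e₁f₂ : ⁅e₁, f₂⁆ = 0
  e₂f₁ : ⁅e₂, f₁⁆ = 0
  h₁e₁ : ⁅h₁, e₁⁆ = (2 : ℝ) • e₁
  h₁e₂ : ⁅h₁, e₂⁆ = (-3 : ℝ) • e₂
  h₂e₁ : ⁅h₂, e₁⁆ = (-1 : ℝ) • e₁
  h₂e₂ : ⁅h₂, e₂⁆ = (2 : ℝ) • e₂
  h₁f₁ : ⁅h₁, f₁⁆ = (-2 : ℝ) • f₁
  h₁f₂ : ⁅h₁, f₂⁆ = (3 : ℝ) • f₂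
  h₂f₁ : ⁅h₂, f₁⁆ = (1 : ℝ) • f₁
  h₂f₂ : ⁅h₂, f₂⁆ = (-2 : ℝ) • f₂
  serre_e₁ : ⁅e₁, ⁅e₁, ⁅e₁, ⁅e₁, e₂⁆⁆⁆⁆ = 0
  serre_e₂ : ⁅e₂, ⁅e₂, e₁⁆⁆ = 0
  serre_f₁ : ⁅f₁, ⁅f₁, ⁅f₁, ⁅f₁, f₂⁆⁆⁆⁆ = 0
  serre_f₂ : ⁅f₂, ⁅f₂, f₁⁆⁆ = 0

namespace IsChevalleyG2

variable {e₁ e₂ f₁ f₂ h₁ h₂ : L}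

/-- The Chevalley involution. It lets every statement about positive root vectors be reused for the
negative ones. The Cartan elements change sign since ⁅f, e⁆ = -h. -/
theorem symm (h : IsChevalleyG2 e₁ e₂ f₁ f₂ h₁ h₂) :
    IsChevalleyG2 f₁ f₂ e₁ e₂ (-h₁) (-h₂) where
  hh := by simp [h.hh]
  e₁f₁ := by rw [← lie_skew, h.e₁f₁]
  e₂f₂ := by rw [← lie_skew, h.e₂f₂]
  e₁f₂ := by rw [← lie_skew, h.e₂f₁, neg_zero]
  e₂f₁ := by rw [← lie_skew, h.e₁f₂, neg_zero]
  h₁e₁ := by rw [neg_lie, h.h₁f₁]; module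
  h₁e₂ := by rw [neg_lie, h.h₁f₂]; module
  h₂e₁ := by rw [neg_lie, h.h₂f₁]; module
  h₂e₂ := by rw [neg_lie, h.h₂f₂]; module
  h₁f₁ := by rw [neg_lie, h.h₁e₁]; module
  h₁f₂ := by rw [neg_lie, h.h₁e₂]; module
  h₂f₁ := by rw [neg_lie, h.h₂e₁]; module
  h₂f₂ := by rw [neg_lie, h.h₂e₂]; module
  serre_e₁ := h.serre_f₁
  serre_e₂ := h.serre_f₂
  serre_f₁ := h.serre_e₁
  serre_f₂ := h.serre_e₂

/-- The six iterated brackets of two elements that correspond to the positive roots of `G₂`. -/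
def pos (e₁ e₂ : L) : Fin 6 → L :=
  ![e₁, e₂, ⁅e₁, e₂⁆, ⁅e₁, ⁅e₁, e₂⁆⁆, ⁅e₁, ⁅e₁, ⁅e₁, e₂⁆⁆⁆, ⁅e₂, ⁅e₁, ⁅e₁, ⁅e₁, e₂⁆⁆⁆⁆]

theorem lie_e₂_e₃ (h : IsChevalleyG2 e₁ e₂ f₁ f₂ h₁ h₂) : ⁅e₂, ⁅e₁, e₂⁆⁆ = 0 := by
  rw [← lie_skew e₁ e₂, lie_neg, h.serre_e₂, neg_zero]

theorem lie_e₂_e₄ (h : IsChevalleyG2 e₁ e₂ f₁ f₂ h₁ h₂) : ⁅e₂, ⁅e₁, ⁅e₁, e₂⁆⁆⁆ = 0 := by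
  rw [leibniz_lie, h.lie_e₂_e₃, lie_zero, add_zero, ← lie_skew e₂ e₁, neg_lie, lie_self, neg_zero]

theorem e₆_eq (h : IsChevalleyG2 e₁ e₂ f₁ f₂ h₁ h₂) :
    ⁅e₂, ⁅e₁, ⁅e₁, ⁅e₁, e₂⁆⁆⁆⁆ = -⁅⁅e₁, e₂⁆, ⁅e₁, ⁅e₁, e₂⁆⁆⁆ := by
  rw [leibniz_lie, h.lie_e₂_e₄, lie_zero, add_zero, ← lie_skew e₂ e₁, neg_lie]

/-- The weight 4α₁ + 2α₂ is not a root. Expanding the bracket through the definition of the sixth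
vector and through `e₆_eq` gives opposite values, so twice the bracket is zero. -/
theorem lie_e₁_e₆ (h : IsChevalleyG2 e₁ e₂ f₁ f₂ h₁ h₂) :
    ⁅e₁, ⁅e₂, ⁅e₁, ⁅e₁, ⁅e₁, e₂⁆⁆⁆⁆⁆ = 0 := by
  have h₁ : ⁅e₁, ⁅e₂, ⁅e₁, ⁅e₁, ⁅e₁, e₂⁆⁆⁆⁆⁆ = ⁅⁅e₁, e₂⁆, ⁅e₁, ⁅e₁, ⁅e₁, e₂⁆⁆⁆⁆ := by
    rw [leibniz_lie, h.serre_e₁, lie_zero, add_zero]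
  have h₂ : ⁅e₁, ⁅e₂, ⁅e₁, ⁅e₁, ⁅e₁, e₂⁆⁆⁆⁆⁆ = -⁅⁅e₁, e₂⁆, ⁅e₁, ⁅e₁, ⁅e₁, e₂⁆⁆⁆⁆ := by
    rw [h.e₆_eq, lie_neg, leibniz_lie, lie_self, zero_add]
  have h₃ : (2 : ℝ) • ⁅e₁, ⁅e₂, ⁅e₁, ⁅e₁, ⁅e₁, e₂⁆⁆⁆⁆⁆ = 0 := by
    rw [two_smul]
    nth_rewrite 1 [h₁]
    rw [h₂, add_neg_cancel]
  exact (smul_eq_zero.1 h₃).resolve_left two_ne_zero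

theorem lie_e₂_e₆ (h : IsChevalleyG2 e₁ e₂ f₁ f₂ h₁ h₂) :
    ⁅e₂, ⁅e₂, ⁅e₁, ⁅e₁, ⁅e₁, e₂⁆⁆⁆⁆⁆ = 0 := by
  rw [h.e₆_eq, lie_neg, leibniz_lie, h.lie_e₂_e₃, h.lie_e₂_e₄, zero_lie, lie_zero, add_zero,
    neg_zero]

theorem lie_h₁_e₃ (h : IsChevalleyG2 e₁ e₂ f₁ f₂ h₁ h₂) : ⁅h₁, ⁅e₁, e₂⁆⁆ = (-1 : ℝ) • ⁅e₁, e₂⁆ := by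
  rw [leibniz_lie, h.h₁e₁, h.h₁e₂, smul_lie, lie_smul]; module

theorem lie_h₁_e₄ (h : IsChevalleyG2 e₁ e₂ f₁ f₂ h₁ h₂) :
    ⁅h₁, ⁅e₁, ⁅e₁, e₂⁆⁆⁆ = (1 : ℝ) • ⁅e₁, ⁅e₁, e₂⁆⁆ := by
  rw [leibniz_lie, h.h₁e₁, h.lie_h₁_e₃, smul_lie, lie_smul]; module

theorem lie_h₂_e₃ (h : IsChevalleyG2 e₁ e₂ f₁ f₂ h₁ h₂) : ⁅h₂, ⁅e₁, e₂⁆⁆ = (1 : ℝ) • ⁅e₁, e₂⁆ := by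
  rw [leibniz_lie, h.h₂e₁, h.h₂e₂, smul_lie, lie_smul]; module

theorem lie_h₂_e₄ (h : IsChevalleyG2 e₁ e₂ f₁ f₂ h₁ h₂) : ⁅h₂, ⁅e₁, ⁅e₁, e₂⁆⁆⁆ = 0 := by
  rw [leibniz_lie, h.h₂e₁, h.lie_h₂_e₃, smul_lie, lie_smul]; module

theorem lie_h₂_e₅ (h : IsChevalleyG2 e₁ e₂ f₁ f₂ h₁ h₂) :
    ⁅h₂, ⁅e₁, ⁅e₁, ⁅e₁, e₂⁆⁆⁆⁆ = (-1 : ℝ) • ⁅e₁, ⁅e₁, ⁅e₁, e₂⁆⁆⁆ := by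
  rw [leibniz_lie, h.h₂e₁, h.lie_h₂_e₄, smul_lie, lie_zero, add_zero]

/-- The constants 3, 4, 3 in this and the next two lemmas are k(4 - k) for k = 1, 2, 3: the
e₁-string through e₂ is the four-dimensional sl₂-module with lowest vector e₂. -/
theorem lie_f₁_e₃ (h : IsChevalleyG2 e₁ e₂ f₁ f₂ h₁ h₂) : ⁅f₁, ⁅e₁, e₂⁆⁆ = (3 : ℝ) • e₂ := by
  rw [leibniz_lie, ← lie_skew f₁ e₁, ← lie_skew f₁ e₂, h.e₁f₁, h.e₂f₁, neg_lie, h.h₁e₂]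
  simp

theorem lie_f₁_e₄ (h : IsChevalleyG2 e₁ e₂ f₁ f₂ h₁ h₂) :
    ⁅f₁, ⁅e₁, ⁅e₁, e₂⁆⁆⁆ = (4 : ℝ) • ⁅e₁, e₂⁆ := by
  rw [leibniz_lie, ← lie_skew f₁ e₁, h.e₁f₁, neg_lie, h.lie_h₁_e₃, h.lie_f₁_e₃, lie_smul]
  module

theorem lie_f₁_e₅ (h : IsChevalleyG2 e₁ e₂ f₁ f₂ h₁ h₂) :
    ⁅f₁, ⁅e₁, ⁅e₁, ⁅e₁, e₂⁆⁆⁆⁆ = (3 : ℝ) • ⁅e₁, ⁅e₁, e₂⁆⁆ := by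
  rw [leibniz_lie, ← lie_skew f₁ e₁, h.e₁f₁, neg_lie, h.lie_h₁_e₄, h.lie_f₁_e₄, lie_smul]
  module

theorem lie_f₁_e₆ (h : IsChevalleyG2 e₁ e₂ f₁ f₂ h₁ h₂) :
    ⁅f₁, ⁅e₂, ⁅e₁, ⁅e₁, ⁅e₁, e₂⁆⁆⁆⁆⁆ = 0 := by
  rw [leibniz_lie, ← lie_skew f₁ e₂, h.e₂f₁, h.lie_f₁_e₅, lie_smul, h.lie_e₂_e₄]
  simp

theorem lie_f₂_e₃ (h : IsChevalleyG2 e₁ e₂ f₁ f₂ h₁ h₂) : ⁅f₂, ⁅e₁, e₂⁆⁆ = (-1 : ℝ) • e₁ := by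
  rw [leibniz_lie, ← lie_skew f₂ e₁, ← lie_skew f₂ e₂, h.e₁f₂, h.e₂f₂, lie_neg, lie_skew, h.h₂e₁,
    neg_zero, zero_lie, zero_add]

theorem lie_f₂_e₄ (h : IsChevalleyG2 e₁ e₂ f₁ f₂ h₁ h₂) : ⁅f₂, ⁅e₁, ⁅e₁, e₂⁆⁆⁆ = 0 := by
  rw [leibniz_lie, ← lie_skew f₂ e₁, h.e₁f₂, h.lie_f₂_e₃, neg_zero, zero_lie, lie_smul, lie_self,
    smul_zero, add_zero]

theorem lie_f₂_e₅ (h : IsChevalleyG2 e₁ e₂ f₁ f₂ h₁ h₂) : ⁅f₂, ⁅e₁, ⁅e₁, ⁅e₁, e₂⁆⁆⁆⁆ = 0 := by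
  rw [leibniz_lie, ← lie_skew f₂ e₁, h.e₁f₂, h.lie_f₂_e₄]
  simp

theorem lie_f₂_e₆ (h : IsChevalleyG2 e₁ e₂ f₁ f₂ h₁ h₂) :
    ⁅f₂, ⁅e₂, ⁅e₁, ⁅e₁, ⁅e₁, e₂⁆⁆⁆⁆⁆ = (1 : ℝ) • ⁅e₁, ⁅e₁, ⁅e₁, e₂⁆⁆⁆ := by
  rw [leibniz_lie, ← lie_skew f₂ e₂, h.e₂f₂, neg_lie, h.lie_h₂_e₅, h.lie_f₂_e₅,
    lie_zero, add_zero, neg_smul, neg_neg]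

/-- The generators map the positive root vectors into every subspace that contains the Cartan
generators and the positive root vectors. -/
theorem lie_pos_mem (h : IsChevalleyG2 e₁ e₂ f₁ f₂ h₁ h₂) {S : Submodule ℝ L}
    (hh₁ : h₁ ∈ S) (hh₂ : h₂ ∈ S) (hp : ∀ i, pos e₁ e₂ i ∈ S) (i : Fin 6) :
    ⁅e₁, pos e₁ e₂ i⁆ ∈ S ∧ ⁅e₂, pos e₁ e₂ i⁆ ∈ S ∧ ⁅f₁, pos e₁ e₂ i⁆ ∈ S ∧
      ⁅f₂, pos e₁ e₂ i⁆ ∈ S := by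
  have p0 : e₁ ∈ S := hp 0
  have p1 : e₂ ∈ S := hp 1
  have p2 : ⁅e₁, e₂⁆ ∈ S := hp 2
  have p3 : ⁅e₁, ⁅e₁, e₂⁆⁆ ∈ S := hp 3
  have p4 : ⁅e₁, ⁅e₁, ⁅e₁, e₂⁆⁆⁆ ∈ S := hp 4
  have p5 : ⁅e₂, ⁅e₁, ⁅e₁, ⁅e₁, e₂⁆⁆⁆⁆ ∈ S := hp 5
  fin_cases i
  · refine ⟨?_, ?_, ?_, ?_⟩ <;> change ⁅_, e₁⁆ ∈ S
    · simp
    · rw [← lie_skew]; exact S.neg_mem p2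
    · rw [← lie_skew, h.e₁f₁]; exact S.neg_mem hh₁
    · rw [← lie_skew, h.e₁f₂]; simp
  · refine ⟨?_, ?_, ?_, ?_⟩ <;> change ⁅_, e₂⁆ ∈ S
    · exact p2
    · simp
    · rw [← lie_skew, h.e₂f₁]; simp
    · rw [← lie_skew, h.e₂f₂]; exact S.neg_mem hh₂
  · exact ⟨p3, h.lie_e₂_e₃ ▸ S.zero_mem, h.lie_f₁_e₃ ▸ S.smul_mem _ p1,
      h.lie_f₂_e₃ ▸ S.smul_mem _ p0⟩
  · exact ⟨p4, h.lie_e₂_e₄ ▸ S.zero_mem, h.lie_f₁_e₄ ▸ S.smul_mem _ p2,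
      h.lie_f₂_e₄ ▸ S.zero_mem⟩
  · exact ⟨h.serre_e₁ ▸ S.zero_mem, p5, h.lie_f₁_e₅ ▸ S.smul_mem _ p3,
      h.lie_f₂_e₅ ▸ S.zero_mem⟩
  · exact ⟨h.lie_e₁_e₆ ▸ S.zero_mem, h.lie_e₂_e₆ ▸ S.zero_mem, h.lie_f₁_e₆ ▸ S.zero_mem,
      h.lie_f₂_e₆ ▸ S.smul_mem _ p4⟩

/-- The Cartan generators and the iterated brackets attached to the twelve roots. -/
def spanningSet (e₁ e₂ f₁ f₂ h₁ h₂ : L) : Set L :=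
  {h₁, h₂} ∪ (range (pos e₁ e₂) ∪ range (pos f₁ f₂))

/-- A Lie algebra generated by Chevalley generators of type `G₂` is spanned by fourteen
elements. -/
theorem span_eq_top (h : IsChevalleyG2 e₁ e₂ f₁ f₂ h₁ h₂)
    (hgen : ∀ K : LieSubalgebra ℝ L, e₁ ∈ K → e₂ ∈ K → f₁ ∈ K → f₂ ∈ K → K = ⊤) :
    Submodule.span ℝ (spanningSet e₁ e₂ f₁ f₂ h₁ h₂) = ⊤ := by
  set S := Submodule.span ℝ (spanningSet e₁ e₂ f₁ f₂ h₁ h₂) with hS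
  have hh₁ : h₁ ∈ S := Submodule.subset_span (Or.inl (Or.inl rfl))
  have hh₂ : h₂ ∈ S := Submodule.subset_span (Or.inl (Or.inr rfl))
  have hp : ∀ i, pos e₁ e₂ i ∈ S := fun i => Submodule.subset_span (Or.inr (Or.inl ⟨i, rfl⟩))
  have hn : ∀ i, pos f₁ f₂ i ∈ S := fun i => Submodule.subset_span (Or.inr (Or.inr ⟨i, rfl⟩))
  have hpp := h.lie_pos_mem hh₁ hh₂ hp
  -- Under the involution the four components of `hnn i` are the brackets with f₁, f₂, e₁, e₂ in
  -- this order.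
  have hnn := h.symm.lie_pos_mem (S.neg_mem hh₁) (S.neg_mem hh₂) hn
  have key : ∀ x : L, ⁅x, h₁⁆ ∈ S → ⁅x, h₂⁆ ∈ S → (∀ i, ⁅x, pos e₁ e₂ i⁆ ∈ S) →
      (∀ i, ⁅x, pos f₁ f₂ i⁆ ∈ S) → ∀ s ∈ S, ⁅x, s⁆ ∈ S := by
    intro x a b c d s hs
    have : S ≤ S.comap (LieAlgebra.ad ℝ L x : L →ₗ[ℝ] L) := by
      refine Submodule.span_le.2 ?_
      rintro _ ((rfl | rfl) | (⟨i, rfl⟩ | ⟨i, rfl⟩))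
      exacts [a, b, c i, d i]
    exact this hs
  -- By the Jacobi identity the elements whose adjoint action preserves S form a subalgebra. It
  -- contains the four generators, hence is everything.
  let N : LieSubalgebra ℝ L :=
    { carrier := {x | ∀ s ∈ S, ⁅x, s⁆ ∈ S}
      add_mem' := fun {x y} hx hy s hs => by
        rw [add_lie]; exact S.add_mem (hx s hs) (hy s hs)
      zero_mem' := fun s _ => by simp
      smul_mem' := fun c x hx s hs => by
        rw [smul_lie]; exact S.smul_mem c (hx s hs)
      lie_mem' := fun {x y} hx hy s hs => by
        rw [lie_lie]; exact S.sub_mem (hx _ (hy s hs)) (hy _ (hx s hs)) }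
  have hN : N = ⊤ := by
    refine hgen N ?_ ?_ ?_ ?_
    · refine key _ ?_ ?_ (fun i => (hpp i).1) fun i => (hnn i).2.2.1
      · rw [← lie_skew, h.h₁e₁]; exact S.neg_mem (S.smul_mem _ (hp 0))
      · rw [← lie_skew, h.h₂e₁]; exact S.neg_mem (S.smul_mem _ (hp 0))
    · refine key _ ?_ ?_ (fun i => (hpp i).2.1) fun i => (hnn i).2.2.2
      · rw [← lie_skew, h.h₁e₂]; exact S.neg_mem (S.smul_mem _ (hp 1))
      · rw [← lie_skew, h.h₂e₂]; exact S.neg_mem (S.smul_mem _ (hp 1))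
    · refine key _ ?_ ?_ (fun i => (hpp i).2.2.1) fun i => (hnn i).1
      · rw [← lie_skew, h.h₁f₁]; exact S.neg_mem (S.smul_mem _ (hn 0))
      · rw [← lie_skew, h.h₂f₁]; exact S.neg_mem (S.smul_mem _ (hn 0))
    · refine key _ ?_ ?_ (fun i => (hpp i).2.2.2) fun i => (hnn i).2.1
      · rw [← lie_skew, h.h₁f₂]; exact S.neg_mem (S.smul_mem _ (hn 1))
      · rw [← lie_skew, h.h₂f₂]; exact S.neg_mem (S.smul_mem _ (hn 1))
  -- Since every element preserves S, in particular S is a subalgebra, and it contains the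
  -- generators.
  let K : LieSubalgebra ℝ L :=
    { S with
      lie_mem' := fun {x y} _ hy => (hN ▸ LieSubalgebra.mem_top x : x ∈ N) y hy }
  have hK : K = ⊤ := hgen K (hp 0) (hp 1) (hn 0) (hn 1)
  rw [eq_top_iff]
  intro x _
  exact (hK ▸ LieSubalgebra.mem_top x : x ∈ K)

end IsChevalleyG2

/-! ### The Lie algebra 𝔤₂ as a quotient of a free Lie algebra. -/

open CartanMatrix (Generators)

/-- The quotient map onto the Lie algebra `𝔤₂`. -/
noncomputable def serreMk : FreeLieAlgebra ℝ (Generators (Fin 2)) →ₗ⁅ℝ⁆ LieAlgebra.g₂ ℝ where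
  toFun x := (LieSubmodule.Quotient.mk x :
    FreeLieAlgebra ℝ (Generators (Fin 2)) ⧸ CartanMatrix.Relations.toIdeal ℝ CartanMatrix.G₂)
  map_add' _ _ := rfl
  map_smul' _ _ := rfl
  map_lie' := rfl

theorem serreMk_surjective : Function.Surjective serreMk := fun x =>
  LieSubmodule.Quotient.surjective_mk' (CartanMatrix.Relations.toIdeal ℝ CartanMatrix.G₂) x

theorem serreMk_eq_zero {x : FreeLieAlgebra ℝ (Generators (Fin 2))}
    (h : x ∈ CartanMatrix.Relations.toSet ℝ CartanMatrix.G₂) : serreMk x = 0 :=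
  LieSubmodule.Quotient.mk_eq_zero'.2 (LieSubmodule.subset_lieSpan h)

/-- The image of a generator in the Lie algebra `𝔤₂`. -/
noncomputable def serreGen (g : Generators (Fin 2)) : LieAlgebra.g₂ ℝ :=
  serreMk (FreeLieAlgebra.of ℝ g)

section Relations

open CartanMatrix.Relations

theorem serre_HH (i j : Fin 2) : ⁅serreGen (.H i), serreGen (.H j)⁆ = 0 := by
  have h := serreMk_eq_zero (x := HH ℝ (i, j)) (by simp [toSet])
  simpa [HH, serreGen] using h

theorem serre_EF_same (i : Fin 2) :
    ⁅serreGen (.E i), serreGen (.F i)⁆ = serreGen (.H i) := by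
  have h := serreMk_eq_zero (x := EF ℝ (i, i)) (by
    simp only [toSet, mem_union, mem_range_self, true_or, or_true])
  simpa [EF, serreGen, sub_eq_zero] using h

theorem serre_EF_ne {i j : Fin 2} (hij : i ≠ j) :
    ⁅serreGen (.E i), serreGen (.F j)⁆ = 0 := by
  have h := serreMk_eq_zero (x := EF ℝ (i, j)) (by
    simp only [toSet, mem_union, mem_range_self, true_or, or_true])
  simpa [EF, serreGen, hij] using h

theorem serre_HE (i j : Fin 2) : ⁅serreGen (.H i), serreGen (.E j)⁆ =
    (CartanMatrix.G₂ i j : ℝ) • serreGen (.E j) := by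
  have h := serreMk_eq_zero (x := HE ℝ CartanMatrix.G₂ (i, j)) (by
    simp only [toSet, mem_union, mem_range_self, true_or, or_true])
  simpa [HE, serreGen, sub_eq_zero, Int.cast_smul_eq_zsmul] using h

theorem serre_HF (i j : Fin 2) : ⁅serreGen (.H i), serreGen (.F j)⁆ =
    (-CartanMatrix.G₂ i j : ℝ) • serreGen (.F j) := by
  have h := serreMk_eq_zero (x := HF ℝ CartanMatrix.G₂ (i, j)) (by
    simp only [toSet, mem_union, mem_range_self, true_or, or_true])
  rw [neg_smul, Int.cast_smul_eq_zsmul, eq_neg_iff_add_eq_zero]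
  simpa [HF, serreGen] using h

/-- One application of ad E i is already contained in the bracket, so the exponent -Aᵢⱼ stands for
the usual 1 - Aᵢⱼ when i ≠ j. -/
theorem serre_adE (i j : Fin 2) :
    serreMk (((LieAlgebra.ad ℝ _ (FreeLieAlgebra.of ℝ (Generators.E i))) ^
      (-CartanMatrix.G₂ i j).toNat)
      ⁅FreeLieAlgebra.of ℝ (Generators.E i), FreeLieAlgebra.of ℝ (Generators.E j)⁆) = 0 :=
  serreMk_eq_zero (x := adE ℝ CartanMatrix.G₂ (i, j)) (by
    simp only [toSet, mem_union, mem_range_self, true_or, or_true])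

theorem serre_adF (i j : Fin 2) :
    serreMk (((LieAlgebra.ad ℝ _ (FreeLieAlgebra.of ℝ (Generators.F i))) ^
      (-CartanMatrix.G₂ i j).toNat)
      ⁅FreeLieAlgebra.of ℝ (Generators.F i), FreeLieAlgebra.of ℝ (Generators.F j)⁆) = 0 :=
  serreMk_eq_zero (x := adF ℝ CartanMatrix.G₂ (i, j)) (by
    simp only [toSet, mem_union, mem_range_self, or_true])

end Relations

theorem isChevalleyG2_serreGen :
    IsChevalleyG2 (serreGen (.E 0)) (serreGen (.E 1)) (serreGen (.F 0)) (serreGen (.F 1))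
      (serreGen (.H 0)) (serreGen (.H 1)) where
  hh := serre_HH 0 1
  e₁f₁ := serre_EF_same 0
  e₂f₂ := serre_EF_same 1
  e₁f₂ := serre_EF_ne (by decide)
  e₂f₁ := serre_EF_ne (by decide)
  h₁e₁ := by rw [serre_HE]; simp [CartanMatrix.G₂]
  h₁e₂ := by rw [serre_HE]; simp [CartanMatrix.G₂]
  h₂e₁ := by rw [serre_HE]; simp [CartanMatrix.G₂]
  h₂e₂ := by rw [serre_HE]; simp [CartanMatrix.G₂]
  h₁f₁ := by rw [serre_HF]; simp [CartanMatrix.G₂]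
  h₁f₂ := by rw [serre_HF]; simp [CartanMatrix.G₂]
  h₂f₁ := by rw [serre_HF]; simp [CartanMatrix.G₂]
  h₂f₂ := by rw [serre_HF]; simp [CartanMatrix.G₂]
  serre_e₁ := by simpa [CartanMatrix.G₂, pow_succ, serreGen] using serre_adE 0 1
  serre_e₂ := by simpa [CartanMatrix.G₂, serreGen] using serre_adE 1 0
  serre_f₁ := by simpa [CartanMatrix.G₂, pow_succ, serreGen] using serre_adF 0 1
  serre_f₂ := by simpa [CartanMatrix.G₂, serreGen] using serre_adF 1 0

/-- The H's need not be assumed, being the brackets ⁅E, F⁆. This is the generation hypothesis of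
`IsChevalleyG2.span_eq_top`. -/
theorem eq_top_of_serreGen_mem (K : LieSubalgebra ℝ (LieAlgebra.g₂ ℝ))
    (h₀ : serreGen (.E 0) ∈ K) (h₁ : serreGen (.E 1) ∈ K) (h₂ : serreGen (.F 0) ∈ K)
    (h₃ : serreGen (.F 1) ∈ K) : K = ⊤ := by
  have hmem : ∀ g, serreGen g ∈ K := by
    rintro (i | i | i)
    · rw [← serre_EF_same i]
      fin_cases i
      exacts [K.lie_mem h₀ h₂, K.lie_mem h₁ h₃]
    · fin_cases i
      exacts [h₀, h₁]
    · fin_cases i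
      exacts [h₂, h₃]
  -- The surjective quotient map factors through K, which forces K to be everything.
  have hcomp : K.incl.comp (FreeLieAlgebra.lift ℝ fun g => (⟨serreGen g, hmem g⟩ : K)) = serreMk :=
    FreeLieAlgebra.hom_ext fun g => by simp [serreGen]
  rw [eq_top_iff]
  intro x _
  obtain ⟨y, rfl⟩ := serreMk_surjective x
  rw [← hcomp]
  exact (FreeLieAlgebra.lift ℝ (fun g => (⟨serreGen g, hmem g⟩ : K)) y).2

/-- The universal property of the Serre presentation of `𝔤₂`. -/
theorem exists_lieHom_of_isChevalleyG2 {e₁ e₂ f₁ f₂ h₁ h₂ : L}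
    (h : IsChevalleyG2 e₁ e₂ f₁ f₂ h₁ h₂) : ∃ φ : LieAlgebra.g₂ ℝ →ₗ⁅ℝ⁆ L,
      φ (serreGen (.E 0)) = e₁ ∧ φ (serreGen (.E 1)) = e₂ ∧ φ (serreGen (.F 0)) = f₁ ∧
      φ (serreGen (.F 1)) = f₂ ∧ φ (serreGen (.H 0)) = h₁ ∧ φ (serreGen (.H 1)) = h₂ := by
  let g : Generators (Fin 2) → L
    | .H i => ![h₁, h₂] i
    | .E i => ![e₁, e₂] i
    | .F i => ![f₁, f₂] i
  let ψ := FreeLieAlgebra.lift ℝ g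
  have hψ : ∀ x, ψ (FreeLieAlgebra.of ℝ x) = g x := FreeLieAlgebra.lift_of_apply g
  have hker : CartanMatrix.Relations.toIdeal ℝ CartanMatrix.G₂ ≤ ψ.ker := by
    refine LieSubmodule.lieSpan_le.2 ?_
    rintro _ (((((⟨⟨i, j⟩, rfl⟩ | ⟨⟨i, j⟩, rfl⟩) | ⟨⟨i, j⟩, rfl⟩) | ⟨⟨i, j⟩, rfl⟩) |
      ⟨⟨i, j⟩, rfl⟩) | ⟨⟨i, j⟩, rfl⟩) <;> rw [SetLike.mem_coe, LieHom.mem_ker]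
    · have h' : ⁅h₂, h₁⁆ = 0 := by rw [← lie_skew, h.hh, neg_zero]
      fin_cases i <;> fin_cases j <;> simp [CartanMatrix.Relations.HH, hψ, g, h.hh, h']
    · fin_cases i <;> fin_cases j <;>
        simp [CartanMatrix.Relations.EF, hψ, g, h.e₁f₁, h.e₁f₂, h.e₂f₁, h.e₂f₂]
    · fin_cases i <;> fin_cases j <;>
        simp [CartanMatrix.Relations.HE, CartanMatrix.G₂, hψ, g, h.h₁e₁, h.h₁e₂, h.h₂e₁, h.h₂e₂] <;>
        module
    · fin_cases i <;> fin_cases j <;>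
        simp [CartanMatrix.Relations.HF, CartanMatrix.G₂, hψ, g, h.h₁f₁, h.h₁f₂, h.h₂f₁, h.h₂f₂] <;>
        module
    · fin_cases i <;> fin_cases j <;>
        simp [CartanMatrix.Relations.adE, CartanMatrix.G₂, pow_succ, hψ, g, h.serre_e₁, h.serre_e₂]
    · fin_cases i <;> fin_cases j <;>
        simp [CartanMatrix.Relations.adF, CartanMatrix.G₂, pow_succ, hψ, g, h.serre_f₁, h.serre_f₂]
  let φ : LieAlgebra.g₂ ℝ →ₗ⁅ℝ⁆ L :=
    { Submodule.liftQ (CartanMatrix.Relations.toIdeal ℝ CartanMatrix.G₂).toSubmodule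
        (ψ : FreeLieAlgebra ℝ (Generators (Fin 2)) →ₗ[ℝ] L) hker with
      map_lie' := by
        intro x y
        obtain ⟨x, rfl⟩ := serreMk_surjective x
        obtain ⟨y, rfl⟩ := serreMk_surjective y
        exact ψ.map_lie x y }
  have hφ : ∀ x, φ (serreGen x) = g x := hψ
  exact ⟨φ, hφ _, hφ _, hφ _, hφ _, hφ _, hφ _⟩

end Serre

/-! ### The Lie algebra spanned by the fourteen fields -/

/-- The simple roots are the short arrow at hour 3 and the long arrow at hour 8, which enclose 150°.
The Cartan elements are the coroots 2r/(r,r), namely (2, 0) and (-1, -√3/3). The multiples of S⁹ and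
L² are fixed by ⁅eᵢ, fᵢ⁆ = hᵢ. -/
theorem isChevalleyG2_fields :
    IsChevalleyG2 vfS3 vfL8 ((-2 : ℝ) • vfS9) ((1 / 2 : ℝ) • vfL2) ((2 : ℝ) • vfh1)
      (-vfh1 - (√3 / 3 : ℝ) • vfh2) where
  hh := by simp [lie_h1_h2]
  e₁f₁ := by rw [lie_smul, lie_S3_S9]; module
  e₂f₂ := by rw [lie_smul, lie_L8_L2]; module
  e₁f₂ := by rw [lie_smul, lie_S3_L2, smul_zero]
  e₂f₁ := by rw [lie_smul, lie_L8_S9, smul_zero]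
  h₁e₁ := by rw [smul_lie, lie_h1_S3]; module
  h₁e₂ := by rw [smul_lie, lie_h1_L8]; module
  h₂e₁ := by rw [sub_lie, neg_lie, smul_lie, lie_h1_S3, lie_h2_S3]; module
  h₂e₂ := by
    rw [sub_lie, neg_lie, smul_lie, lie_h1_L8, lie_h2_L8]
    have h3 : √3 ^ 2 = (3 : ℝ) := Real.sq_sqrt (by norm_num)
    match_scalars
    linear_combination (1 / 6 : ℝ) * h3
  h₁f₁ := by rw [smul_lie, lie_smul, lie_h1_S9]; module
  h₁f₂ := by rw [smul_lie, lie_smul, lie_h1_L2]; module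
  h₂f₁ := by rw [sub_lie, neg_lie, smul_lie, lie_smul, lie_smul, lie_h1_S9, lie_h2_S9]; module
  h₂f₂ := by
    rw [sub_lie, neg_lie, smul_lie, lie_smul, lie_smul, lie_h1_L2, lie_h2_L2]
    have h3 : √3 ^ 2 = (3 : ℝ) := Real.sq_sqrt (by norm_num)
    match_scalars
    linear_combination (-1 / 12 : ℝ) * h3
  serre_e₁ := by
    simp [lie_S3_L8, lie_S3_S7, lie_S3_S5, lie_S3_L4]
  serre_e₂ := by
    rw [← lie_skew vfL8 vfS3, lie_S3_L8, lie_neg, lie_smul, lie_L8_S7]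
    simp
  serre_f₁ := by simp [lie_S9_L2, lie_S9_S1, lie_S9_S11, lie_S9_L10]
  serre_f₂ := by
    rw [← lie_skew _ ((-2 : ℝ) • vfS9), lie_neg, smul_lie (-2 : ℝ), lie_smul _ vfS9, lie_S9_L2]
    simp [lie_L2_S1]

/-- The fields `h₁, h₂, S¹, L², …, L¹²`. -/
noncomputable def basisVF : Fin 14 → VF := Fin.cons vfh1 (Fin.cons vfh2 rootVF)

/-- The generating function `ϖ(X)` of a contact vector field `X`. -/
def ham (X : J → J) (u : J) : ℝ := varpi u (X u)

theorem sum_basisVF_apply (c : Fin 14 → ℝ) (u : J) :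
    ((∑ i, c i • basisVF i : VF) : J → J) u =
      c 0 • h1 u + c 1 • h2 u + c 2 • S1 u + c 3 • L2 u + c 4 • S3 u + c 5 • L4 u + c 6 • S5 u +
        c 7 • L6 u + c 8 • S7 u + c 9 • L8 u + c 10 • S9 u + c 11 • L10 u + c 12 • S11 u +
        c 13 • L12 u := by
  simp only [Fin.sum_univ_succ, Fin.sum_univ_zero, add_zero, ← add_assoc]
  rfl

theorem eq_zero_of_ham_sum_eq_zero (c : Fin 14 → ℝ)
    (h : ∀ u, ham ((∑ i, c i • basisVF i : VF) : J → J) u = 0) : c = 0 := by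
  have h' : ∀ x y z p q : ℝ, _ := fun x y z p q => h ![x, y, z, p, q]
  simp only [ham, varpi, sum_basisVF_apply] at h'
  simp [h1, h2, S1, L2, S3, L4, S5, L6, S7, L8, S9, L10, S11, L12, field] at h'
  -- The generating functions are polynomials. On each coordinate axis only a few monomials survive,
  -- and enough points on the axis separate them. The coefficients of S¹ and S¹¹ are left for the
  -- mixed terms zq and yz.
  have h7 : c 7 = 0 := by linarith [h' 0 0 0 0 0]
  have hs : (0 : ℝ) < √3 := by positivity
  have h1 : c 1 = 0 := by
    have : c 1 * √3 = 0 := by linarith [h' 0 0 1 0 0, h' 0 0 (-1) 0 0]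
    simpa [hs.ne'] using this
  have h13 : c 13 = 0 := by linarith [h' 0 0 1 0 0, h' 0 0 (-1) 0 0]
  simp only [h7, h1, h13] at h'
  have h6 : c 6 = 0 := by linarith [h' 0 0 0 0 1, h' 0 0 0 0 (-1), h' 0 0 0 0 2]
  have h4 : c 4 = 0 := by linarith [h' 0 0 0 0 1, h' 0 0 0 0 (-1), h' 0 0 0 0 2]
  have h3 : c 3 = 0 := by linarith [h' 0 0 0 0 1, h' 0 0 0 0 (-1), h' 0 0 0 0 2]
  simp only [h6, h4, h3] at h'
  have h8 : c 8 = 0 := by linarith [h' 0 1 0 0 0, h' 0 (-1) 0 0 0, h' 0 2 0 0 0]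
  have h10 : c 10 = 0 := by linarith [h' 0 1 0 0 0, h' 0 (-1) 0 0 0, h' 0 2 0 0 0]
  have h11 : c 11 = 0 := by linarith [h' 0 1 0 0 0, h' 0 (-1) 0 0 0, h' 0 2 0 0 0]
  have h5 : c 5 = 0 := by linarith [h' 1 0 0 0 0]
  simp only [h8, h10, h11, h5] at h'
  have h9 : c 9 = 0 := by linarith [h' 0 0 0 1 0, h' 0 0 0 (-1) 0]
  have h0 : c 0 = 0 := by linarith [h' 0 0 0 1 0, h' 0 0 0 (-1) 0]
  have h2 : c 2 = 0 := by linarith [h' 0 0 1 0 1]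
  have h12 : c 12 = 0 := by linarith [h' 0 1 1 0 0]
  funext i
  fin_cases i <;> assumption

theorem linearIndependent_basisVF : LinearIndependent ℝ basisVF := by
  rw [Fintype.linearIndependent_iff]
  intro c hc
  refine congrFun (eq_zero_of_ham_sum_eq_zero c fun u => ?_)
  rw [hc]
  simp [ham, varpi]

theorem span_basisVF_le {S : Submodule ℝ VF} (h₁ : vfh1 ∈ S) (h₂ : vfh2 ∈ S)
    (h : ∀ i, rootVF i ∈ S) : Submodule.span ℝ (range basisVF) ≤ S := by
  rw [Submodule.span_le]
  rintro _ ⟨i, rfl⟩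
  refine Fin.cases h₁ (fun i => ?_) i
  exact Fin.cases h₂ h i

theorem exists_lieHom_fields : ∃ φ : LieAlgebra.g₂ ℝ →ₗ⁅ℝ⁆ VF, Function.Injective φ ∧
    φ.range.toSubmodule = Submodule.span ℝ (range basisVF) := by
  obtain ⟨φ, he₁, he₂, hf₁, hf₂, hh₁, hh₂⟩ := exists_lieHom_of_isChevalleyG2 isChevalleyG2_fields
  have hs3 : √3 * √3 = (3 : ℝ) := Real.mul_self_sqrt (by norm_num)
  have hs : √3 ≠ (0 : ℝ) := by positivity
  -- Preimages of the fourteen fields. Each scalar inverts the product of structure constants met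
  -- along the iterated bracket; for instance the fourth bracket in the S³-string is 2 · (1/2) · 2 ·
  -- L⁴ = 2L⁴.
  let w : Fin 14 → LieAlgebra.g₂ ℝ :=
    ![(1 / 2 : ℝ) • serreGen (.H 0),
      (-√3 : ℝ) • ((1 / 2 : ℝ) • serreGen (.H 0) + serreGen (.H 1)),
      (2 : ℝ) • IsChevalleyG2.pos (serreGen (.F 0)) (serreGen (.F 1)) 2,
      (2 : ℝ) • IsChevalleyG2.pos (serreGen (.F 0)) (serreGen (.F 1)) 1,
      IsChevalleyG2.pos (serreGen (.E 0)) (serreGen (.E 1)) 0,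
      (1 / 2 : ℝ) • IsChevalleyG2.pos (serreGen (.E 0)) (serreGen (.E 1)) 4,
      IsChevalleyG2.pos (serreGen (.E 0)) (serreGen (.E 1)) 3,
      (1 / 2 : ℝ) • IsChevalleyG2.pos (serreGen (.E 0)) (serreGen (.E 1)) 5,
      (1 / 2 : ℝ) • IsChevalleyG2.pos (serreGen (.E 0)) (serreGen (.E 1)) 2,
      IsChevalleyG2.pos (serreGen (.E 0)) (serreGen (.E 1)) 1,
      (-(1 / 2) : ℝ) • IsChevalleyG2.pos (serreGen (.F 0)) (serreGen (.F 1)) 0,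
      (1 / 24 : ℝ) • IsChevalleyG2.pos (serreGen (.F 0)) (serreGen (.F 1)) 4,
      (-(1 / 4) : ℝ) • IsChevalleyG2.pos (serreGen (.F 0)) (serreGen (.F 1)) 3,
      (-(1 / 6) : ℝ) • IsChevalleyG2.pos (serreGen (.F 0)) (serreGen (.F 1)) 5]
  have hφw : ∀ i, φ (w i) = basisVF i := by
    intro i
    fin_cases i
    · simp [w, hh₁, basisVF]
    · simp [w, hh₁, hh₂, basisVF]; match_scalars
      · ring
      · linear_combination (1 / 3 : ℝ) * hs3
    · simp [w, hf₁, hf₂, IsChevalleyG2.pos, lie_S9_L2]; rfl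
    · simp [w, hf₂, IsChevalleyG2.pos]; rfl
    · simp [w, he₁, IsChevalleyG2.pos]; rfl
    · simp [w, he₁, he₂, IsChevalleyG2.pos, lie_S3_L8, lie_S3_S7, lie_S3_S5]; rfl
    · simp [w, he₁, he₂, IsChevalleyG2.pos, lie_S3_L8, lie_S3_S7]; rfl
    · simp [w, he₁, he₂, IsChevalleyG2.pos, lie_S3_L8, lie_S3_S7, lie_S3_S5, lie_L8_L4]; rfl
    · simp [w, he₁, he₂, IsChevalleyG2.pos, lie_S3_L8]; rfl
    · simp [w, he₂, IsChevalleyG2.pos]; rfl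
    · simp [w, hf₁, IsChevalleyG2.pos]; rfl
    · simp [w, hf₁, hf₂, IsChevalleyG2.pos, lie_S9_L2, lie_S9_S1, lie_S9_S11]
      change _ = vfL10; module
    · simp [w, hf₁, hf₂, IsChevalleyG2.pos, lie_S9_L2, lie_S9_S1]
      rfl
    · simp [w, hf₁, hf₂, IsChevalleyG2.pos, lie_S9_L2, lie_S9_S1, lie_S9_S11, lie_L2_L10]
      change _ = vfL12; module
  have hspan : Submodule.span ℝ (range w) = ⊤ := by
    rw [eq_top_iff, ← isChevalleyG2_serreGen.span_eq_top eq_top_of_serreGen_mem,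
      Submodule.span_le]
    have key : ∀ (i : Fin 14) (c : ℝ) x, c ≠ 0 → c • x = w i → x ∈ Submodule.span ℝ (range w) := by
      intro i c x hc hx
      rw [← inv_smul_smul₀ hc x, hx]
      exact Submodule.smul_mem _ _ (Submodule.subset_span ⟨i, rfl⟩)
    have k₁ := key 0 (1 / 2) _ (by norm_num) rfl
    rintro _ ((rfl | rfl) | (⟨i, rfl⟩ | ⟨i, rfl⟩))
    · exact k₁
    · have k₂ := key 1 (-√3) _ (neg_ne_zero.2 hs) rfl
      simpa using Submodule.sub_mem _ k₂ (Submodule.smul_mem _ (1 / 2 : ℝ) k₁)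
    · fin_cases i
      exacts [key 4 1 _ one_ne_zero (one_smul _ _), key 9 1 _ one_ne_zero (one_smul _ _),
        key 8 (1 / 2) _ (by norm_num) rfl, key 6 1 _ one_ne_zero (one_smul _ _),
        key 5 (1 / 2) _ (by norm_num) rfl, key 7 (1 / 2) _ (by norm_num) rfl]
    · fin_cases i
      exacts [key 10 (-(1 / 2)) _ (by norm_num) rfl, key 3 2 _ (by norm_num) rfl,
        key 2 2 _ (by norm_num) rfl, key 12 (-(1 / 4)) _ (by norm_num) rfl,
        key 11 (1 / 24) _ (by norm_num) rfl, key 13 (-(1 / 6)) _ (by norm_num) rfl]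
  have hrange : φ ∘ w = basisVF := funext hφw
  refine ⟨φ, ?_, ?_⟩
  -- The preimages span 𝔤₂ and their images are independent, so a combination mapped to zero has
  -- zero coefficients.
  · rw [injective_iff_map_eq_zero]
    intro x hx
    obtain ⟨c, rfl⟩ := (Submodule.mem_span_range_iff_exists_fun ℝ).1
      (hspan ▸ Submodule.mem_top : x ∈ Submodule.span ℝ (range w))
    have hc : c = 0 := by
      refine funext (Fintype.linearIndependent_iff.1 linearIndependent_basisVF c ?_)
      rw [← hx, map_sum]
      simp [hφw]
    simp [hc]
  · rw [LieHom.range_toSubmodule, LinearMap.range_eq_map, ← hspan, Submodule.map_span, ← range_comp]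
    exact congrArg (fun f : Fin 14 → VF => Submodule.span ℝ (range f)) hrange

/-! ### The prolongation of the symmetry equations -/

/-- Operators satisfying the commutation relations of a Heisenberg algebra with centre `Z`. -/
structure IsHeisenberg {V : Type*} [AddCommGroup V] [Module ℝ V] (A B C D Z : V →ₗ[ℝ] V) :
    Prop where
  ab : ∀ g, B (A g) = A (B g)
  ac : ∀ g, C (A g) = A (C g)
  bd : ∀ g, D (B g) = B (D g)
  cd : ∀ g, D (C g) = C (D g)
  bc : ∀ g, B (C g) = C (B g) + Z g
  da : ∀ g, D (A g) = A (D g) + Z g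
  za : ∀ g, A (Z g) = Z (A g)
  zb : ∀ g, B (Z g) = Z (B g)
  zc : ∀ g, C (Z g) = Z (C g)
  zd : ∀ g, D (Z g) = Z (D g)

/-- The equations on the generating function of a symmetry. -/
structure SymmEqs {V : Type*} [AddCommGroup V] [Module ℝ V] (A B C D Z : V →ₗ[ℝ] V) (f : V) :
    Prop where
  aa : A (A f) = 0
  ab : A (B f) = 0
  ac : A (C f) = (-4 : ℝ) • B (B f)
  ad : A (D f) = (-3 : ℝ) • C (B f) - (2 : ℝ) • Z f
  cc : C (C f) = (-16 / 3 : ℝ) • B (D f)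
  cd : C (D f) = 0
  dd : D (D f) = 0

namespace SymmEqs

variable {V : Type*} [AddCommGroup V] [Module ℝ V] {A B C D Z : V →ₗ[ℝ] V} {f : V}

/-- Start of the prolongation. The second derivatives not solved for by the equations are BBf, CBf
and BDf. Commuting one more derivative through the equations expresses each of their frame
derivatives through Z of a first derivative of f. -/
theorem a_bb (H : IsHeisenberg A B C D Z) (h : SymmEqs A B C D Z f) :
    A (B (B f)) = 0 := by rw [← H.ab, h.ab, map_zero]

theorem b_bb (H : IsHeisenberg A B C D Z) (h : SymmEqs A B C D Z f) :
    B (B (B f)) = (-1 / 4 : ℝ) • Z (A f) := by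
  have e : B (A (C f)) = Z (A f) := by
    rw [H.ab, H.bc, map_add, ← H.ac, h.ab, map_zero, zero_add, H.za]
  rw [h.ac, map_smul] at e
  linear_combination (norm := module) (-1 / 4 : ℝ) • e

theorem a_bd (H : IsHeisenberg A B C D Z) (h : SymmEqs A B C D Z f) :
    A (B (D f)) = -Z (B f) := by
  have e := H.da (B f)
  rw [h.ab, map_zero, H.bd] at e
  linear_combination (norm := module) -e

theorem c_bb (H : IsHeisenberg A B C D Z) (h : SymmEqs A B C D Z f) :
    C (B (B f)) = (-4 / 3 : ℝ) • Z (B f) := by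
  have e : B (A (D f)) = _ := congrArg B h.ad
  rw [H.ab, h.a_bd H, map_sub, map_smul, map_smul, H.bc, H.zb] at e
  linear_combination (norm := module) (1 / 3 : ℝ) • e

theorem c_cb (H : IsHeisenberg A B C D Z) (h : SymmEqs A B C D Z f) :
    C (C (B f)) = (-2 / 3 : ℝ) • Z (C f) := by
  have e : C (A (D f)) = _ := congrArg C h.ad
  rw [H.ac, h.cd, map_zero, map_sub, map_smul, map_smul, H.zc] at e
  linear_combination (norm := module) (1 / 3 : ℝ) • e

theorem b_bd (H : IsHeisenberg A B C D Z) (h : SymmEqs A B C D Z f) :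
    B (B (D f)) = (-1 / 4 : ℝ) • Z (C f) := by
  have e : B (C (C f)) = _ := congrArg B h.cc
  rw [H.bc, H.bc, map_add, H.zc, h.c_cb H, map_smul] at e
  linear_combination (norm := module) (3 / 16 : ℝ) • e

theorem d_bb (H : IsHeisenberg A B C D Z) (h : SymmEqs A B C D Z f) :
    D (B (B f)) = (-1 / 4 : ℝ) • Z (C f) := by rw [H.bd, H.bd, h.b_bd H]

theorem a_cb (H : IsHeisenberg A B C D Z) (h : SymmEqs A B C D Z f) :
    A (C (B f)) = 0 := by rw [← H.ac, h.ab, map_zero]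

theorem b_cb (H : IsHeisenberg A B C D Z) (h : SymmEqs A B C D Z f) :
    B (C (B f)) = (-1 / 3 : ℝ) • Z (B f) := by
  rw [H.bc, h.c_bb H]; module

theorem c_bd (H : IsHeisenberg A B C D Z) (h : SymmEqs A B C D Z f) :
    C (B (D f)) = -Z (D f) := by
  have e := H.bc (D f)
  rw [h.cd, map_zero] at e
  linear_combination (norm := module) -e

theorem d_cb (H : IsHeisenberg A B C D Z) (h : SymmEqs A B C D Z f) :
    D (C (B f)) = -Z (D f) := by rw [H.cd, H.bd, h.c_bd H]

theorem d_bd (H : IsHeisenberg A B C D Z) (h : SymmEqs A B C D Z f) :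
    D (B (D f)) = 0 := by rw [H.bd, h.dd, map_zero]

/-- Integrability condition: BC - CB = Z applied to BBf, with both orders evaluated by the
third-order formulas, leaves a nonzero multiple of ZBBf. The same argument on CBf and BDf gives
`z_cb` and `z_bd`. -/
theorem z_bb (H : IsHeisenberg A B C D Z) (h : SymmEqs A B C D Z f) :
    Z (B (B f)) = 0 := by
  have e := H.bc (B (B f))
  rw [h.c_bb H, h.b_bb H, map_smul, map_smul, H.zb, H.zc, H.ac, h.ac, map_smul] at e
  linear_combination (norm := module) (-3 / 10 : ℝ) • e

theorem z_cb (H : IsHeisenberg A B C D Z) (h : SymmEqs A B C D Z f) :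
    Z (C (B f)) = (-1 / 2 : ℝ) • Z (Z f) := by
  have e := H.bc (C (B f))
  rw [h.c_cb H, h.b_cb H, map_smul, map_smul, H.zb, H.zc, H.bc, map_add] at e
  linear_combination (norm := module) (-3 / 4 : ℝ) • e

theorem z_bd (H : IsHeisenberg A B C D Z) (h : SymmEqs A B C D Z f) :
    Z (B (D f)) = 0 := by
  have e := H.bc (B (D f))
  rw [h.c_bd H, h.b_bd H, map_neg, map_smul, H.zb, H.zc, h.cc, map_smul] at e
  linear_combination (norm := module) (-3 / 10 : ℝ) • e

/-- With `b_zz`, `c_zz` and `d_zz` this closes the system: ZZf is annihilated by the whole frame, so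
it behaves as a constant of integration. -/
theorem a_zz (H : IsHeisenberg A B C D Z) (h : SymmEqs A B C D Z f) :
    A (Z (Z f)) = 0 := by
  have e := congrArg Z (h.b_bb H)
  rw [← H.zb, h.z_bb H, map_zero, map_smul] at e
  rw [H.za, H.za]
  linear_combination (norm := module) (4 : ℝ) • e

theorem b_zz (H : IsHeisenberg A B C D Z) (h : SymmEqs A B C D Z f) :
    B (Z (Z f)) = 0 := by
  have e := congrArg Z (h.c_bb H)
  rw [← H.zc, h.z_bb H, map_zero, map_smul] at e
  rw [H.zb, H.zb]
  linear_combination (norm := module) (3 / 4 : ℝ) • e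

theorem c_zz (H : IsHeisenberg A B C D Z) (h : SymmEqs A B C D Z f) :
    C (Z (Z f)) = 0 := by
  have e := congrArg Z (h.b_bd H)
  rw [← H.zb, h.z_bd H, map_zero, map_smul] at e
  rw [H.zc, H.zc]
  linear_combination (norm := module) (4 : ℝ) • e

theorem d_zz (H : IsHeisenberg A B C D Z) (h : SymmEqs A B C D Z f) :
    D (Z (Z f)) = 0 := by
  have e := congrArg Z (h.c_bd H)
  rw [← H.zc, h.z_bd H, map_zero, map_neg] at e
  rw [H.zd, H.zd]
  linear_combination (norm := module) e

end SymmEqs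

/-- If the linear functional `ev` detects the vanishing of the vectors killed by `A, B, C, D`, then
a solution of the symmetry equations is determined by fourteen values of `ev`. -/
theorem SymmEqs.eq_zero {V : Type*} [AddCommGroup V] [Module ℝ V] {A B C D Z : V →ₗ[ℝ] V} {f : V}
    (H : IsHeisenberg A B C D Z) (h : SymmEqs A B C D Z f) {ev : V →ₗ[ℝ] ℝ}
    (hev : ∀ g, A g = 0 → B g = 0 → C g = 0 → D g = 0 → ev g = 0 → g = 0)
    (hf : ev f = 0) (ha : ev (A f) = 0) (hb : ev (B f) = 0) (hc : ev (C f) = 0)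
    (hd : ev (D f) = 0) (hz : ev (Z f) = 0) (hbb : ev (B (B f)) = 0) (hcb : ev (C (B f)) = 0)
    (hbd : ev (B (D f)) = 0) (hza : ev (Z (A f)) = 0) (hzb : ev (Z (B f)) = 0)
    (hzc : ev (Z (C f)) = 0) (hzd : ev (Z (D f)) = 0) (hzz : ev (Z (Z f)) = 0) : f = 0 := by
  -- Descent through the prolonged system: at each stage the frame derivatives of the next quantity
  -- involve only quantities already shown to vanish, so its value under `ev` decides. The order is
  -- ZZf, Z of the first derivatives, Zf, the three second derivatives, the first derivatives, f.
  have zz : Z (Z f) = 0 := hev _ (h.a_zz H) (h.b_zz H) (h.c_zz H) (h.d_zz H) hzz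
  have zcb : Z (C (B f)) = 0 := by rw [h.z_cb H, zz, smul_zero]
  have zbb := h.z_bb H
  have zbd := h.z_bd H
  have za : Z (A f) = 0 := by
    refine hev _ ?_ ?_ ?_ ?_ hza
    · rw [H.za, h.aa, map_zero]
    · rw [H.zb, H.ab, h.ab, map_zero]
    · rw [H.zc, H.ac, h.ac, map_smul, zbb, smul_zero]
    · rw [H.zd, H.da, h.ad]; simp [zcb, zz]
  have zb : Z (B f) = 0 := by
    refine hev _ ?_ ?_ ?_ ?_ hzb
    · rw [H.za, h.ab, map_zero]
    · rw [H.zb, zbb]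
    · rw [H.zc, zcb]
    · rw [H.zd, H.bd, zbd]
  have zc : Z (C f) = 0 := by
    refine hev _ ?_ ?_ ?_ ?_ hzc
    · rw [H.za, h.ac, map_smul, zbb, smul_zero]
    · rw [H.zb, H.bc, map_add, zcb, zz, add_zero]
    · rw [H.zc, h.cc, map_smul, zbd, smul_zero]
    · rw [H.zd, H.cd, h.cd, map_zero]
  have zd : Z (D f) = 0 := by
    refine hev _ ?_ ?_ ?_ ?_ hzd
    · rw [H.za, h.ad]; simp [zcb, zz]
    · rw [H.zb, zbd]
    · rw [H.zc, h.cd, map_zero]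
    · rw [H.zd, h.dd, map_zero]
  have z : Z f = 0 := by
    refine hev _ ?_ ?_ ?_ ?_ hz
    · rw [H.za, za]
    · rw [H.zb, zb]
    · rw [H.zc, zc]
    · rw [H.zd, zd]
  have bb : B (B f) = 0 := by
    refine hev _ (h.a_bb H) ?_ ?_ ?_ hbb
    · rw [h.b_bb H, za, smul_zero]
    · rw [h.c_bb H, zb, smul_zero]
    · rw [h.d_bb H, zc, smul_zero]
  have cb : C (B f) = 0 := by
    refine hev _ (h.a_cb H) ?_ ?_ ?_ hcb
    · rw [h.b_cb H, zb, smul_zero]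
    · rw [h.c_cb H, zc, smul_zero]
    · rw [h.d_cb H, zd, neg_zero]
  have bd : B (D f) = 0 := by
    refine hev _ ?_ ?_ ?_ (h.d_bd H) hbd
    · rw [h.a_bd H, zb, neg_zero]
    · rw [h.b_bd H, zc, smul_zero]
    · rw [h.c_bd H, zd, neg_zero]
  refine hev f ?_ ?_ ?_ ?_ hf
  · refine hev _ h.aa ?_ ?_ ?_ ha
    · rw [H.ab, h.ab]
    · rw [H.ac, h.ac, bb, smul_zero]
    · rw [H.da, h.ad]; simp [cb, z]
  · refine hev _ h.ab bb cb ?_ hb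
    rw [H.bd, bd]
  · refine hev _ ?_ ?_ ?_ ?_ hc
    · rw [h.ac, bb, smul_zero]
    · rw [H.bc, cb, z, add_zero]
    · rw [h.cc, bd, smul_zero]
    · rw [H.cd, h.cd]
  · refine hev _ ?_ bd h.cd h.dd hd
    rw [h.ad]; simp [cb, z]

open scoped Topology

/-! ### Differential operators on the smooth functions on an open set -/

/-- The smooth functions on `U`, extended by zero. -/
def smoothOn (U : Set J) : Submodule ℝ (J → ℝ) where
  carrier := {g | ContDiffOn ℝ ∞ g U ∧ ∀ u ∉ U, g u = 0}
  add_mem' {g k} hg hk := ⟨hg.1.add hk.1, fun u hu => by simp [hg.2 u hu, hk.2 u hu]⟩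
  zero_mem' := ⟨contDiffOn_const, fun _ _ => rfl⟩
  smul_mem' c g hg := ⟨contDiffOn_const.smul hg.1, fun u hu => by simp [hg.2 u hu]⟩

variable {U : Set J}

theorem smoothOn_ext {g k : smoothOn U} (h : ∀ u ∈ U, (g : J → ℝ) u = (k : J → ℝ) u) : g = k := by
  refine Subtype.ext (funext fun u => ?_)
  by_cases hu : u ∈ U
  · exact h u hu
  · rw [g.2.2 u hu, k.2.2 u hu]

theorem contDiffOn_smoothOn (g : smoothOn U) : ContDiffOn ℝ ∞ (g : J → ℝ) U := g.2.1

/-- The restriction to `U` of a function that is smooth there. -/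
noncomputable def restrictOn (g : J → ℝ) (hg : ContDiffOn ℝ ∞ g U) : smoothOn U :=
  ⟨U.indicator g, hg.congr fun _ hu => indicator_of_mem hu g,
    fun _ hu => indicator_of_notMem hu g⟩

theorem restrictOn_apply {g : J → ℝ} (hg : ContDiffOn ℝ ∞ g U) {u : J} (hu : u ∈ U) :
    (restrictOn g hg : J → ℝ) u = g u := indicator_of_mem hu g

theorem contDiffOn_fderiv_apply (hU : IsOpen U) {g : J → ℝ} (hg : ContDiffOn ℝ ∞ g U) (v : J) :
    ContDiffOn ℝ ∞ (fun u => fderiv ℝ g u v) U :=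
  (hg.fderiv_of_isOpen hU (m := ∞) (by simp)).clm_apply contDiffOn_const

theorem differentiableAt_of_contDiffOn (hU : IsOpen U) {E : Type*} [NormedAddCommGroup E]
    [NormedSpace ℝ E] {g : J → E} (hg : ContDiffOn ℝ ∞ g U) {u : J} (hu : u ∈ U) :
    DifferentiableAt ℝ g u :=
  (hg.contDiffAt (hU.mem_nhds hu)).differentiableAt (by simp)

theorem differentiableAt_smoothOn (hU : IsOpen U) (g : smoothOn U) {u : J} (hu : u ∈ U) :
    DifferentiableAt ℝ (g : J → ℝ) u := differentiableAt_of_contDiffOn hU (contDiffOn_smoothOn g) hu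

theorem fderiv_restrictOn (hU : IsOpen U) {g : J → ℝ} (hg : ContDiffOn ℝ ∞ g U) {u : J}
    (hu : u ∈ U) : fderiv ℝ (restrictOn g hg : J → ℝ) u = fderiv ℝ g u := by
  refine Filter.EventuallyEq.fderiv_eq ?_
  filter_upwards [hU.mem_nhds hu] with w hw
  exact restrictOn_apply hg hw

/-- The partial derivative `∂ᵢ` on the smooth functions on `U`. -/
noncomputable def pd (hU : IsOpen U) (i : Fin 5) : smoothOn U →ₗ[ℝ] smoothOn U where
  toFun g := restrictOn (fun u => fderiv ℝ (g : J → ℝ) u (Pi.single i 1))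
    (contDiffOn_fderiv_apply hU (contDiffOn_smoothOn g) _)
  map_add' g k := smoothOn_ext fun u hu => by
    have hg := differentiableAt_smoothOn hU g hu
    have hk := differentiableAt_smoothOn hU k hu
    change U.indicator (fun u => fderiv ℝ ((g : J → ℝ) + (k : J → ℝ)) u (Pi.single i 1)) u =
      U.indicator (fun u => fderiv ℝ (g : J → ℝ) u (Pi.single i 1)) u +
        U.indicator (fun u => fderiv ℝ (k : J → ℝ) u (Pi.single i 1)) u
    rw [indicator_of_mem hu, indicator_of_mem hu, indicator_of_mem hu, fderiv_add hg hk]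
    rfl
  map_smul' c g := smoothOn_ext fun u hu => by
    have hg := differentiableAt_smoothOn hU g hu
    change U.indicator (fun u => fderiv ℝ (c • (g : J → ℝ)) u (Pi.single i 1)) u =
      c * U.indicator (fun u => fderiv ℝ (g : J → ℝ) u (Pi.single i 1)) u
    rw [indicator_of_mem hu, indicator_of_mem hu, fderiv_const_smul hg]
    rfl

theorem pd_apply (hU : IsOpen U) (i : Fin 5) (g : smoothOn U) {u : J} (hu : u ∈ U) :
    (pd hU i g : J → ℝ) u = fderiv ℝ (g : J → ℝ) u (Pi.single i 1) :=
  restrictOn_apply (contDiffOn_fderiv_apply hU (contDiffOn_smoothOn g) _) hu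

/-- Multiplication by the coordinate `u i` on the smooth functions on `U`. -/
def mulCoord (i : Fin 5) : smoothOn U →ₗ[ℝ] smoothOn U where
  toFun g := ⟨fun u => u i * (g : J → ℝ) u,
    (contDiff_apply ℝ ℝ i).contDiffOn.mul (contDiffOn_smoothOn g), fun u hu => by simp [g.2.2 u hu]⟩
  map_add' g k := Subtype.ext (funext fun u => mul_add _ _ _)
  map_smul' c g := Subtype.ext (funext fun u => mul_left_comm _ _ _)

theorem mulCoord_apply (i : Fin 5) (g : smoothOn U) (u : J) :
    (mulCoord i g : J → ℝ) u = u i * (g : J → ℝ) u := rfl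

theorem fderiv_smoothOn_eq_sum (hU : IsOpen U) (g : smoothOn U) {u : J} (hu : u ∈ U) (v : J) :
    fderiv ℝ (g : J → ℝ) u v = ∑ i, v i * (pd hU i g : J → ℝ) u := by
  conv_lhs => rw [pi_eq_sum_univ' v]
  simp only [map_sum, map_smul, smul_eq_mul, pd_apply hU _ g hu]

theorem pd_comm (hU : IsOpen U) (i j : Fin 5) (g : smoothOn U) :
    pd hU i (pd hU j g) = pd hU j (pd hU i g) := by
  refine smoothOn_ext fun u hu => ?_
  have hd : DifferentiableAt ℝ (fderiv ℝ (g : J → ℝ)) u :=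
    differentiableAt_of_contDiffOn hU ((contDiffOn_smoothOn g).fderiv_of_isOpen hU (m := ∞) (by simp)) hu
  have hs : IsSymmSndFDerivAt ℝ (g : J → ℝ) u :=
    ((contDiffOn_smoothOn g).contDiffAt (hU.mem_nhds hu)).isSymmSndFDerivAt
      (by simpa using (WithTop.coe_le_coe.2 (le_top : (2 : ℕ∞) ≤ ⊤)))
  have key : ∀ k l : Fin 5, (pd hU k (pd hU l g) : J → ℝ) u =
      fderiv ℝ (fderiv ℝ (g : J → ℝ)) u (Pi.single k 1) (Pi.single l 1) := by
    intro k l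
    rw [pd_apply hU _ _ hu]
    change fderiv ℝ (restrictOn (fun u => fderiv ℝ (g : J → ℝ) u (Pi.single l 1))
      (contDiffOn_fderiv_apply hU (contDiffOn_smoothOn g) _) : J → ℝ) u _ = _
    rw [fderiv_restrictOn hU _ hu, fderiv_clm_apply hd (differentiableAt_const _)]
    simp
  rw [key, key, hs.eq]

theorem pd_mulCoord (hU : IsOpen U) (i j : Fin 5) (g : smoothOn U) :
    pd hU i (mulCoord j g) = mulCoord j (pd hU i g) + (if i = j then (1 : ℝ) else 0) • g := by
  refine smoothOn_ext fun u hu => ?_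
  rw [pd_apply hU _ _ hu]
  change fderiv ℝ (fun u : J => u j * (g : J → ℝ) u) u _ = _
  rw [fderiv_fun_mul (by fun_prop) (differentiableAt_smoothOn hU g hu)]
  simp only [Submodule.coe_add, Submodule.coe_smul, Pi.add_apply, Pi.smul_apply, mulCoord_apply,
    pd_apply hU _ _ hu, add_apply, smul_apply,
    smul_eq_mul, fderiv_coord, Pi.single_apply, eq_comm]
  ring

/-- The contact derivation `∂ₓ + p ∂_z`. -/
noncomputable def opA (hU : IsOpen U) : smoothOn U →ₗ[ℝ] smoothOn U :=
  pd hU 0 + mulCoord 3 ∘ₗ pd hU 2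

/-- The contact derivation `∂_q`. -/
noncomputable def opB (hU : IsOpen U) : smoothOn U →ₗ[ℝ] smoothOn U := pd hU 4

/-- The contact derivation `∂_y + q ∂_z`. -/
noncomputable def opC (hU : IsOpen U) : smoothOn U →ₗ[ℝ] smoothOn U :=
  pd hU 1 + mulCoord 4 ∘ₗ pd hU 2

/-- The contact derivation `∂_p + (3/4) (∂ₓ + p ∂_z)`. -/
noncomputable def opD (hU : IsOpen U) : smoothOn U →ₗ[ℝ] smoothOn U :=
  pd hU 3 + (3 / 4 : ℝ) • opA hU

theorem mulCoord_comm (i j : Fin 5) (g : smoothOn U) :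
    mulCoord i (mulCoord j g) = mulCoord j (mulCoord i g) :=
  Subtype.ext (funext fun _ => mul_left_comm _ _ _)

theorem isHeisenberg_op (hU : IsOpen U) :
    IsHeisenberg (opA hU) (opB hU) (opC hU) (opD hU) (pd hU 2) where
  ab g := by
    simp [opA, opB, pd_mulCoord, pd_comm hU 4]
  ac g := by
    simp [opA, opC, pd_mulCoord, pd_comm hU 1 0, pd_comm hU 1 2, pd_comm hU 2 0, mulCoord_comm 4 3]
    abel
  bd g := by
    simp [opA, opB, opD, pd_mulCoord, pd_comm hU 4]
  cd g := by
    simp [opA, opC, opD, pd_mulCoord, pd_comm hU 1 0, pd_comm hU 1 2, pd_comm hU 1 3,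
      pd_comm hU 2 0, pd_comm hU 2 3, mulCoord_comm 4 3]
    module
  bc g := by
    simp [opB, opC, pd_mulCoord, pd_comm hU 4]
    abel
  da g := by
    simp [opA, opD, pd_mulCoord, pd_comm hU 3]
    module
  za g := by simp [opA, pd_mulCoord, pd_comm hU 2 0]
  zb g := by simp [opB, pd_comm hU 2]
  zc g := by simp [opC, pd_mulCoord, pd_comm hU 2 1]
  zd g := by simp [opA, opD, pd_mulCoord, pd_comm hU 2 0, pd_comm hU 2 3]

/-- A function killed by the contact derivations is constant; it vanishes if it does so at one
point. -/
theorem eq_zero_of_op_eq_zero (hU : IsOpen U) (hc : IsPreconnected U) {u₀ : J} (hu₀ : u₀ ∈ U)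
    {g : smoothOn U} (ha : opA hU g = 0) (hb : opB hU g = 0) (hc' : opC hU g = 0)
    (hd : opD hU g = 0) (h₀ : (g : J → ℝ) u₀ = 0) : g = 0 := by
  have H := isHeisenberg_op hU
  -- The frame is bracket-generating: Z = [B,C] supplies the missing derivative, after which the
  -- other partial derivatives separate.
  have p2 : pd hU 2 g = 0 := by
    have := H.bc g
    rwa [hb, hc', map_zero, map_zero, zero_add, eq_comm] at this
  have p0 : pd hU 0 g = 0 := by simpa [opA, p2] using ha
  have p1 : pd hU 1 g = 0 := by simpa [opC, p2] using hc'
  have p3 : pd hU 3 g = 0 := by simpa [opD, ha] using hd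
  have p4 : pd hU 4 g = 0 := hb
  refine smoothOn_ext fun u hu => ?_
  rw [hU.is_const_of_fderiv_eq_zero (𝕜 := ℝ) hc
    (fun w hw => (differentiableAt_smoothOn hU g hw).differentiableWithinAt) (fun w hw => ?_)
    hu hu₀, h₀]
  · rfl
  · ext v
    rw [fderiv_smoothOn_eq_sum hU g hw]
    simp [Fin.sum_univ_five, p0, p1, p2, p3, p4]

/-! ### The symmetry equations -/

/-- The pointwise algebra behind the seven equations. The four bracketed coefficients are the
partial derivatives of Υ in frame coordinates, and the factors after them are the variations of a,
d, c, b along X. Here `ab` stands for A(Bf) and so on, z for Zf. -/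
theorem eqs_of_quartic {aa ab ac ad ba bb bc bd ca cb cc cd da db dc dd z β : ℝ}
    (hab : ba = ab) (hac : ca = ac) (hbd : db = bd) (hcd : dc = cd) (hbc : bc = cb + z)
    (hda : da = ad + z)
    (h : ∀ a b c d : ℝ,
      (288 * a * d ^ 2 - 288 * b * c * d + 512 * c ^ 3) *
          -(a * ad + b * bd + c * cd + d * dd) +
        (-288 * a * c * d + 72 * d * b ^ 2 - 96 * b * c ^ 2) *
          (a * ac + b * bc + c * cc + d * dc) +
        (-288 * a * b * d + 1536 * a * c ^ 2 - 96 * b ^ 2 * c) *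
          -(a * ab + b * bb + c * cb + d * db) +
        (288 * a ^ 2 * d - 288 * a * b * c + 24 * b ^ 3) *
          (a * aa + b * ba + c * ca + d * da) =
      β * (144 * a ^ 2 * d ^ 2 - 288 * a * b * c * d + 24 * d * b ^ 3 + 512 * a * c ^ 3 -
        48 * b ^ 2 * c ^ 2)) :
    aa = 0 ∧ ab = 0 ∧ ac = -4 * bb ∧ ad = -3 * cb - 2 * z ∧ cc = -16 / 3 * bd ∧ cd = 0 ∧
      dd = 0 := by
  subst hab hac hbd hcd hbc hda
  -- On the plane b = c = 0 the coefficients of d, d², d³ give `aa = 0`, β = 2z and `dd = 0`.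
  have h₁ := h 1 0 0 1
  have h₂ := h 1 0 0 (-1)
  have h₃ := h 1 0 0 2
  have haa : aa = 0 := by linarith
  have hdd : dd = 0 := by linarith
  have hβ : β = 2 * z := by linarith
  subst haa hdd hβ
  -- The slices c = 0 and b = 0 determine the five remaining relations.
  have k₁ := h 1 1 0 1
  have k₂ := h 1 1 0 (-1)
  have k₃ := h 1 (-1) 0 1
  have k₄ := h 1 (-1) 0 (-1)
  have k₅ := h 1 2 0 1
  have k₆ := h 1 1 0 2
  have l₁ := h 1 0 1 1
  have l₂ := h 1 0 1 (-1)
  have l₃ := h 1 0 (-1) 1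
  have l₄ := h 1 0 (-1) (-1)
  have l₅ := h 1 0 2 1
  have l₆ := h 1 0 1 2
  refine ⟨rfl, ?_, ?_, ?_, ?_, ?_, rfl⟩ <;> linarith

theorem contDiffOn_comp {X : J → J} (hX : ContDiffOn ℝ ∞ X U) (i : Fin 5) :
    ContDiffOn ℝ ∞ (fun u => X u i) U := contDiffOn_pi.1 hX i

theorem contDiffOn_ham {X : J → J} (hX : ContDiffOn ℝ ∞ X U) : ContDiffOn ℝ ∞ (ham X) U :=
  ((contDiffOn_comp hX 2).sub ((contDiff_apply ℝ ℝ 3).contDiffOn.mul (contDiffOn_comp hX 0))).sub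
    ((contDiff_apply ℝ ℝ 4).contDiffOn.mul (contDiffOn_comp hX 1))

theorem fderiv_comp_apply {X : J → J} {u : J} (hX : DifferentiableAt ℝ X u) (i : Fin 5) (v : J) :
    fderiv ℝ (fun w => X w i) u v = fderiv ℝ X u v i := by
  rw [((hasFDerivAt_pi'.1 hX.hasFDerivAt) i).fderiv]
  rfl

/-- Cartan's formula d(ϖ(X)) = L_X ϖ - dϖ(X, ·). -/
theorem fderiv_ham {X : J → J} {u : J} (hX : DifferentiableAt ℝ X u) (v : J) :
    fderiv ℝ (ham X) u v = lieDeriv X varpi u v - v 3 * X u 0 - v 4 * X u 1 + X u 3 * v 0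
      + X u 4 * v 1 := by
  have hd : ∀ i, DifferentiableAt ℝ (fun w => X w i) u := fun i => differentiableAt_pi.1 hX i
  have hc : ∀ i, DifferentiableAt ℝ (fun w : J => w i) u := fun i => by fun_prop
  rw [lieDeriv_varpi]
  unfold ham varpi
  rw [fderiv_fun_sub ((hd 2).fun_sub ((hc 3).fun_mul (hd 0))) ((hc 4).fun_mul (hd 1)),
    fderiv_fun_sub (hd 2) ((hc 3).fun_mul (hd 0)), fderiv_fun_mul (hc 3) (hd 0),
    fderiv_fun_mul (hc 4) (hd 1)]
  simp only [sub_apply, add_apply, smul_apply, smul_eq_mul, fderiv_coord, fderiv_comp_apply hX]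
  ring

theorem opA_apply (hU : IsOpen U) (g : smoothOn U) {u : J} (hu : u ∈ U) :
    (opA hU g : J → ℝ) u = fderiv ℝ (g : J → ℝ) u ![1, 0, u 3, 0, 0] := by
  rw [fderiv_smoothOn_eq_sum hU g hu]
  simp [Fin.sum_univ_five, opA, mulCoord_apply]

theorem opB_apply (hU : IsOpen U) (g : smoothOn U) {u : J} (hu : u ∈ U) :
    (opB hU g : J → ℝ) u = fderiv ℝ (g : J → ℝ) u ![0, 0, 0, 0, 1] := by
  rw [fderiv_smoothOn_eq_sum hU g hu]
  simp [Fin.sum_univ_five, opB]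

theorem opC_apply (hU : IsOpen U) (g : smoothOn U) {u : J} (hu : u ∈ U) :
    (opC hU g : J → ℝ) u = fderiv ℝ (g : J → ℝ) u ![0, 1, u 4, 0, 0] := by
  rw [fderiv_smoothOn_eq_sum hU g hu]
  simp [Fin.sum_univ_five, opC, mulCoord_apply]

theorem opD_apply (hU : IsOpen U) (g : smoothOn U) {u : J} (hu : u ∈ U) :
    (opD hU g : J → ℝ) u = fderiv ℝ (g : J → ℝ) u ![3 / 4, 0, 3 / 4 * u 3, 1, 0] := by
  rw [fderiv_smoothOn_eq_sum hU g hu]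
  simp [Fin.sum_univ_five, opA, opD, mulCoord_apply]
  ring

theorem fderiv_contact (hU : IsOpen U) (g : smoothOn U) {u : J} (hu : u ∈ U) (a b c d : ℝ) :
    fderiv ℝ (g : J → ℝ) u
        ![a + 3 / 4 * d, c, u 3 * (a + 3 / 4 * d) + u 4 * c, d, b] =
      a * (opA hU g : J → ℝ) u + b * (opB hU g : J → ℝ) u + c * (opC hU g : J → ℝ) u +
        d * (opD hU g : J → ℝ) u := by
  rw [fderiv_smoothOn_eq_sum hU g hu]
  simp [Fin.sum_univ_five, opA, opB, opC, opD, mulCoord_apply]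
  ring

section

variable (hU : IsOpen U) {X : J → J} (hX : ContDiffOn ℝ ∞ X U)

/-- The components of a contact vector field as derivatives of its generating function. -/
theorem op_ham (h : ∃ a : J → ℝ, ∀ u ∈ U, ∀ v, lieDeriv X varpi u v = a u * varpi u v) :
    opA hU (restrictOn (ham X) (contDiffOn_ham hX)) =
        restrictOn (fun u => X u 3) (contDiffOn_comp hX 3) ∧
      opB hU (restrictOn (ham X) (contDiffOn_ham hX)) =
        -restrictOn (fun u => X u 1) (contDiffOn_comp hX 1) ∧
      opC hU (restrictOn (ham X) (contDiffOn_ham hX)) =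
        restrictOn (fun u => X u 4) (contDiffOn_comp hX 4) ∧
      opD hU (restrictOn (ham X) (contDiffOn_ham hX)) =
        (3 / 4 : ℝ) • restrictOn (fun u => X u 3) (contDiffOn_comp hX 3) -
          restrictOn (fun u => X u 0) (contDiffOn_comp hX 0) := by
  obtain ⟨a, ha⟩ := h
  have key : ∀ u ∈ U, ∀ v, fderiv ℝ (restrictOn (ham X) (contDiffOn_ham hX) : J → ℝ) u v =
      a u * varpi u v - v 3 * X u 0 - v 4 * X u 1 + X u 3 * v 0 + X u 4 * v 1 := by
    intro u hu v
    rw [fderiv_restrictOn hU _ hu, fderiv_ham (differentiableAt_of_contDiffOn hU hX hu), ha u hu]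
  refine ⟨?_, ?_, ?_, ?_⟩ <;> refine smoothOn_ext fun u hu => ?_
  · rw [opA_apply hU _ hu, key u hu, restrictOn_apply _ hu]
    simp [varpi]
  · rw [opB_apply hU _ hu, key u hu, Submodule.coe_neg, Pi.neg_apply, restrictOn_apply _ hu]
    simp [varpi]
  · rw [opC_apply hU _ hu, key u hu, restrictOn_apply _ hu]
    simp [varpi]
  · rw [opD_apply hU _ hu, key u hu, Submodule.coe_sub, Submodule.coe_smul, Pi.sub_apply,
      Pi.smul_apply, restrictOn_apply _ hu, restrictOn_apply _ hu]
    simp [varpi]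
    ring

theorem symmEqs_ham (h : IsSymmetryOn varpi upsilon U X) :
    SymmEqs (opA hU) (opB hU) (opC hU) (opD hU) (pd hU 2)
      (restrictOn (ham X) (contDiffOn_ham hX)) := by
  obtain ⟨hA, hB, hC, hD⟩ := op_ham hU hX h.1
  obtain ⟨b, hb⟩ := h.2
  have H := isHeisenberg_op hU
  set F := restrictOn (ham X) (contDiffOn_ham hX)
  have main : ∀ u ∈ U, _ := fun u hu =>
    eqs_of_quartic (aa := (opA hU (opA hU F) : J → ℝ) u) (ab := (opA hU (opB hU F) : J → ℝ) u)
      (ac := (opA hU (opC hU F) : J → ℝ) u) (ad := (opA hU (opD hU F) : J → ℝ) u)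
      (ba := (opB hU (opA hU F) : J → ℝ) u) (bb := (opB hU (opB hU F) : J → ℝ) u)
      (bc := (opB hU (opC hU F) : J → ℝ) u) (bd := (opB hU (opD hU F) : J → ℝ) u)
      (ca := (opC hU (opA hU F) : J → ℝ) u) (cb := (opC hU (opB hU F) : J → ℝ) u)
      (cc := (opC hU (opC hU F) : J → ℝ) u) (cd := (opC hU (opD hU F) : J → ℝ) u)
      (da := (opD hU (opA hU F) : J → ℝ) u) (db := (opD hU (opB hU F) : J → ℝ) u)
      (dc := (opD hU (opC hU F) : J → ℝ) u) (dd := (opD hU (opD hU F) : J → ℝ) u)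
      (z := (pd hU 2 F : J → ℝ) u) (β := b u)
      (by rw [H.ab]) (by rw [H.ac]) (by rw [H.bd]) (by rw [H.cd])
      (by rw [H.bc, Submodule.coe_add, Pi.add_apply])
      (by rw [H.da, Submodule.coe_add, Pi.add_apply]) (by
        intro p q r s
        -- The contact vector pA + qB + rC + sD; here p, q, r, s are frame coordinates, not the jet
        -- variables.
        have e := hb u hu ![p + 3 / 4 * s, r, u 3 * (p + 3 / 4 * s) + u 4 * r, s, q]
          (by simp [varpi])
        have hf : ∀ i, fderiv ℝ X u ![p + 3 / 4 * s, r, u 3 * (p + 3 / 4 * s) + u 4 * r, s, q] i =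
            _ := fun i => by
          rw [← fderiv_comp_apply (differentiableAt_of_contDiffOn hU hX hu),
            ← fderiv_restrictOn hU (contDiffOn_comp hX i) hu, fderiv_contact hU _ hu]
        have h1 : restrictOn (fun u => X u 1) (contDiffOn_comp hX 1) = -opB hU F := by
          rw [hB, neg_neg]
        have h0 : restrictOn (fun u => X u 0) (contDiffOn_comp hX 0) =
            (3 / 4 : ℝ) • opA hU F - opD hU F := by
          rw [hD, hA]; abel
        rw [lieDeriv_upsilon, hf 0, hf 1, hf 3, hf 4, ← hA, ← hC, h1, h0] at e
        simp [upsilon, upsilonPoly] at e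
        linear_combination e)
  refine ⟨?_, ?_, ?_, ?_, ?_, ?_, ?_⟩ <;> refine smoothOn_ext fun u hu => ?_ <;>
    obtain ⟨e1, e2, e3, e4, e5, e6, e7⟩ := main u hu
  exacts [e1, e2, e3, e4, e5, e6, e7]

end

/-! ### The symmetry algebra -/

theorem lieDeriv_add {X Y : J → J} {u : J} (hX : DifferentiableAt ℝ X u)
    (hY : DifferentiableAt ℝ Y u) (T : J → J → ℝ) (v : J) :
    lieDeriv (X + Y) T u v = lieDeriv X T u v + lieDeriv Y T u v := by
  simp only [lieDeriv, fderiv_add hX hY, Pi.add_apply, add_apply, map_add]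
  ring

theorem lieDeriv_smul {X : J → J} {u : J} (hX : DifferentiableAt ℝ X u) (c : ℝ)
    (T : J → J → ℝ) (v : J) : lieDeriv (c • X) T u v = c * lieDeriv X T u v := by
  simp only [lieDeriv, fderiv_const_smul hX, Pi.smul_apply, smul_apply, map_smul, smul_eq_mul]
  ring

theorem IsSymmetryOn.mono {α T : J → J → ℝ} {U V : Set J} {X : J → J} (hUV : U ⊆ V)
    (h : IsSymmetryOn α T V X) : IsSymmetryOn α T U X :=
  ⟨h.1.imp fun _ ha u hu => ha u (hUV hu), h.2.imp fun _ hb u hu => hb u (hUV hu)⟩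

/-- The smooth vector fields that are infinitesimal symmetries of `[α, T]`. -/
def symmetries (α T : J → J → ℝ) : Submodule ℝ VF where
  carrier := {X | IsSymmetryOn α T univ (X : J → J)}
  add_mem' {X Y} := by
    rintro ⟨⟨a, ha⟩, b, hb⟩ ⟨⟨a', ha'⟩, b', hb'⟩
    refine ⟨⟨a + a', fun u hu v => ?_⟩, b + b', fun u hu v hv => ?_⟩
    · rw [Submodule.coe_add, lieDeriv_add (differentiableAt_coe X u) (differentiableAt_coe Y u),
        ha u hu, ha' u hu, Pi.add_apply, add_mul]
    · rw [Submodule.coe_add, lieDeriv_add (differentiableAt_coe X u) (differentiableAt_coe Y u),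
        hb u hu v hv, hb' u hu v hv, Pi.add_apply, add_mul]
  zero_mem' := by
    refine ⟨⟨0, fun u _ v => ?_⟩, 0, fun u _ v _ => ?_⟩ <;> simp [lieDeriv]
  smul_mem' c X := by
    rintro ⟨⟨a, ha⟩, b, hb⟩
    refine ⟨⟨c • a, fun u hu v => ?_⟩, c • b, fun u hu v hv => ?_⟩
    · rw [Submodule.coe_smul, lieDeriv_smul (differentiableAt_coe X u), ha u hu, Pi.smul_apply,
        smul_eq_mul, mul_assoc]
    · rw [Submodule.coe_smul, lieDeriv_smul (differentiableAt_coe X u), hb u hu v hv,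
        Pi.smul_apply, smul_eq_mul, mul_assoc]

theorem span_basisVF_le_symmetries :
    Submodule.span ℝ (range basisVF) ≤ symmetries varpi upsilon := by
  refine span_basisVF_le isSymmetryOn_h1 isSymmetryOn_h2 fun i => ?_
  fin_cases i
  exacts [isSymmetryOn_S1, isSymmetryOn_L2, isSymmetryOn_S3, isSymmetryOn_L4, isSymmetryOn_S5,
    isSymmetryOn_L6, isSymmetryOn_S7, isSymmetryOn_L8, isSymmetryOn_S9, isSymmetryOn_L10,
    isSymmetryOn_S11, isSymmetryOn_L12]

/-- The solutions on `U` of the symmetry equations. -/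
noncomputable def solutions (hU : IsOpen U) : Submodule ℝ (smoothOn U) where
  carrier := {g | SymmEqs (opA hU) (opB hU) (opC hU) (opD hU) (pd hU 2) g}
  add_mem' {g k} hg hk :=
    { aa := by simp only [map_add, hg.aa, hk.aa, add_zero]
      ab := by simp only [map_add, hg.ab, hk.ab, add_zero]
      ac := by simp only [map_add, hg.ac, hk.ac, smul_add]
      ad := by simp only [map_add, hg.ad, hk.ad, smul_add]; abel
      cc := by simp only [map_add, hg.cc, hk.cc, smul_add]
      cd := by simp only [map_add, hg.cd, hk.cd, add_zero]
      dd := by simp only [map_add, hg.dd, hk.dd, add_zero] }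
  zero_mem' := by constructor <;> simp
  smul_mem' c g hg :=
    { aa := by simp only [map_smul, hg.aa, smul_zero]
      ab := by simp only [map_smul, hg.ab, smul_zero]
      ac := by simp only [map_smul, hg.ac]; module
      ad := by simp only [map_smul, hg.ad]; module
      cc := by simp only [map_smul, hg.cc]; module
      cd := by simp only [map_smul, hg.cd, smul_zero]
      dd := by simp only [map_smul, hg.dd, smul_zero] }

/-- Evaluation at a point. -/
def evalAt (u₀ : J) : smoothOn U →ₗ[ℝ] ℝ where
  toFun g := (g : J → ℝ) u₀
  map_add' _ _ := rfl
  map_smul' _ _ := rfl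

/-- The fourteen values that determine a solution of the symmetry equations. -/
noncomputable def jet (hU : IsOpen U) (u₀ : J) : smoothOn U →ₗ[ℝ] Fin 14 → ℝ :=
  LinearMap.pi fun i => evalAt u₀ ∘ₗ
    (![LinearMap.id, opA hU, opB hU, opC hU, opD hU, pd hU 2, opB hU ∘ₗ opB hU, opC hU ∘ₗ opB hU,
      opB hU ∘ₗ opD hU, pd hU 2 ∘ₗ opA hU, pd hU 2 ∘ₗ opB hU, pd hU 2 ∘ₗ opC hU,
      pd hU 2 ∘ₗ opD hU, pd hU 2 ∘ₗ pd hU 2] : Fin 14 → (smoothOn U →ₗ[ℝ] smoothOn U)) i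

theorem eq_zero_of_jet_eq_zero (hU : IsOpen U) (hc : IsPreconnected U) {u₀ : J} (hu₀ : u₀ ∈ U)
    {g : smoothOn U} (hg : g ∈ solutions hU) (h : jet hU u₀ g = 0) : g = 0 :=
  SymmEqs.eq_zero (isHeisenberg_op hU) hg (ev := evalAt u₀)
    (fun _ ha hb hc' hd h₀ => eq_zero_of_op_eq_zero hU hc hu₀ ha hb hc' hd h₀)
    (congrFun h 0) (congrFun h 1) (congrFun h 2) (congrFun h 3) (congrFun h 4) (congrFun h 5)
    (congrFun h 6) (congrFun h 7) (congrFun h 8) (congrFun h 9) (congrFun h 10) (congrFun h 11)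
    (congrFun h 12) (congrFun h 13)

theorem ham_sum_eq_zero_of_open (hU : IsOpen U) {u₀ : J} (hu₀ : u₀ ∈ U) (c : Fin 14 → ℝ)
    (h : ∀ u ∈ U, ham ((∑ i, c i • basisVF i : VF) : J → J) u = 0) : c = 0 := by
  refine eq_zero_of_ham_sum_eq_zero c ?_
  -- The generating function is polynomial, hence analytic, so vanishing near one point spreads to
  -- all of J.
  have hs : ContDiff ℝ ω (ham ((∑ i, c i • basisVF i : VF) : J → J)) := by
    unfold ham
    simp only [varpi, sum_basisVF_apply]
    simp [h1, h2, S1, L2, S3, L4, S5, L6, S7, L8, S9, L10, S11, L12, field]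
    fun_prop
  have ha := contDiff_omega_iff_analyticOnNhd.1 hs
  refine congrFun (ha.eq_of_eventuallyEq (g := 0) analyticOnNhd_const (z₀ := u₀) ?_)
  filter_upwards [hU.mem_nhds hu₀] with u hu
  exact h u hu

/-- A symmetry on a connected open set is the restriction of a combination of the fourteen
fields. -/
theorem exists_eqOn_of_isSymmetryOn (hU : IsOpen U) (hc : IsPreconnected U) {X : J → J}
    (hX : ContDiffOn ℝ ∞ X U) (h : IsSymmetryOn varpi upsilon U X) :
    ∃ Y ∈ Submodule.span ℝ (range basisVF), EqOn X (Y : J → J) U := by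
  obtain rfl | ⟨u₀, hu₀⟩ := U.eq_empty_or_nonempty
  · exact ⟨0, Submodule.zero_mem _, fun _ hu => hu.elim⟩
  have hY : ∀ Y : VF, ContDiffOn ℝ ∞ (Y : J → J) U := fun Y => (contDiff_coe Y).contDiffOn
  let R : VF →ₗ[ℝ] smoothOn U :=
    { toFun := fun Y => restrictOn (ham (Y : J → J)) (contDiffOn_ham (hY Y))
      map_add' := fun Y W => smoothOn_ext fun u hu => by
        change U.indicator (ham ((Y : J → J) + (W : J → J))) u =
          U.indicator (ham (Y : J → J)) u + U.indicator (ham (W : J → J)) u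
        rw [indicator_of_mem hu, indicator_of_mem hu, indicator_of_mem hu]
        simp only [ham, varpi, Pi.add_apply]
        ring
      map_smul' := fun c Y => smoothOn_ext fun u hu => by
        change U.indicator (ham (c • (Y : J → J))) u = c * U.indicator (ham (Y : J → J)) u
        rw [indicator_of_mem hu, indicator_of_mem hu]
        simp only [ham, varpi, Pi.smul_apply, smul_eq_mul]
        ring }
  have hsol : ∀ Y ∈ Submodule.span ℝ (range basisVF), R Y ∈ solutions hU := fun Y hY' =>
    symmEqs_ham hU (hY Y) ((span_basisVF_le_symmetries hY').mono (subset_univ U))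
  -- A combination of the fields with zero jet has zero generating function on U by the
  -- prolongation, hence zero coefficients.
  have hlin : LinearIndependent ℝ fun i => jet hU u₀ (R (basisVF i)) := by
    rw [Fintype.linearIndependent_iff]
    intro c h0
    have hmem : ∑ i, c i • basisVF i ∈ Submodule.span ℝ (range basisVF) :=
      Submodule.sum_mem _ fun i _ => Submodule.smul_mem _ _ (Submodule.subset_span ⟨i, rfl⟩)
    have hz : R (∑ i, c i • basisVF i) = 0 := by
      refine eq_zero_of_jet_eq_zero hU hc hu₀ (hsol _ hmem) ?_
      rw [← h0]
      simp only [map_sum, map_smul]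
    refine congrFun (ham_sum_eq_zero_of_open hU hu₀ c fun u hu => ?_)
    have hz' := congrFun (congrArg Subtype.val hz) u
    rwa [show (R (∑ i, c i • basisVF i)).1 u = _ from restrictOn_apply
      (contDiffOn_ham (hY (∑ i, c i • basisVF i))) hu] at hz'
  -- Fourteen independent jets span ℝ¹⁴, so some combination Y of the fields shares the jet of X,
  -- and then the generating functions agree on U.
  have htop := hlin.span_eq_top_of_card_eq_finrank' (by simp)
  set F := restrictOn (ham X) (contDiffOn_ham hX) with hF
  obtain ⟨c, hcF⟩ := (Submodule.mem_span_range_iff_exists_fun ℝ).1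
    (htop ▸ Submodule.mem_top : jet hU u₀ F ∈ Submodule.span ℝ (range _))
  have hmem : ∑ i, c i • basisVF i ∈ Submodule.span ℝ (range basisVF) :=
    Submodule.sum_mem _ fun i _ => Submodule.smul_mem _ _ (Submodule.subset_span ⟨i, rfl⟩)
  set Y := ∑ i, c i • basisVF i with hYdef
  have hFY : F = R Y := by
    rw [← sub_eq_zero]
    refine eq_zero_of_jet_eq_zero hU hc hu₀
      (Submodule.sub_mem _ (symmEqs_ham hU hX h) (hsol Y hmem)) ?_
    rw [map_sub, ← hcF, hYdef]
    simp only [map_sum, map_smul, sub_self]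
  -- The generating function recovers the field: its frame derivatives give the components 0, 1, 3,
  -- 4, and its value then gives component 2.
  obtain ⟨a3, a1, a4, a0⟩ := op_ham hU hX h.1
  obtain ⟨b3, b1, b4, b0⟩ := op_ham hU (hY Y)
    ((span_basisVF_le_symmetries hmem).mono (subset_univ U)).1
  rw [← hF, hFY] at a0 a1 a3 a4
  have e3 := a3.symm.trans b3
  have e1 := neg_injective (a1.symm.trans b1)
  have e4 := a4.symm.trans b4
  have e0 := a0.symm.trans b0
  rw [e3, sub_right_inj] at e0
  refine ⟨Y, hmem, fun u hu => ?_⟩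
  have c0 := congrFun (congrArg Subtype.val e0) u
  have c1 := congrFun (congrArg Subtype.val e1) u
  have c3 := congrFun (congrArg Subtype.val e3) u
  have c4 := congrFun (congrArg Subtype.val e4) u
  have cF := congrFun (congrArg Subtype.val hFY) u
  change F.1 u = (restrictOn (ham (Y : J → J)) (contDiffOn_ham (hY Y))).1 u at cF
  rw [restrictOn_apply _ hu, restrictOn_apply _ hu] at c0 c1 c3 c4 cF
  simp only [ham, varpi, c0, c1, sub_left_inj] at cF
  ext i
  fin_cases i
  exacts [c0, c1, cF, c3, c4]

/-! ### Cartan subalgebra and Killing form from simultaneous eigenvectors. -/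

theorem trace_eq_sum_of_diagonal {M ι : Type*} [AddCommGroup M] [Module ℝ M] [Fintype ι]
    [DecidableEq ι] (b : Module.Basis ι ℝ M) (f : M →ₗ[ℝ] M) (c : ι → ℝ)
    (h : ∀ i, f (b i) = c i • b i) : LinearMap.trace ℝ M f = ∑ i, c i := by
  rw [LinearMap.trace_eq_matrix_trace ℝ b, Matrix.trace]
  refine Finset.sum_congr rfl fun i _ => ?_
  simp [LinearMap.toMatrix_apply, h]

/-- If `k₁, k₂` and simultaneous eigenvectors `R i` form a basis, with nonzero pairs of
eigenvalues, and `k₁, k₂` commute, then `k₁, k₂` span a Cartan subalgebra. -/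
theorem exists_isCartanSubalgebra {L : Type*} [LieRing L] [LieAlgebra ℝ L] {k₁ k₂ : L}
    {R : Fin 12 → L} {w : Fin 12 → ℝ × ℝ} (b : Module.Basis (Fin 14) ℝ L)
    (hb : ⇑b = Fin.cons k₁ (Fin.cons k₂ R)) (hk : ⁅k₁, k₂⁆ = 0)
    (hR : ∀ i, ⁅k₁, R i⁆ = (w i).1 • R i ∧ ⁅k₂, R i⁆ = (w i).2 • R i)
    (hw : ∀ i, (w i).1 ≠ 0 ∨ (w i).2 ≠ 0) :
    ∃ C : LieSubalgebra ℝ L, C.toSubmodule = Submodule.span ℝ {k₁, k₂} ∧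
      C.IsCartanSubalgebra := by
  have hk' : ⁅k₂, k₁⁆ = 0 := by rw [← lie_skew, hk, neg_zero]
  have hab : ∀ x ∈ Submodule.span ℝ {k₁, k₂}, ∀ y ∈ Submodule.span ℝ {k₁, k₂}, ⁅x, y⁆ = 0 := by
    intro x hx y hy
    obtain ⟨a, c, rfl⟩ := Submodule.mem_span_pair.1 hx
    obtain ⟨a', c', rfl⟩ := Submodule.mem_span_pair.1 hy
    simp [hk, hk']
  let C : LieSubalgebra ℝ L :=
    { Submodule.span ℝ {k₁, k₂} with
      lie_mem' := fun {x y} hx hy => by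
        rw [hab x hx y hy]; exact Submodule.zero_mem _ }
  have hmem : ∀ x, x ∈ C ↔ x ∈ Submodule.span ℝ {k₁, k₂} := fun _ => Iff.rfl
  have hk₁ : k₁ ∈ C := (hmem _).2 (Submodule.subset_span (by simp))
  have hk₂ : k₂ ∈ C := (hmem _).2 (Submodule.subset_span (by simp))
  have : IsLieAbelian C := ⟨fun x y => Subtype.ext (hab x x.2 y y.2)⟩
  -- Nilpotency comes from commutativity. It remains to see that C is its own normalizer.
  refine ⟨C, rfl, inferInstance, le_antisymm (fun x hx => ?_) C.le_normalizer⟩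
  rw [LieSubalgebra.mem_normalizer_iff'] at hx
  have b0 : b 0 = k₁ := by rw [hb]; rfl
  have b1 : b 1 = k₂ := by rw [hb]; rfl
  have bs : ∀ i : Fin 12, b i.succ.succ = R i := fun i => by rw [hb]; rfl
  have hcoord : ∀ y ∈ C, ∀ i : Fin 12, b.repr y i.succ.succ = 0 := by
    intro y hy i
    obtain ⟨a, c, rfl⟩ := Submodule.mem_span_pair.1 hy
    have n0 : (0 : Fin 14) ≠ i.succ.succ := (Fin.succ_ne_zero _).symm
    have n1 : (1 : Fin 14) ≠ i.succ.succ := fun h =>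
      Fin.succ_ne_zero i (Fin.succ_injective 13 (a₁ := 0) h).symm
    rw [← b0, ← b1, map_add, map_smul, map_smul, b.repr_self, b.repr_self, Finsupp.add_apply,
      Finsupp.smul_apply, Finsupp.smul_apply, Finsupp.single_eq_of_ne' n0,
      Finsupp.single_eq_of_ne' n1, smul_zero, smul_zero, add_zero]
  have hx_eq : x = b.repr x 0 • k₁ + (b.repr x 1 • k₂ + ∑ i : Fin 12, b.repr x i.succ.succ • R i) := by
    conv_lhs => rw [← b.sum_repr x]
    rw [Fin.sum_univ_succ, Fin.sum_univ_succ]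
    simp only [b0, bs, Fin.succ_zero_eq_one, b1]
  have h₁ : ⁅k₁, x⁆ = ∑ i : Fin 12, (b.repr x i.succ.succ * (w i).1) • b i.succ.succ := by
    conv_lhs => rw [hx_eq]
    simp [lie_sum, hk, (hR _).1, bs, smul_smul]
  have h₂ : ⁅k₂, x⁆ = ∑ i : Fin 12, (b.repr x i.succ.succ * (w i).2) • b i.succ.succ := by
    conv_lhs => rw [hx_eq]
    simp [lie_sum, hk', (hR _).2, bs, smul_smul]
  have hsum : ∀ (c : Fin 12 → ℝ) (i : Fin 12),
      b.repr (∑ j, c j • b j.succ.succ) i.succ.succ = c i := by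
    intro c i
    simp [Finsupp.single_apply, Finsupp.finsetSum_apply]
  -- If ⁅k₁, x⁆ and ⁅k₂, x⁆ lie in C, each root coefficient of x times either eigenvalue is zero,
  -- and one of the two eigenvalues is nonzero.
  have hzero : ∀ i : Fin 12, b.repr x i.succ.succ = 0 := by
    intro i
    have e₁ := hcoord _ (hx k₁ hk₁) i
    have e₂ := hcoord _ (hx k₂ hk₂) i
    rw [h₁, hsum (fun i => b.repr x i.succ.succ * (w i).1)] at e₁
    rw [h₂, hsum (fun i => b.repr x i.succ.succ * (w i).2)] at e₂
    rcases hw i with h | h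
    exacts [(mul_eq_zero.1 e₁).resolve_right h, (mul_eq_zero.1 e₂).resolve_right h]
  rw [hx_eq]
  simp only [hzero, zero_smul, Finset.sum_const_zero, add_zero]
  exact C.add_mem (C.smul_mem _ hk₁) (C.smul_mem _ hk₂)

theorem killingForm_apply_of_diagonal {L : Type*} [LieRing L] [LieAlgebra ℝ L] {x y : L}
    (b : Module.Basis (Fin 14) ℝ L) (c d : Fin 14 → ℝ) (hx : ∀ i, ⁅x, b i⁆ = c i • b i)
    (hy : ∀ i, ⁅y, b i⁆ = d i • b i) : killingForm ℝ L x y = ∑ i, d i * c i := by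
  rw [killingForm_apply_apply]
  refine trace_eq_sum_of_diagonal b _ _ fun i => ?_
  simp [hx, hy, smul_smul]

theorem symmetry_algebra :
    ∃ (𝔤 : LieSubalgebra ℝ VF) (R : Fin 12 → 𝔤) (k₁ k₂ : 𝔤),
      (∀ X : VF, X ∈ 𝔤 ↔ IsSymmetryOn varpi upsilon Set.univ (X : J → J)) ∧
      (∀ i, ((R i : VF) : J → J) = rootField i) ∧
      ((k₁ : VF) : J → J) = h1 ∧ ((k₂ : VF) : J → J) = h2 ∧
      LinearIndependent ℝ (Fin.cons k₁ (Fin.cons k₂ R) : Fin 14 → 𝔤) ∧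
      Submodule.span ℝ (Set.range (Fin.cons k₁ (Fin.cons k₂ R) : Fin 14 → 𝔤)) = ⊤ ∧
      (∀ U : Set J, IsOpen U → IsPreconnected U → ∀ X : J → J, ContDiffOn ℝ (⊤ : ℕ∞) X U →
        IsSymmetryOn varpi upsilon U X → ∃ Y : VF, Y ∈ 𝔤 ∧ Set.EqOn X (Y : J → J) U) ∧
      Nonempty (𝔤 ≃ₗ⁅ℝ⁆ LieAlgebra.g₂ ℝ) ∧
      (∃ C : LieSubalgebra ℝ 𝔤, C.toSubmodule = Submodule.span ℝ {k₁, k₂} ∧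
        C.IsCartanSubalgebra) ∧
      ⁅k₁, k₂⁆ = 0 ∧
      (∀ i, ⁅k₁, R i⁆ = (rootArrow i).1 • R i ∧ ⁅k₂, R i⁆ = (rootArrow i).2 • R i) ∧
      killingForm ℝ 𝔤 k₁ k₂ = 0 ∧ killingForm ℝ 𝔤 k₁ k₁ = killingForm ℝ 𝔤 k₂ k₂ := by
  obtain ⟨φ, hinj, hrange⟩ := exists_lieHom_fields
  have hmem : ∀ X, X ∈ φ.range ↔ X ∈ Submodule.span ℝ (range basisVF) := fun X => by
    rw [← hrange]; rfl
  have hbasis : ∀ i, basisVF i ∈ φ.range := fun i => (hmem _).2 (Submodule.subset_span ⟨i, rfl⟩)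
  let R : Fin 12 → φ.range := fun i => ⟨rootVF i, hbasis i.succ.succ⟩
  let k₁ : φ.range := ⟨vfh1, hbasis 0⟩
  let k₂ : φ.range := ⟨vfh2, hbasis 1⟩
  have hcoe : (fun i => ((Fin.cons k₁ (Fin.cons k₂ R) : Fin 14 → φ.range) i : VF)) = basisVF := by
    funext i
    refine Fin.cases rfl (fun i => ?_) i
    exact Fin.cases rfl (fun _ => rfl) i
  have hli : LinearIndependent ℝ (Fin.cons k₁ (Fin.cons k₂ R) : Fin 14 → φ.range) := by
    refine LinearIndependent.of_comp φ.range.toSubmodule.subtype ?_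
    change LinearIndependent ℝ fun i => ((Fin.cons k₁ (Fin.cons k₂ R) : Fin 14 → φ.range) i : VF)
    rw [hcoe]
    exact linearIndependent_basisVF
  have hsp : Submodule.span ℝ (range (Fin.cons k₁ (Fin.cons k₂ R) : Fin 14 → φ.range)) = ⊤ := by
    refine Submodule.map_injective_of_injective φ.range.toSubmodule.injective_subtype ?_
    rw [Submodule.map_span, ← range_comp]
    change Submodule.span ℝ (range fun i => ((Fin.cons k₁ (Fin.cons k₂ R) : Fin 14 → φ.range) i :
      VF)) = _
    rw [hcoe, Submodule.map_top, Submodule.range_subtype]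
    exact hrange.symm
  have hk : ⁅k₁, k₂⁆ = 0 := Subtype.ext lie_h1_h2
  have hk' : ⁅k₂, k₁⁆ = 0 := by rw [← lie_skew, hk, neg_zero]
  have hR : ∀ i, ⁅k₁, R i⁆ = (rootArrow i).1 • R i ∧ ⁅k₂, R i⁆ = (rootArrow i).2 • R i :=
    fun i => ⟨Subtype.ext (lie_h1_rootVF i), Subtype.ext (lie_h2_rootVF i)⟩
  let b : Module.Basis (Fin 14) ℝ φ.range := Module.Basis.mk hli hsp.ge
  have hb : ⇑b = Fin.cons k₁ (Fin.cons k₂ R) := Module.Basis.coe_mk hli hsp.ge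
  have hd₁ : ∀ i, ⁅k₁, b i⁆ =
      (Fin.cons 0 (Fin.cons 0 fun i => (rootArrow i).1) : Fin 14 → ℝ) i • b i := by
    rw [hb]
    refine Fin.cases (by simp) (Fin.cases (by simp [hk]) fun i => ?_)
    simpa using (hR i).1
  have hd₂ : ∀ i, ⁅k₂, b i⁆ =
      (Fin.cons 0 (Fin.cons 0 fun i => (rootArrow i).2) : Fin 14 → ℝ) i • b i := by
    rw [hb]
    refine Fin.cases (by simp [hk']) (Fin.cases (by simp) fun i => ?_)
    simpa using (hR i).2
  have hs : √3 * √3 = (3 : ℝ) := Real.mul_self_sqrt (by norm_num)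
  refine ⟨φ.range, R, k₁, k₂, fun X => ?_, coe_rootVF, rfl, rfl, hli, hsp, ?_,
    ⟨(LieEquiv.ofInjective φ hinj).symm⟩, exists_isCartanSubalgebra b hb hk hR ?_, hk, hR, ?_, ?_⟩
  · refine ⟨fun h => span_basisVF_le_symmetries ((hmem X).1 h), fun h => ?_⟩
    -- Completeness of the list is the local classification applied on the whole space.
    obtain ⟨Y, hY, hXY⟩ := exists_eqOn_of_isSymmetryOn isOpen_univ isPreconnected_univ
      (contDiff_coe X).contDiffOn h
    have : X = Y := Subtype.ext (eqOn_univ _ _ |>.1 hXY)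
    exact (hmem X).2 (this ▸ hY)
  · intro U hU hc X hX h
    obtain ⟨Y, hY, hXY⟩ := exists_eqOn_of_isSymmetryOn hU hc hX h
    exact ⟨Y, (hmem Y).2 hY, hXY⟩
  · intro i
    fin_cases i <;> simp [rootArrow]
  -- The Killing form on the Cartan subalgebra is the sum over roots of products of weights. By the
  -- symmetry of the diagram Σαβ = 0, and below Σα² = Σβ² = 12.
  · rw [killingForm_apply_of_diagonal b _ _ hd₁ hd₂]
    simp [Fin.sum_univ_succ, rootArrow]
  · rw [killingForm_apply_of_diagonal b _ _ hd₁ hd₁, killingForm_apply_of_diagonal b _ _ hd₂ hd₂]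
    simp [Fin.sum_univ_succ, rootArrow]
    linarith

/-! ### The contact structure of `G₂` type -/

/-- The identification of the binary cubics with the contact hyperplane at `u`. -/
noncomputable def cubicFrame (u : J) : (Fin 4 → ℝ) →L[ℝ] J :=
  LinearMap.toContinuousLinearMap
    { toFun := fun a => ![9 * a 0 + 1 / 12 * a 3, 1 / 2 * a 2,
        u 3 * (9 * a 0 + 1 / 12 * a 3) + u 4 * (1 / 2 * a 2), 1 / 9 * a 3, 6 * a 1]
      map_add' := fun a b => by
        ext i
        fin_cases i <;> simp <;> ring
      map_smul' := fun c a => by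
        ext i
        fin_cases i <;> simp <;> ring }

theorem cubicFrame_apply (u : J) (a : Fin 4 → ℝ) : cubicFrame u a =
    ![9 * a 0 + 1 / 12 * a 3, 1 / 2 * a 2,
      u 3 * (9 * a 0 + 1 / 12 * a 3) + u 4 * (1 / 2 * a 2), 1 / 9 * a 3, 6 * a 1] := rfl

theorem contDiff_cubicFrame : ContDiff ℝ ∞ cubicFrame := by
  rw [contDiff_clm_apply_iff]
  intro a
  simp only [cubicFrame_apply]
  rw [contDiff_pi]
  intro i
  fin_cases i <;> simp <;> fun_prop

theorem extD_varpi (u v w : J) :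
    extD varpi u v w = v 0 * w 3 - v 3 * w 0 + (v 1 * w 4 - v 4 * w 1) := by
  unfold extD varpi
  simp (disch := fun_prop) [fderiv_fun_sub, fderiv_fun_mul, fderiv_coord]
  ring

theorem isG2Contact_varpi_upsilon : IsG2Contact varpi upsilon := by
  refine ⟨cubicFrame, fun _ => 1, fun _ => 144, contDiff_cubicFrame, fun u =>
    ⟨?_, ?_, one_ne_zero, by norm_num, fun a b => ?_, fun a => ?_⟩⟩
  · rw [injective_iff_map_eq_zero]
    intro a ha
    rw [cubicFrame_apply] at ha
    have e0 := congrFun ha 0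
    have e1 := congrFun ha 1
    have e3 := congrFun ha 3
    have e4 := congrFun ha 4
    simp at e0 e1 e3 e4
    ext i
    fin_cases i <;> simp <;> linarith
  · ext v
    constructor
    · rintro ⟨a, rfl⟩
      simp [cubicFrame_apply, varpi]
    · intro hv
      have hv' : v 2 - u 3 * v 0 - u 4 * v 1 = 0 := hv
      -- The inverse of the frame: dx - (3/4)dp is the coordinate along A, and the scalings 1/9,
      -- 1/6, 2, 9 normalise the discriminant.
      refine ⟨![(v 0 - 3 / 4 * v 3) / 9, v 4 / 6, 2 * v 1, 9 * v 3], ?_⟩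
      rw [cubicFrame_apply]
      ext i
      fin_cases i <;> simp <;> linarith
  · rw [extD_varpi, cubicFrame_apply, cubicFrame_apply]
    simp [cubicSymp]
    ring
  · rw [upsilon, cubicFrame_apply]
    simp [upsilonPoly, cubicDisc]
    ring

/-! ### The solution of Noth's equation -/

/-- The `t`-component of the curve in terms of the cube root of its parameter. -/
noncomputable def cbrtT (c : ℝ) : ℝ := 2 * c / (c ^ 3 + 2)

/-- The two branches of the curve, in terms of the cube root of the parameter. -/
def IsBranch (K : Set ℝ) : Prop := K = Ioo 0 1 ∨ K = Ioi 1

/-- The inverse of `cbrtT` on a branch. -/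
noncomputable def cbrtInv (K : Set ℝ) : ℝ → ℝ := Function.invFunOn cbrtT K

theorem hasStrictDerivAt_cbrtT {c : ℝ} (hc : c ^ 3 + 2 ≠ 0) :
    HasStrictDerivAt cbrtT (4 * (1 - c ^ 3) / (c ^ 3 + 2) ^ 2) c := by
  have h := ((hasStrictDerivAt_id c).const_mul 2).div
    ((hasStrictDerivAt_pow 3 c).add_const 2) hc
  refine h.congr_deriv ?_
  simp only [id]
  push_cast
  ring

/-! ### Inverting t(c) on a branch. -/

namespace IsBranch

variable {K : Set ℝ}

theorem isOpen (hK : IsBranch K) : IsOpen K := by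
  rcases hK with rfl | rfl
  exacts [isOpen_Ioo, isOpen_Ioi]

theorem pos (hK : IsBranch K) {c : ℝ} (hc : c ∈ K) : 0 < c := by
  rcases hK with rfl | rfl
  exacts [hc.1, one_pos.trans hc]

theorem add_ne (hK : IsBranch K) {c : ℝ} (hc : c ∈ K) : c ^ 3 + 2 ≠ 0 := by
  have := hK.pos hc
  positivity

theorem sub_ne (hK : IsBranch K) {c : ℝ} (hc : c ∈ K) : 1 - c ^ 3 ≠ 0 := by
  intro h
  have h1 : c ^ 3 = 1 := by linarith
  have h2 : c = 1 := (pow_eq_one_iff_of_nonneg (hK.pos hc).le (by norm_num)).1 h1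
  subst h2
  rcases hK with rfl | rfl
  exacts [lt_irrefl _ hc.2, lt_irrefl _ (mem_Ioi.1 hc)]

theorem injOn (hK : IsBranch K) : InjOn cbrtT K := by
  intro a ha b hb h
  have pa := hK.pos ha
  have pb := hK.pos hb
  -- The second factor cannot vanish: ab(a + b) is less than 2 on (0, 1) and greater than 2 on (1,
  -- ∞).
  have h' : (a - b) * (2 - a * b * (a + b)) = 0 := by
    rw [cbrtT, cbrtT, div_eq_div_iff (hK.add_ne ha) (hK.add_ne hb)] at h
    linear_combination h / 2
  rcases mul_eq_zero.1 h' with h0 | h0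
  · exact sub_eq_zero.1 h0
  · exfalso
    rcases hK with rfl | rfl
    · nlinarith [ha.2, hb.2, mul_pos pa pb, mul_lt_one_of_nonneg_of_lt_one_left pa.le ha.2 hb.2.le]
    · have h1 : 1 < a * b := by nlinarith [mem_Ioi.1 ha, mem_Ioi.1 hb]
      nlinarith [mem_Ioi.1 ha, mem_Ioi.1 hb]

theorem cbrtInv_cbrtT (hK : IsBranch K) {c : ℝ} (hc : c ∈ K) : cbrtInv K (cbrtT c) = c :=
  hK.injOn.leftInvOn_invFunOn hc

theorem map_nhds (hK : IsBranch K) {c : ℝ} (hc : c ∈ K) :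
    Filter.map cbrtT (𝓝 c) = 𝓝 (cbrtT c) :=
  (hasStrictDerivAt_cbrtT (hK.add_ne hc)).map_nhds_eq
    (div_ne_zero (mul_ne_zero four_ne_zero (hK.sub_ne hc)) (pow_ne_zero _ (hK.add_ne hc)))

theorem isOpen_image (hK : IsBranch K) : IsOpen (cbrtT '' K) := by
  rw [isOpen_iff_mem_nhds]
  rintro _ ⟨c, hc, rfl⟩
  rw [← hK.map_nhds hc]
  exact Filter.image_mem_map (hK.isOpen.mem_nhds hc)

theorem hasDerivAt_cbrtInv (hK : IsBranch K) {c : ℝ} (hc : c ∈ K) :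
    HasDerivAt (cbrtInv K) ((c ^ 3 + 2) ^ 2 / (4 * (1 - c ^ 3))) (cbrtT c) := by
  have hcont : ContinuousAt (cbrtInv K) (cbrtT c) := by
    rw [ContinuousAt, hK.cbrtInv_cbrtT hc, ← hK.map_nhds hc, Filter.tendsto_map'_iff]
    refine Filter.tendsto_id.congr' ?_
    filter_upwards [hK.isOpen.mem_nhds hc] with x hx
    exact (hK.cbrtInv_cbrtT hx).symm
  have h := HasDerivAt.of_local_left_inverse (f := cbrtT) (g := cbrtInv K) (a := cbrtT c)
    (f' := 4 * (1 - c ^ 3) / (c ^ 3 + 2) ^ 2) hcont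
    (by rw [hK.cbrtInv_cbrtT hc]; exact (hasStrictDerivAt_cbrtT (hK.add_ne hc)).hasDerivAt)
    (div_ne_zero (mul_ne_zero four_ne_zero (hK.sub_ne hc)) (pow_ne_zero _ (hK.add_ne hc)))
    (by
      filter_upwards [hK.isOpen_image.mem_nhds ⟨c, hc, rfl⟩] with t ht
      obtain ⟨x, hx, rfl⟩ := ht
      rw [hK.cbrtInv_cbrtT hx])
  rwa [inv_div] at h

theorem hasDerivAt_comp (hK : IsBranch K) {R : ℝ → ℝ} {r c : ℝ} (hc : c ∈ K)
    (h : HasDerivAt R r c) :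
    HasDerivAt (fun t => R (cbrtInv K t)) (r * ((c ^ 3 + 2) ^ 2 / (4 * (1 - c ^ 3))))
      (cbrtT c) :=
  HasDerivAt.comp (cbrtT c) (by rwa [hK.cbrtInv_cbrtT hc]) (hK.hasDerivAt_cbrtInv hc)

theorem contDiffOn_cbrtInv (hK : IsBranch K) : ContDiffOn ℝ ∞ (cbrtInv K) (cbrtT '' K) := by
  rw [contDiffOn_infty]
  have hd : DifferentiableOn ℝ (cbrtInv K) (cbrtT '' K) := by
    rintro _ ⟨c, hc, rfl⟩
    exact (hK.hasDerivAt_cbrtInv hc).differentiableAt.differentiableWithinAt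
  intro n
  -- Bootstrapping: the derivative of the inverse is a smooth function of c composed with the
  -- inverse itself, so each degree of smoothness yields the next.
  induction n with
  | zero => exact contDiffOn_zero.2 hd.continuousOn
  | succ n ih =>
    push_cast
    rw [contDiffOn_succ_iff_deriv_of_isOpen hK.isOpen_image]
    refine ⟨hd, by simp, ?_⟩
    have hφ : ContDiffOn ℝ n (fun c : ℝ => (c ^ 3 + 2) ^ 2 / (4 * (1 - c ^ 3))) K :=
      ContDiffOn.div (by fun_prop) (by fun_prop) fun c hc =>
        mul_ne_zero four_ne_zero (hK.sub_ne hc)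
    refine (hφ.comp ih ?_).congr ?_
    · rintro _ ⟨c, hc, rfl⟩
      rwa [hK.cbrtInv_cbrtT hc]
    · rintro _ ⟨c, hc, rfl⟩
      rw [(hK.hasDerivAt_cbrtInv hc).deriv, Function.comp_apply, hK.cbrtInv_cbrtT hc]

theorem iteratedDeriv_succ_comp (hK : IsBranch K) {H R R' : ℝ → ℝ} {n : ℕ}
    (hn : ∀ c ∈ K, iteratedDeriv n H (cbrtT c) = R c) (hR : ∀ c ∈ K, HasDerivAt R (R' c) c) :
    ∀ c ∈ K, iteratedDeriv (n + 1) H (cbrtT c) =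
      R' c * ((c ^ 3 + 2) ^ 2 / (4 * (1 - c ^ 3))) := by
  intro c hc
  rw [iteratedDeriv_succ, ← (hK.hasDerivAt_comp hc (hR c hc)).deriv]
  refine Filter.EventuallyEq.deriv_eq ?_
  filter_upwards [hK.isOpen_image.mem_nhds ⟨c, hc, rfl⟩]
  rintro _ ⟨x, hx, rfl⟩
  rw [hn x hx, hK.cbrtInv_cbrtT hx]

/-- Each d/dt raises the power of c³ + 2 by one and that of 1 - c³ by two, so only the polynomial
numerator has to be tracked. The exponents are written as successors to keep the power rule free of
truncated subtraction. -/
theorem iteratedDeriv_succ_of_eq (hK : IsBranch K) {H N N' : ℝ → ℝ} {n k m : ℕ}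
    (hn : ∀ c ∈ K, iteratedDeriv n H (cbrtT c) =
      (c ^ 3 + 2) ^ (k + 1) * N c / (1 - c ^ 3) ^ (m + 1))
    (hN : ∀ c, HasDerivAt N (N' c) c) :
    ∀ c ∈ K, iteratedDeriv (n + 1) H (cbrtT c) = (c ^ 3 + 2) ^ (k + 2) *
      ((3 * (k + 1) * c ^ 2 * N c * (1 - c ^ 3) + (c ^ 3 + 2) * N' c * (1 - c ^ 3) +
        3 * (m + 1) * c ^ 2 * (c ^ 3 + 2) * N c) / 4) / (1 - c ^ 3) ^ (m + 3) := by
  intro c hc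
  have hQ := hK.sub_ne hc
  rw [hK.iteratedDeriv_succ_comp hn (fun x hx => ((((hasDerivAt_pow 3 x).add_const 2).fun_pow
    (k + 1)).fun_mul (hN x)).fun_div (((hasDerivAt_pow 3 x).const_sub 1).fun_pow (m + 1))
    (pow_ne_zero _ (hK.sub_ne hx))) c hc]
  simp only [Nat.add_sub_cancel, Nat.cast_add, Nat.cast_one]
  field_simp
  push_cast
  ring

end IsBranch

/-- The `H`-component of the curve in terms of the cube root of its parameter. -/
noncomputable def cbrtH (c : ℝ) : ℝ := -4 * c ^ 2 / (c ^ 3 + 2)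

/-- The solution of Noth's equation whose graph is a branch of the curve. -/
noncomputable def nothSol (K : Set ℝ) (t : ℝ) : ℝ := cbrtH (cbrtInv K t)

/-! ### The derivatives of H up to order six and the associated tensor. -/

namespace IsBranch

variable {K : Set ℝ}

theorem contDiffOn_nothSol (hK : IsBranch K) : ContDiffOn ℝ ∞ (nothSol K) (cbrtT '' K) := by
  have h : ContDiffOn ℝ ∞ cbrtH K :=
    ContDiffOn.div (by fun_prop) (by fun_prop) fun c hc => hK.add_ne hc
  refine h.comp hK.contDiffOn_cbrtInv ?_
  rintro _ ⟨c, hc, rfl⟩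
  rwa [hK.cbrtInv_cbrtT hc]

theorem nothSol_cbrtT (hK : IsBranch K) {c : ℝ} (hc : c ∈ K) :
    nothSol K (cbrtT c) = cbrtH c := by rw [nothSol, hK.cbrtInv_cbrtT hc]

theorem iteratedDeriv_one (hK : IsBranch K) :
    ∀ c ∈ K, iteratedDeriv 1 (nothSol K) (cbrtT c) = (c ^ 4 - 4 * c) / (1 - c ^ 3) := by
  intro c hc
  have hP := hK.add_ne hc
  have hQ := hK.sub_ne hc
  rw [hK.iteratedDeriv_succ_comp (n := 0) (R := cbrtH)
    (fun x hx => by rw [iteratedDeriv_zero, hK.nothSol_cbrtT hx])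
    (fun x hx => ((hasDerivAt_pow 2 x).const_mul (-4)).fun_div ((hasDerivAt_pow 3 x).add_const 2)
      (hK.add_ne hx)) c hc]
  push_cast
  field_simp
  ring

theorem deriv_nothSol (hK : IsBranch K) {c : ℝ} (hc : c ∈ K) :
    deriv (nothSol K) (cbrtT c) = (c ^ 4 - 4 * c) / (1 - c ^ 3) := by
  rw [← iteratedDeriv_one hK c hc, _root_.iteratedDeriv_one]

theorem iteratedDeriv_two (hK : IsBranch K) :
    ∀ c ∈ K, iteratedDeriv 2 (nothSol K) (cbrtT c) =
      (c ^ 3 + 2) ^ 4 * (-(1 / 4)) / (1 - c ^ 3) ^ 3 := by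
  intro c hc
  have hQ := hK.sub_ne hc
  rw [hK.iteratedDeriv_succ_comp hK.iteratedDeriv_one
    (fun x hx => ((hasDerivAt_pow 4 x).fun_sub ((hasDerivAt_id' x).const_mul 4)).fun_div
      ((hasDerivAt_pow 3 x).const_sub 1) (hK.sub_ne hx)) c hc]
  push_cast
  field_simp
  ring

theorem iteratedDeriv_three (hK : IsBranch K) :
    ∀ c ∈ K, iteratedDeriv 3 (nothSol K) (cbrtT c) =
      (c ^ 3 + 2) ^ 5 * (3 / 16 * c ^ 5 - 15 / 8 * c ^ 2) / (1 - c ^ 3) ^ 5 := by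
  intro c hc
  rw [hK.iteratedDeriv_succ_of_eq (k := 3) (m := 2) hK.iteratedDeriv_two
    (fun x => hasDerivAt_const x _) c hc]
  push_cast
  ring

theorem iteratedDeriv_four (hK : IsBranch K) :
    ∀ c ∈ K, iteratedDeriv 4 (nothSol K) (cbrtT c) =
      (c ^ 3 + 2) ^ 6 * (-15 / 64 * c ^ 10 + 45 / 16 * c ^ 7 - 315 / 16 * c ^ 4 - 15 / 8 * c) /
        (1 - c ^ 3) ^ 7 := by
  intro c hc
  rw [hK.iteratedDeriv_succ_of_eq (k := 4) (m := 4) hK.iteratedDeriv_three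
    (fun x => ((hasDerivAt_pow 5 x).const_mul (3 / 16)).fun_sub
      ((hasDerivAt_pow 2 x).const_mul (15 / 8))) c hc]
  push_cast
  ring

theorem iteratedDeriv_five (hK : IsBranch K) :
    ∀ c ∈ K, iteratedDeriv 5 (nothSol K) (cbrtT c) =
      (c ^ 3 + 2) ^ 7 * (105 / 256 * c ^ 15 - 735 / 128 * c ^ 12 + 2625 / 64 * c ^ 9 -
        8535 / 32 * c ^ 6 - 2145 / 32 * c ^ 3 - 15 / 16) / (1 - c ^ 3) ^ 9 := by
  intro c hc
  rw [hK.iteratedDeriv_succ_of_eq (k := 5) (m := 6) hK.iteratedDeriv_four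
    (fun x => ((((hasDerivAt_pow 10 x).const_mul (-15 / 64)).fun_add
      ((hasDerivAt_pow 7 x).const_mul (45 / 16))).fun_sub
      ((hasDerivAt_pow 4 x).const_mul (315 / 16))).fun_sub
      ((hasDerivAt_id' x).const_mul (15 / 8))) c hc]
  push_cast
  ring

theorem iteratedDeriv_six (hK : IsBranch K) :
    ∀ c ∈ K, iteratedDeriv 6 (nothSol K) (cbrtT c) =
      (c ^ 3 + 2) ^ 8 * (-945 / 1024 * c ^ 20 + 945 / 64 * c ^ 17 - 945 / 8 * c ^ 14 +
        82215 / 128 * c ^ 11 - 571725 / 128 * c ^ 8 - 16065 / 8 * c ^ 5 - 945 / 8 * c ^ 2) /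
        (1 - c ^ 3) ^ 11 := by
  intro c hc
  rw [hK.iteratedDeriv_succ_of_eq (k := 6) (m := 8) hK.iteratedDeriv_five
    (fun x => ((((((hasDerivAt_pow 15 x).const_mul (105 / 256)).fun_sub
      ((hasDerivAt_pow 12 x).const_mul (735 / 128))).fun_add
      ((hasDerivAt_pow 9 x).const_mul (2625 / 64))).fun_sub
      ((hasDerivAt_pow 6 x).const_mul (8535 / 32))).fun_sub
      ((hasDerivAt_pow 3 x).const_mul (2145 / 32))).sub_const (15 / 16)) c hc]
  push_cast
  ring

theorem solvesNoth (hK : IsBranch K) : SolvesNoth (nothSol K) (cbrtT '' K) := by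
  refine ⟨hK.contDiffOn_nothSol, ?_⟩
  rintro _ ⟨c, hc, rfl⟩
  have hQ := hK.sub_ne hc
  rw [hK.iteratedDeriv_two c hc, hK.iteratedDeriv_three c hc, hK.iteratedDeriv_four c hc,
    hK.iteratedDeriv_five c hc, hK.iteratedDeriv_six c hc]
  field_simp
  ring

/-- The primitive of the solution for which the structural forms annihilate the double roots. -/
theorem hasDerivAt_primitive (hK : IsBranch K) {c : ℝ} (hc : c ∈ K) :
    HasDerivAt (fun t => 8 / (cbrtInv K t ^ 3 + 2) ^ 2 - 16 / 3 / (cbrtInv K t ^ 3 + 2))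
      (nothSol K (cbrtT c)) (cbrtT c) := by
  have hP := hK.add_ne hc
  have hQ := hK.sub_ne hc
  have hd := (hasDerivAt_pow 3 c).add_const 2
  have h := hK.hasDerivAt_comp hc
    (((hasDerivAt_const c (8 : ℝ)).fun_div (hd.fun_pow 2) (pow_ne_zero _ hP)).fun_sub
      ((hasDerivAt_const c (16 / 3 : ℝ)).fun_div hd hP))
  refine h.congr_deriv ?_
  rw [hK.nothSol_cbrtT hc, cbrtH]
  push_cast
  field_simp
  ring

theorem isAssociatedToNoth (hK : IsBranch K) :
    IsAssociatedToNoth upsilon (nothSol K) (cbrtT '' K) := by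
  refine ⟨hK.isOpen_image, hK.solvesNoth,
    fun t => 8 / (cbrtInv K t ^ 3 + 2) ^ 2 - 16 / 3 / (cbrtInv K t ^ 3 + 2), ?_, ?_⟩
  · rintro _ ⟨c, hc, rfl⟩
    exact hK.hasDerivAt_primitive hc
  · rintro _ ⟨c, hc, rfl⟩ u v h₂ h₃
    have hP := hK.add_ne hc
    have hQ := hK.sub_ne hc
    rw [omega2, hK.deriv_nothSol hc, hK.nothSol_cbrtT hc, hK.cbrtInv_cbrtT hc] at h₂
    rw [omega3, hK.deriv_nothSol hc, hK.nothSol_cbrtT hc] at h₃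
    -- The integration constant of the primitive matters here: with this choice the dx-coefficient
    -- of ω₂ collapses to a single fraction. Solving for dp and dq then leaves a polynomial identity
    -- in c, dx and dy.
    have e₁ : cbrtT c ^ 2 * ((c ^ 4 - 4 * c) / (1 - c ^ 3)) - 2 * cbrtT c * cbrtH c +
        2 * (8 / (c ^ 3 + 2) ^ 2 - 16 / 3 / (c ^ 3 + 2)) = -4 / (3 * (1 - c ^ 3)) := by
      rw [cbrtT, cbrtH]
      field_simp
      ring
    have e₂ : cbrtH c - cbrtT c * ((c ^ 4 - 4 * c) / (1 - c ^ 3)) = 2 * c ^ 2 / (1 - c ^ 3) := by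
      rw [cbrtT, cbrtH]
      field_simp
      ring
    rw [e₁, e₂] at h₂
    rw [e₂] at h₃
    have k₃ : v 3 = 4 / (3 * (1 - c ^ 3)) * v 0 - 2 * c ^ 2 / (1 - c ^ 3) * v 1 := by
      linear_combination h₂
    have k₄ : v 4 = -(2 * c ^ 2 / (1 - c ^ 3)) * v 0 - (c ^ 4 - 4 * c) / (1 - c ^ 3) * v 1 := by
      linear_combination h₃
    rw [upsilon, upsilonPoly, k₃, k₄]
    field_simp
    ring

end IsBranch

/-! ### Return to the parameter s = c³. -/

theorem nothT_pow_three {c : ℝ} (hc : 0 < c) : nothT (c ^ 3) = cbrtT c := by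
  have h : (c ^ 3) ^ (1 / 3 : ℝ) = c := by
    rw [← Real.rpow_natCast, ← Real.rpow_mul hc.le]; norm_num
  rw [nothT, cbrtT, h]

theorem nothH_pow_three {c : ℝ} (hc : 0 < c) : nothH (c ^ 3) = cbrtH c := by
  have h : (c ^ 3) ^ (2 / 3 : ℝ) = c ^ 2 := by
    rw [← Real.rpow_natCast, ← Real.rpow_mul hc.le]; norm_num
  rw [nothH, cbrtH, h]
  ring

theorem exists_cbrt {s : ℝ} (hs : 0 < s) : ∃ c : ℝ, 0 < c ∧ c ^ 3 = s :=
  ⟨s ^ (1 / 3 : ℝ), Real.rpow_pos_of_pos hs _, by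
    rw [← Real.rpow_natCast, ← Real.rpow_mul hs.le]; norm_num⟩

theorem exists_isAssociatedToNoth {I : Set ℝ} (hI : IsBranch I) :
    ∃ H : ℝ → ℝ, (∀ s ∈ I, H (nothT s) = nothH s) ∧
      IsAssociatedToNoth upsilon H (nothT '' I) := by
  -- Cubing maps each branch onto itself, so the same interval serves for s and for c.
  have hpow : ∀ c : ℝ, 0 < c → (c ^ 3 ∈ I ↔ c ∈ I) := by
    intro c hc
    rcases hI with rfl | rfl
    · have : c ^ 3 < 1 ↔ c < 1 := pow_lt_one_iff_of_nonneg hc.le (by norm_num)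
      simp [hc, this]
    · have : 1 < c ^ 3 ↔ 1 < c := one_lt_pow_iff_of_nonneg hc.le (by norm_num)
      simp [this]
  have himage : nothT '' I = cbrtT '' I := by
    ext t
    constructor
    · rintro ⟨s, hs, rfl⟩
      obtain ⟨c, hc, rfl⟩ := exists_cbrt (hI.pos hs)
      exact ⟨c, (hpow c hc).1 hs, (nothT_pow_three hc).symm⟩
    · rintro ⟨c, hc, rfl⟩
      exact ⟨c ^ 3, (hpow c (hI.pos hc)).2 hc, nothT_pow_three (hI.pos hc)⟩
  refine ⟨nothSol I, fun s hs => ?_, himage ▸ hI.isAssociatedToNoth⟩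
  obtain ⟨c, hc, rfl⟩ := exists_cbrt (hI.pos hs)
  rw [nothT_pow_three hc, hI.nothSol_cbrtT ((hpow c hc).1 hs), nothH_pow_three hc]

end ContactG2

theorem mainTheorem2 :
    -- `[ϖ, Υ]` is a contact structure of type `G₂`
    IsG2Contact varpi upsilon ∧
    -- it is associated to the solution of Noth's equation parametrized by `(t, H)(s)`
    (∀ I : Set ℝ, I = Set.Ioo 0 1 ∨ I = Set.Ioi 1 →
      ∃ H : ℝ → ℝ, (∀ s ∈ I, H (nothT s) = nothH s) ∧
        IsAssociatedToNoth upsilon H (nothT '' I)) ∧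
    -- the symmetry algebra `𝔤`, with the fourteen fields in it
    ∃ (𝔤 : LieSubalgebra ℝ VF) (R : Fin 12 → 𝔤) (k₁ k₂ : 𝔤),
      (∀ X : VF, X ∈ 𝔤 ↔ IsSymmetryOn varpi upsilon Set.univ (X : J → J)) ∧
      (∀ i, ((R i : VF) : J → J) = rootField i) ∧
      ((k₁ : VF) : J → J) = h1 ∧ ((k₂ : VF) : J → J) = h2 ∧
      -- the fourteen fields are a basis of `𝔤`
      LinearIndependent ℝ (Fin.cons k₁ (Fin.cons k₂ R) : Fin 14 → 𝔤) ∧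
      Submodule.span ℝ (Set.range (Fin.cons k₁ (Fin.cons k₂ R) : Fin 14 → 𝔤)) = ⊤ ∧
      -- every locally defined symmetry is the restriction of an element of `𝔤`
      (∀ U : Set J, IsOpen U → IsPreconnected U → ∀ X : J → J, ContDiffOn ℝ (⊤ : ℕ∞) X U →
        IsSymmetryOn varpi upsilon U X → ∃ Y : VF, Y ∈ 𝔤 ∧ Set.EqOn X (Y : J → J) U) ∧
      -- `𝔤` is split `𝔤₂`
      Nonempty (𝔤 ≃ₗ⁅ℝ⁆ LieAlgebra.g₂ ℝ) ∧
      -- `h₁`, `h₂` span a Cartan subalgebra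
      (∃ C : LieSubalgebra ℝ 𝔤, C.toSubmodule = Submodule.span ℝ {k₁, k₂} ∧
        C.IsCartanSubalgebra) ∧
      -- the root diagram; `h₁`, `h₂` are orthogonal of equal length for the Killing form
      ⁅k₁, k₂⁆ = 0 ∧
      (∀ i, ⁅k₁, R i⁆ = (rootArrow i).1 • R i ∧ ⁅k₂, R i⁆ = (rootArrow i).2 • R i) ∧
      killingForm ℝ 𝔤 k₁ k₂ = 0 ∧ killingForm ℝ 𝔤 k₁ k₁ = killingForm ℝ 𝔤 k₂ k₂ :=
  ⟨isG2Contact_varpi_upsilon, fun _ hI => exists_isAssociatedToNoth hI, symmetry_algebra⟩
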